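/- Let $d\ge 1$ and let $\Omega\subset\mathbb R^d$ be a bounded domain (open, connected, non-empty) with Lipschitz boundary. Let $S_0,S_1\subset\Omega$ be disjoint measurable sets such that $\tilde\Omega:=\Omega\setminus(S_0\cup S_1)$ is open with Lipschitz boundary. Let $-1<\beta_1\le\beta_2<1$, $\varepsilon>0$, $\gamma>0$, and set $$\mathcal U=\{\varphi\in L^1(\Omega):\ \varphi=-1\text{ a.e. on }S_0,\ \varphi=1\text{ a.e. on }S_1\},$$ $$\mathcal G^\beta=\Big\{\varphi\in H^1(\tilde\Omega):\ |\varphi|\le 1\text{ a.e. in }\tilde\Omega,\ \beta_1|\tilde\Omega|\le\int_{\tilde\Omega}\varphi\,dx\le\beta_2|\tilde\Omega|\Big\}.$$ Let $\psi_0\in C^{1,1}_{loc}(\mathbb R)$ be such that $\psi=\psi_0+I_{[-1,1]}$ (with $I_{[-1,1]}=0$ on $[-1,1]$ and $+\infty$ elsewhere) has exactly the two global minimum points $\pm1$, with $\psi(\pm1)=0$, and a local maximum point in $(-1,1)$, and let $$E^\varepsilon(\varphi)=\int_{\tilde\Omega}\Big(\frac\varepsilon2|\nabla\varphi|^2+\frac1\varepsilon\psi_0(\varphi)\Big)dx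 .$$ Let $a_\varepsilon,b_\varepsilon,c_\varepsilon\in C^{1,1}_{loc}(\mathbb R)$ with $b_\varepsilon\ge0$ and $a_\varepsilon,c_\varepsilon>C_\varepsilon$ on $\mathbb R$ for some constant $C_\varepsilon>0$. Let $l\in\mathbb N$, let $1\le i_1<\dots<i_l$ be integers, and let $\Psi:(\mathbb R_{>0})^l\to\mathbb R$ be of class $C^1$ (not necessarily bounded below). For every $\varphi\in\mathcal G^\beta\cap\mathcal U$ the weak eigenvalue problems $$w\in H^1_0(\Omega),\quad\int_\Omega a_\varepsilon(\varphi)\nabla w\cdot\nabla\eta+b_\varepsilon(\varphi)w\eta\,dx=\lambda\int_\Omega c_\varepsilon(\varphi)w\eta\,dx\quad\forall\eta\in H^1_0(\Omega),$$ $$w\in H^1(\Omega),\quad\int_\Omega a_\varepsilon(\varphi)\nabla w\cdot\nabla\eta\,dx=\mu\int_\Omega c_\varepsilon(\varphi)w\eta\,dx\quad\forall\eta\in H^1(\Omega),$$ with $w\ne0$, have eigenvalues which, repeated according to their multiplicity, form sequences $0<\lambda_1^{\varepsilon,\varphi}\le\lambda_2^{\varepsilon,\varphi}\le\dots\to\infty$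 and $0=\mu_0^{\varepsilon,\varphi}<\mu_1^{\varepsilon,\varphi}\le\mu_2^{\varepsilon,\varphi}\le\dots\to\infty$, respectively. Moreover, the functionals $$J_l^{D,\varepsilon}(\varphi)=\Psi(\lambda_{i_1}^{\varepsilon,\varphi},\dots,\lambda_{i_l}^{\varepsilon,\varphi})+\gamma E^\varepsilon(\varphi),\qquad J_l^{N,\varepsilon}(\varphi)=\Psi(\mu_{i_1}^{\varepsilon,\varphi},\dots,\mu_{i_l}^{\varepsilon,\varphi})+\gamma E^\varepsilon(\varphi)$$ each attain their minimum over $\mathcal G^\beta\cap\mathcal U$: there are $\varphi^D,\varphi^N\in\mathcal G^\beta\cap\mathcal U$ with $J_l^{D,\varepsilon}(\varphi^D)\le J_l^{D,\varepsilon}(\varphi)$ and $J_l^{N,\varepsilon}(\varphi^N)\le J_l^{N,\varepsilon}(\varphi)$ for all $\varphi\in\mathcal G^\beta\cap\mathcal U$. -/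

import Mathlib

open MeasureTheory Filter Topology
open scoped ContDiff

namespace PhaseField

noncomputable section

/-! ### Domains with Lipschitz boundary -/

/-- `ℝᵈ` with the Euclidean norm. -/
abbrev Space (d : ℕ) : Type := EuclideanSpace ℝ (Fin d)

/-- The set `U` has Lipschitz boundary: near each boundary point, for a suitable unit vector `e`,
`U` is the strict epigraph, in direction `e`, of a Lipschitz function on the hyperplane
orthogonal to `e`. -/
def HasLipschitzBoundary {d : ℕ} (U : Set (Space d)) : Prop :=
  ∀ x ∈ frontier U, ∃ e : Space d, ‖e‖ = 1 ∧ ∃ r : ℝ, 0 < r ∧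
    ∃ (K : NNReal) (g : (ℝ ∙ e)ᗮ → ℝ), LipschitzWith K g ∧
      ∀ y ∈ Metric.ball x r,
        (y ∈ U ↔ g ((ℝ ∙ e)ᗮ.orthogonalProjectionOnto y) < inner ℝ e y)

/-! ### Sobolev spaces -/

/-- `η ∈ C_c^∞(U)`. -/
def IsTestFunction {d : ℕ} (U : Set (Space d)) (η : Space d → ℝ) : Prop :=
  ContDiff ℝ ∞ η ∧ HasCompactSupport η ∧ tsupport η ⊆ U

/-- `G` is the weak gradient of `f` in `U`: `∫_U f ∇η = - ∫_U η G` for all `η ∈ C_c^∞(U)`. -/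
def HasWeakGradient {d : ℕ} (U : Set (Space d)) (f : Space d → ℝ) (G : Space d → Space d) :
    Prop :=
  ∀ η : Space d → ℝ, IsTestFunction U η →
    ∫ x in U, f x • gradient η x = -∫ x in U, η x • G x

/-- Pairs `(w, G)` with `w ∈ L²(U)` and `G ∈ L²(U; ℝᵈ)`. -/
abbrev L2Pair {d : ℕ} (U : Set (Space d)) : Type :=
  Lp ℝ 2 (volume.restrict U) × Lp (Space d) 2 (volume.restrict U)

/-- The Sobolev space `H¹(U)`; a function `w` is represented by the pair `(w, ∇w)`, so that the
topology inherited from `L² × L²` is that of `H¹`. -/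
def sobolevH1 {d : ℕ} (U : Set (Space d)) : Set (L2Pair U) :=
  {p | HasWeakGradient U p.1 p.2}

/-- The Sobolev space `H¹₀(U)`, the closure of `C_c^∞(U)` in `H¹(U)`, again as pairs `(w, ∇w)`. -/
def sobolevH10 {d : ℕ} (U : Set (Space d)) : Set (L2Pair U) :=
  closure {p | ∃ η : Space d → ℝ, IsTestFunction U η ∧
    p.1 =ᵐ[volume.restrict U] η ∧ p.2 =ᵐ[volume.restrict U] gradient η}

/-- The restriction of `f` to `U` belongs to `H¹(U)`. -/
def MemH1 {d : ℕ} (U : Set (Space d)) (f : Space d → ℝ) : Prop :=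
  ∃ p ∈ sobolevH1 U, p.1 =ᵐ[volume.restrict U] f

/-- The weak gradient in `L²(U; ℝᵈ)` of a function with `MemH1 U f`. -/
def weakGradient {d : ℕ} (U : Set (Space d)) (f : Space d → ℝ) :
    Lp (Space d) 2 (volume.restrict U) :=
  Classical.epsilon fun G => ∃ p ∈ sobolevH1 U, p.1 =ᵐ[volume.restrict U] f ∧ p.2 = G

/-! ### Regularity of the coefficients and the potential -/

/-- `f ∈ C^{1,1}_loc(ℝ)`. -/
def IsC11Loc (f : ℝ → ℝ) : Prop :=
  Differentiable ℝ f ∧ LocallyLipschitz (deriv f)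

/-- The potential `ψ = ψ₀ + I_{[-1,1]}`. -/
def potential (ψ₀ : ℝ → ℝ) (x : ℝ) : EReal :=
  (ψ₀ x : EReal) + open Classical in if x ∈ Set.Icc (-1 : ℝ) 1 then 0 else ⊤

/-- `ψ₀ ∈ C^{1,1}_loc`, and `ψ = ψ₀ + I_{[-1,1]}` has precisely the global minimum points `±1`,
where it vanishes, and a local maximum point in between. -/
structure IsDoubleWell (ψ₀ : ℝ → ℝ) : Prop where
  regular : IsC11Loc ψ₀
  minimum_points : {x | ∀ y, potential ψ₀ x ≤ potential ψ₀ y} = {-1, 1}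
  minimum_value : potential ψ₀ (-1) = 0 ∧ potential ψ₀ 1 = 0
  local_max : ∃ x ∈ Set.Ioo (-1 : ℝ) 1, IsLocalMax (potential ψ₀) x

/-- The requirements on the coefficient functions. -/
structure AreCoefficients (a b c : ℝ → ℝ) : Prop where
  regular_a : IsC11Loc a
  regular_b : IsC11Loc b
  regular_c : IsC11Loc c
  lower_bound : ∃ C : ℝ, 0 < C ∧ ∀ x, C < a x ∧ C < c x
  nonneg_b : ∀ x, 0 ≤ b x

/-! ### Phase fields -/

/-- `L¹(Ω)`, the space in which phase fields live. -/
abbrev PhaseFields {d : ℕ} (Ω : Set (Space d)) : Type := Lp ℝ 1 (volume.restrict Ω)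

/-- The set `𝒰` of all `φ ∈ L¹(Ω)` with `φ = -1` a.e. on `S₀` and `φ = 1` a.e. on `S₁`. -/
def constraintU {d : ℕ} (Ω S₀ S₁ : Set (Space d)) : Set (PhaseFields Ω) :=
  {φ | (∀ᵐ x ∂(volume.restrict Ω), x ∈ S₀ → φ x = -1) ∧
    (∀ᵐ x ∂(volume.restrict Ω), x ∈ S₁ → φ x = 1)}

/-- The set `𝒢^β`: on `Ω' = Ω \ (S₀ ∪ S₁)`, `φ` is of class `H¹`, `|φ| ≤ 1` a.e., and
`β₁ |Ω'| ≤ ∫_{Ω'} φ ≤ β₂ |Ω'|`. -/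
def constraintG {d : ℕ} (Ω S₀ S₁ : Set (Space d)) (β₁ β₂ : ℝ) : Set (PhaseFields Ω) :=
  {φ | MemH1 (Ω \ (S₀ ∪ S₁)) φ ∧
    (∀ᵐ x ∂(volume.restrict (Ω \ (S₀ ∪ S₁))), |φ x| ≤ 1) ∧
    β₁ * volume.real (Ω \ (S₀ ∪ S₁)) ≤ ∫ x in Ω \ (S₀ ∪ S₁), φ x ∧
    ∫ x in Ω \ (S₀ ∪ S₁), φ x ≤ β₂ * volume.real (Ω \ (S₀ ∪ S₁))}

/-- The regular part `∫_{Ω'} (ε/2 |∇φ|² + ψ₀(φ)/ε)` of the Ginzburg-Landau energy on `Ω'`. -/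
def energy {d : ℕ} (Ω' : Set (Space d)) (ψ₀ : ℝ → ℝ) (ε : ℝ) (φ : Space d → ℝ) : ℝ :=
  ∫ x in Ω', (ε / 2 * ‖weakGradient Ω' φ x‖ ^ 2 + 1 / ε * ψ₀ (φ x))

/-! ### Eigenvalues -/

/-- The eigenfunctions `w ∈ H¹₀(Ω)` for `s` of
`-∇·[a(φ)∇w] + b(φ)w = s c(φ)w` in `Ω`, `w = 0` on `∂Ω`, in the weak sense. -/
def dirichletEigenfunctions {d : ℕ} (Ω : Set (Space d)) (a b c : ℝ → ℝ) (φ : PhaseFields Ω)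
    (s : ℝ) : Set (L2Pair Ω) :=
  {w | w ∈ sobolevH10 Ω ∧ w.1 ≠ 0 ∧ ∀ η ∈ sobolevH10 Ω,
    (∫ x in Ω, a (φ x) * inner ℝ (w.2 x) (η.2 x)) + (∫ x in Ω, b (φ x) * (w.1 x * η.1 x)) =
      s * ∫ x in Ω, c (φ x) * (w.1 x * η.1 x)}

/-- The eigenfunctions `w ∈ H¹(Ω)` for `s` of
`-∇·[a(φ)∇w] = s c(φ)w` in `Ω`, `∂w/∂ν = 0` on `∂Ω`, in the weak sense. -/
def neumannEigenfunctions {d : ℕ} (Ω : Set (Space d)) (a c : ℝ → ℝ) (φ : PhaseFields Ω)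
    (s : ℝ) : Set (L2Pair Ω) :=
  {w | w ∈ sobolevH1 Ω ∧ w.1 ≠ 0 ∧ ∀ η ∈ sobolevH1 Ω,
    (∫ x in Ω, a (φ x) * inner ℝ (w.2 x) (η.2 x)) = s * ∫ x in Ω, c (φ x) * (w.1 x * η.1 x)}

/-- `Λ 0 ≤ Λ 1 ≤ ⋯ → ∞` lists all eigenvalues of a problem whose eigenfunctions for the
value `s` form the set `eig s`, each eigenvalue repeated according to its multiplicity. In
particular every `Λ n` is an eigenvalue, and there are no further eigenvalues. -/
structure IsEigenvalueList {V : Type} [AddCommGroup V] [Module ℝ V] (eig : ℝ → Set V)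
    (Λ : ℕ → ℝ) : Prop where
  mono : Monotone Λ
  tendsto : Tendsto Λ atTop atTop
  multiplicity : ∀ s : ℝ,
    Cardinal.mk {n : ℕ // Λ n = s} = Module.rank ℝ (Submodule.span ℝ (eig s))

/-- There is at most one such list, so that the choices below are unambiguous. -/
theorem IsEigenvalueList.unique {V : Type} [AddCommGroup V] [Module ℝ V] {eig : ℝ → Set V}
    {Λ M : ℕ → ℝ} (hΛ : IsEigenvalueList eig Λ) (hM : IsEigenvalueList eig M) : Λ = M := by
  have key : ∀ {Λ M : ℕ → ℝ}, IsEigenvalueList eig Λ → IsEigenvalueList eig M →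
      ∀ n, Λ n ≤ M n := by
    intro Λ M hΛ hM n
    by_contra! h
    have hf : ∀ s, Nonempty ({k // M k = s} ≃ {k // Λ k = s}) := fun s =>
      Cardinal.eq.1 ((hM.multiplicity s).trans (hΛ.multiplicity s).symm)
    let σ : ℕ → ℕ := fun k => ((hf (M k)).some ⟨k, rfl⟩).1
    have hσ : ∀ k, Λ (σ k) = M k := fun k => ((hf (M k)).some ⟨k, rfl⟩).2
    have aux : ∀ (s : ℝ) (k j : ℕ) (hk : M k = s) (hj : M j = s),
        ((hf s).some ⟨k, hk⟩).1 = ((hf s).some ⟨j, hj⟩).1 → k = j := by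
      intro s k j hk hj e
      have := (hf s).some.injective (Subtype.ext e)
      exact congrArg Subtype.val this
    have hinj : Function.Injective σ := by
      intro k j e
      have hkj : M k = M j := by rw [← hσ k, ← hσ j, e]
      have e2 : σ j = ((hf (M k)).some ⟨j, hkj.symm⟩).1 := by
        simp only [σ]
        have : ∀ (s : ℝ) (hs : M j = s),
            ((hf (M j)).some ⟨j, rfl⟩).1 = ((hf s).some ⟨j, hs⟩).1 := by
          rintro _ rfl; rfl
        exact this _ hkj.symm
      exact aux (M k) k j rfl hkj.symm (e.trans e2)
    have hmaps : ∀ k ∈ Finset.range (n + 1), σ k ∈ Finset.range n := by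
      intro k hk
      rw [Finset.mem_range] at hk ⊢
      by_contra! hn
      have h1 := hΛ.mono hn
      have h2 := hM.mono (Nat.lt_succ_iff.1 hk)
      rw [hσ k] at h1
      linarith
    have := Finset.card_le_card_of_injOn σ hmaps hinj.injOn
    simp at this
  funext n
  exact le_antisymm (key hΛ hM n) (key hM hΛ n)

/-- The Dirichlet eigenvalues `λ_1^φ ≤ λ_2^φ ≤ ⋯` (the index `k` runs from `1`). -/
def dirichletEigenvalue {d : ℕ} (Ω : Set (Space d)) (a b c : ℝ → ℝ) (φ : PhaseFields Ω)
    (k : ℕ) : ℝ :=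
  Classical.epsilon (IsEigenvalueList (dirichletEigenfunctions Ω a b c φ)) (k - 1)

/-- The Neumann eigenvalues `μ_0^φ ≤ μ_1^φ ≤ ⋯` (the index `k` runs from `0`). -/
def neumannEigenvalue {d : ℕ} (Ω : Set (Space d)) (a c : ℝ → ℝ) (φ : PhaseFields Ω)
    (k : ℕ) : ℝ :=
  Classical.epsilon (IsEigenvalueList (neumannEigenfunctions Ω a c φ)) k

/-! ### Objective functionals -/

/-- `J^{D,ε}_l(φ) = Ψ(λ_{i_1}^φ, …, λ_{i_l}^φ) + γ E^ε(φ)`. -/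
def dirichletObjective {d : ℕ} (Ω S₀ S₁ : Set (Space d)) (a b c ψ₀ : ℝ → ℝ) (ε γ : ℝ) {l : ℕ}
    (i : Fin l → ℕ) (Ψ : (Fin l → ℝ) → ℝ) (φ : PhaseFields Ω) : ℝ :=
  Ψ (fun j => dirichletEigenvalue Ω a b c φ (i j)) + γ * energy (Ω \ (S₀ ∪ S₁)) ψ₀ ε φ

/-- `J^{N,ε}_l(φ) = Ψ(μ_{i_1}^φ, …, μ_{i_l}^φ) + γ E^ε(φ)`. -/
def neumannObjective {d : ℕ} (Ω S₀ S₁ : Set (Space d)) (a c ψ₀ : ℝ → ℝ) (ε γ : ℝ) {l : ℕ}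
    (i : Fin l → ℕ) (Ψ : (Fin l → ℝ) → ℝ) (φ : PhaseFields Ω) : ℝ :=
  Ψ (fun j => neumannEigenvalue Ω a c φ (i j)) + γ * energy (Ω \ (S₀ ∪ S₁)) ψ₀ ε φ

end

end PhaseField

/-! The proof is the direct method. It works without a lower bound on Ψ because the selected
eigenvalues are continuous along minimizing sequences and never leave a compact part of the positive
orthant.

Spectral side. Both problems become a pair of symmetric forms on V = H¹₀ or H¹, namely A(u,v) = ∫ a
∇u·∇v + b u v + c u v and C(u,v) = ∫ c u v. The added mass shifts every eigenvalue by 1 and makes A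
coercive in the Neumann case too. Since V embeds compactly in L², the Rayleigh quotient can be
minimized successively on C-orthogonal complements (`FormPair.exists_eigenSystem`). The minimum
property recorded in `IsEigenSystem` then yields the multiplicities (`IsEigenSystem.mk_eq_rank`) and
all comparisons. If φₙ → φ a.e. with |φₙ| ≤ 1, dominated convergence gives convergence of the forms
for each fixed argument. This suffices for λ_k(φₙ) → λ_k(φ) (`IsEigenSystem.tendsto_eigenvalue`):
the eigenvectors of the limit are a trial space for the upper bound, and the weak limits of the
eigenvectors, still C-orthonormal by compactness, are one for the lower bound.

Uniform bounds. Comparison with the problem a = c = 1, b = 0 confines λ_k(φ) to an interval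
independent of φ. Its lower end is positive by Poincaré's inequality (Dirichlet), or by
connectedness for k ≥ 1 (Neumann). So Ψ is evaluated on a compact box, where continuity bounds it.

Analysis. Rellich's theorem, Poincaré's inequality and the constancy of functions with zero gradient
all come from one estimate, ‖f(· + z) − f‖ ≤ |z| ‖∇f‖ (`eLpNorm_translate_sub_le`), proved by
duality with test functions. No extension operator is used: near a Lipschitz boundary one translates
into the domain.

Minimization. On Ω' = Ω \ (S₀ ∪ S₁) the energy controls the H¹ norm, so Rellich gives a subsequence
converging a.e., while on S₀ and S₁ admissible fields coincide. The gradient term is weakly lower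
semicontinuous and the potential term is continuous (`IsDesign.exists_subseq`,
`IsDesign.exists_isMinOn`). -/

namespace PhaseField

noncomputable section

/-! ### Weak convergence in Hilbert spaces -/

section Weak

variable {V : Type*} [NormedAddCommGroup V] [InnerProductSpace ℝ V]

/-- The sequence `u` converges weakly to `v`. -/
def WeakTendsto (u : ℕ → V) (v : V) : Prop :=
  ∀ y, Tendsto (fun n => inner ℝ (u n) y) atTop (𝓝 (inner ℝ v y))

theorem WeakTendsto.comp {u : ℕ → V} {v : V} (h : WeakTendsto u v) {σ : ℕ → ℕ}
    (hσ : Tendsto σ atTop atTop) : WeakTendsto (u ∘ σ) v :=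
  fun y => (h y).comp hσ

theorem WeakTendsto.const_smul {u : ℕ → V} {v : V} (h : WeakTendsto u v) (c : ℝ) :
    WeakTendsto (fun n => c • u n) (c • v) := fun y => by
  simpa only [inner_smul_left, RCLike.conj_to_real] using (h y).const_mul c

theorem WeakTendsto.sum {ι : Type*} (s : Finset ι) {u : ι → ℕ → V} {v : ι → V}
    (h : ∀ i ∈ s, WeakTendsto (u i) (v i)) :
    WeakTendsto (fun n => ∑ i ∈ s, u i n) (∑ i ∈ s, v i) := fun y => by
  simpa only [sum_inner] using tendsto_finsetSum s fun i hi => h i hi y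

variable [CompleteSpace V]

theorem WeakTendsto.apply {u : ℕ → V} {v : V} (h : WeakTendsto u v) (f : V →L[ℝ] ℝ) :
    Tendsto (fun n => f (u n)) atTop (𝓝 (f v)) := by
  have e : ∀ x, inner ℝ x ((InnerProductSpace.toDual ℝ V).symm f) = f x := fun x => by
    rw [real_inner_comm, InnerProductSpace.toDual_symm_apply]
  simpa only [e] using h ((InnerProductSpace.toDual ℝ V).symm f)

theorem WeakTendsto.apply_of_bound {u : ℕ → V} {v : V} (h : WeakTendsto u v) (f : V →ₗ[ℝ] ℝ)
    (K : ℝ) (hf : ∀ x, |f x| ≤ K * ‖x‖) : Tendsto (fun n => f (u n)) atTop (𝓝 (f v)) :=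
  h.apply (f.mkContinuous K hf)

theorem WeakTendsto.map {W : Type*} [NormedAddCommGroup W] [InnerProductSpace ℝ W]
    {u : ℕ → V} {v : V} (h : WeakTendsto u v) (T : V →L[ℝ] W) :
    WeakTendsto (fun n => T (u n)) (T v) := fun y => by
  simpa [real_inner_comm] using h.apply ((innerSL ℝ y).comp T)

/-- Sequential Banach–Alaoglu needs separability, so it is applied in the closed span of the
sequence. A test vector acts on this span only through its orthogonal projection. -/
theorem exists_weakTendsto_subseq {u : ℕ → V} {M : ℝ} (hu : ∀ n, ‖u n‖ ≤ M) :
    ∃ v, ∃ σ : ℕ → ℕ, StrictMono σ ∧ WeakTendsto (u ∘ σ) v := by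
  let K : Submodule ℝ V := (Submodule.span ℝ (Set.range u)).topologicalClosure
  have hK : IsClosed (K : Set V) := Submodule.isClosed_topologicalClosure _
  have : CompleteSpace K := hK.completeSpace_coe
  have : TopologicalSpace.SeparableSpace K := by
    have h1 : TopologicalSpace.IsSeparable (Submodule.span ℝ (Set.range u) : Set V) :=
      (Set.countable_range u).isSeparable.span
    exact h1.closure.separableSpace
  have hmem : ∀ n, u n ∈ K := fun n =>
    Submodule.le_topologicalClosure _ (Submodule.subset_span ⟨n, rfl⟩)
  let u' : ℕ → K := fun n => ⟨u n, hmem n⟩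
  let L : ℕ → WeakDual ℝ K := fun n =>
    StrongDual.toWeakDual (InnerProductSpace.toDual ℝ K (u' n))
  have hL : ∀ n, L n ∈ WeakDual.toStrongDual ⁻¹' Metric.closedBall (0 : StrongDual ℝ K) M := by
    intro n
    have h : ‖InnerProductSpace.toDual ℝ K (u' n)‖ ≤ M := by
      rw [LinearIsometryEquiv.norm_map]
      exact hu n
    exact mem_closedBall_zero_iff.2 h
  obtain ⟨f, -, σ, hσ, hf⟩ := WeakDual.isSeqCompact_closedBall ℝ K (0 : StrongDual ℝ K) M hL
  refine ⟨(InnerProductSpace.toDual ℝ K).symm (WeakDual.toStrongDual f), σ, hσ, fun y => ?_⟩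
  have h1 := ((WeakDual.eval_continuous (𝕜 := ℝ) (K.orthogonalProjectionOnto y)).tendsto f).comp hf
  have key : ∀ x : K, inner ℝ (x : V) y = inner ℝ x (K.orthogonalProjectionOnto y) := fun x =>
    (Submodule.inner_orthogonalProjectionOnto_eq_of_mem_left x y).symm
  have h2 : inner ℝ (((InnerProductSpace.toDual ℝ K).symm (WeakDual.toStrongDual f) : K) : V) y =
      f (K.orthogonalProjectionOnto y) := by
    rw [key, InnerProductSpace.toDual_symm_apply]; rfl
  rw [h2]
  refine h1.congr fun n => ?_
  exact (key (u' (σ n))).symm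

end Weak

/-! ### Pairs of quadratic forms -/

section Forms

variable {V H : Type*} [NormedAddCommGroup V] [InnerProductSpace ℝ V]
  [NormedAddCommGroup H] [InnerProductSpace ℝ H]

/-- `J` maps bounded weakly convergent sequences to strongly convergent ones. -/
def CompletelyContinuous (J : V →L[ℝ] H) : Prop :=
  ∀ (M : ℝ) (u : ℕ → V) (v : V), (∀ n, ‖u n‖ ≤ M) → WeakTendsto u v →
    Tendsto (fun n => J (u n)) atTop (𝓝 (J v))

/-- `A` is a symmetric, bounded, coercive form and `C` a symmetric form equivalent to the square
of the seminorm `‖J u‖`. -/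
structure FormPair (J : V →L[ℝ] H) (m M : ℝ) (A C : V →ₗ[ℝ] V →ₗ[ℝ] ℝ) : Prop where
  pos : 0 < m
  symm_A : ∀ u v, A u v = A v u
  symm_C : ∀ u v, C u v = C v u
  coercive : ∀ u, m * ‖u‖ ^ 2 ≤ A u u
  bound_A : ∀ u v, |A u v| ≤ M * ‖u‖ * ‖v‖
  lower_C : ∀ u, m * ‖J u‖ ^ 2 ≤ C u u
  bound_C : ∀ u v, |C u v| ≤ M * ‖J u‖ * ‖J v‖

/-- The forms `A n` converge to `B` strongly. -/
def FormTendsto (A : ℕ → V →ₗ[ℝ] V →ₗ[ℝ] ℝ) (B : V →ₗ[ℝ] V →ₗ[ℝ] ℝ) : Prop :=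
  ∀ v, ∃ δ : ℕ → ℝ, Tendsto δ atTop (𝓝 0) ∧ ∀ n u, |A n u v - B u v| ≤ δ n * ‖u‖

theorem FormTendsto.const (B : V →ₗ[ℝ] V →ₗ[ℝ] ℝ) : FormTendsto (fun _ => B) B :=
  fun _ => ⟨fun _ => 0, tendsto_const_nhds, by simp⟩

theorem FormTendsto.add {A A' : ℕ → V →ₗ[ℝ] V →ₗ[ℝ] ℝ} {B B' : V →ₗ[ℝ] V →ₗ[ℝ] ℝ}
    (h : FormTendsto A B) (h' : FormTendsto A' B') :
    FormTendsto (fun n => A n + A' n) (B + B') := fun v => by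
  obtain ⟨δ, h0, h1⟩ := h v
  obtain ⟨δ', h0', h1'⟩ := h' v
  refine ⟨fun n => δ n + δ' n, by simpa using h0.add h0', fun n u => ?_⟩
  rw [LinearMap.add_apply, LinearMap.add_apply, LinearMap.add_apply, LinearMap.add_apply,
    add_sub_add_comm, add_mul]
  exact (abs_add_le _ _).trans (add_le_add (h1 n u) (h1' n u))

theorem FormTendsto.comp {A : ℕ → V →ₗ[ℝ] V →ₗ[ℝ] ℝ} {B : V →ₗ[ℝ] V →ₗ[ℝ] ℝ}
    (h : FormTendsto A B) {σ : ℕ → ℕ} (hσ : Tendsto σ atTop atTop) :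
    FormTendsto (fun n => A (σ n)) B := fun v => by
  obtain ⟨δ, h0, h1⟩ := h v
  exact ⟨δ ∘ σ, h0.comp hσ, fun n u => h1 (σ n) u⟩

theorem FormTendsto.apply {A : ℕ → V →ₗ[ℝ] V →ₗ[ℝ] ℝ} {B : V →ₗ[ℝ] V →ₗ[ℝ] ℝ}
    (h : FormTendsto A B) (u v : V) : Tendsto (fun n => A n u v) atTop (𝓝 (B u v)) := by
  obtain ⟨δ, h0, h1⟩ := h v
  rw [tendsto_iff_norm_sub_tendsto_zero]
  refine squeeze_zero (fun n => norm_nonneg _) (fun n => h1 n u) ?_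
  simpa using h0.mul_const ‖u‖

/-- Replacing the n-th form by its limit costs δₙ‖uₙ‖, because the second slot is fixed; the limit
form is weakly continuous in the first slot. -/
theorem FormTendsto.apply_weak [CompleteSpace V] {A : ℕ → V →ₗ[ℝ] V →ₗ[ℝ] ℝ}
    {B : V →ₗ[ℝ] V →ₗ[ℝ] ℝ}
    (h : FormTendsto A B) {K : ℝ} (hB : ∀ u v, |B u v| ≤ K * ‖u‖ * ‖v‖) {M : ℝ} {u : ℕ → V} {v : V}
    (hu : ∀ n, ‖u n‖ ≤ M) (huv : WeakTendsto u v) (y : V) :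
    Tendsto (fun n => A n (u n) y) atTop (𝓝 (B v y)) := by
  obtain ⟨δ, h0, h1⟩ := h y
  have h2 : Tendsto (fun n => B (u n) y) atTop (𝓝 (B v y)) :=
    huv.apply_of_bound (B.flip y) (K * ‖y‖) fun x => by
      simpa [mul_right_comm] using hB x y
  have h3 : Tendsto (fun n => A n (u n) y - B (u n) y) atTop (𝓝 0) := by
    rw [tendsto_zero_iff_norm_tendsto_zero]
    refine squeeze_zero (g := fun n => |δ n| * M) (fun n => norm_nonneg _) (fun n => ?_) ?_
    · exact (h1 n (u n)).trans (mul_le_mul (le_abs_self _) (hu n) (norm_nonneg _) (abs_nonneg _))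
    · simpa using h0.abs.mul_const M
  simpa using h3.add h2

/-! ### Rayleigh quotients of a pair of forms -/

namespace FormPair

variable {J : V →L[ℝ] H} {m M : ℝ} {A C : V →ₗ[ℝ] V →ₗ[ℝ] ℝ}

theorem nonneg_A (P : FormPair J m M A C) (u : V) : 0 ≤ A u u :=
  (mul_nonneg P.pos.le (sq_nonneg _)).trans (P.coercive u)

theorem pos_C (P : FormPair J m M A C) (hJ : Function.Injective J) {u : V} (hu : u ≠ 0) :
    0 < C u u := by
  have : J u ≠ 0 := fun h => hu (hJ (by rw [h, map_zero]))
  exact lt_of_lt_of_le (mul_pos P.pos (by positivity)) (P.lower_C u)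

theorem bound_C' (P : FormPair J m M A C) (u v : V) : |C u v| ≤ |M| * ‖J‖ ^ 2 * ‖u‖ * ‖v‖ := by
  calc |C u v| ≤ M * ‖J u‖ * ‖J v‖ := P.bound_C u v
    _ ≤ |M| * ‖J u‖ * ‖J v‖ := by gcongr; exact le_abs_self M
    _ ≤ |M| * (‖J‖ * ‖u‖) * (‖J‖ * ‖v‖) := by gcongr <;> exact J.le_opNorm _
    _ = _ := by ring

/-- Coercivity bounds ‖u‖², and t ≤ t² + 1 turns this into a bound on ‖u‖ without square roots. -/
theorem norm_le (P : FormPair J m M A C) {u : V} {B : ℝ} (h : A u u ≤ B) : ‖u‖ ≤ B / m + 1 := by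
  have h1 : ‖u‖ ^ 2 ≤ B / m := by
    rw [le_div_iff₀ P.pos, mul_comm]; exact (P.coercive u).trans h
  nlinarith [sq_nonneg (‖u‖ - 1), sq_nonneg ‖u‖]

/-- First variation: Q(u) = A(u,u) − A(w,w) C(u,u) is nonnegative on S and vanishes at w, so its
polar form vanishes on (w, v). -/
theorem eigen_of_minimizer (P : FormPair J m M A C) {w : V} (hw : C w w = 1) {S : Submodule ℝ V}
    (hwS : w ∈ S) (hmin : ∀ u ∈ S, A w w * C u u ≤ A u u) {v : V} (hv : v ∈ S) :
    A w v = A w w * C w v := by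
  set b := A w v - A w w * C w v with hb
  set a := A v v - A w w * C v v with ha
  have ha0 : 0 ≤ a := sub_nonneg.2 (hmin v hv)
  -- With b = Q(w,v) and a = Q(v,v), this t = −b/(a+1) turns Q(w + t v) = 2tb + t²a into −t²(a+2),
  -- which forces t = 0. The + 1 covers a = 0.
  have h := hmin (w + (-b / (a + 1)) • v) (S.add_mem hwS (S.smul_mem _ hv))
  simp only [map_add, map_smul, LinearMap.add_apply, LinearMap.smul_apply, smul_eq_mul,
    P.symm_A v w, P.symm_C v w, hw] at h
  set t := -b / (a + 1) with ht
  have h1 : 0 ≤ 2 * t * b + t ^ 2 * a := by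
    rw [hb, ha]; nlinarith
  have h2 : t * (a + 1) = -b := by rw [ht]; field_simp
  have h3 : b = -(t * (a + 1)) := by linarith
  have h4 : 0 ≤ -(t ^ 2 * (a + 2)) := by
    calc (0 : ℝ) ≤ 2 * t * b + t ^ 2 * a := h1
      _ = _ := by rw [h3]; ring
  have h5 : t = 0 := by
    by_contra hne
    have : 0 < t ^ 2 := by positivity
    nlinarith
  rw [h5] at h3
  linarith

variable [CompleteSpace V]

/-- Expanding A n (uₙ − v) (uₙ − v) ≥ 0 gives 2 A n uₙ v − A n v v ≤ rₙ. The left side is affine in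
uₙ and passes to the weak limit. -/
theorem le_of_weakTendsto {A C : ℕ → V →ₗ[ℝ] V →ₗ[ℝ] ℝ} {A' C' : V →ₗ[ℝ] V →ₗ[ℝ] ℝ}
    (P : ∀ n, FormPair J m M (A n) (C n)) (P' : FormPair J m M A' C') (hA : FormTendsto A A')
    {K : ℝ} {u : ℕ → V} {v : V} (hu : ∀ n, ‖u n‖ ≤ K) (huv : WeakTendsto u v)
    {r : ℕ → ℝ} {R : ℝ} (hr : ∀ n, A n (u n) (u n) ≤ r n) (hR : Tendsto r atTop (𝓝 R)) :
    A' v v ≤ R := by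
  have h1 := (hA.apply_weak P'.bound_A hu huv v).const_mul 2
  have h2 := h1.sub (hA.apply v v)
  have h3 : 2 * A' v v - A' v v = A' v v := by ring
  rw [h3] at h2
  refine le_of_tendsto_of_tendsto' h2 hR fun n => ?_
  have h4 := (P n).nonneg_A (u n - v)
  simp only [map_sub, LinearMap.sub_apply] at h4
  have h5 := (P n).symm_A v (u n)
  linarith [hr n]

/-- Compactness of J makes the mass continuous under weak convergence, not just lower
semicontinuous: replacing u'ₙ by v' costs at most M‖J uₙ‖‖J u'ₙ − J v'‖. -/
theorem tendsto_C {A C : ℕ → V →ₗ[ℝ] V →ₗ[ℝ] ℝ} {A' C' : V →ₗ[ℝ] V →ₗ[ℝ] ℝ}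
    (hJ : CompletelyContinuous J)
    (P : ∀ n, FormPair J m M (A n) (C n)) (P' : FormPair J m M A' C') (hC : FormTendsto C C')
    {K : ℝ} {u u' : ℕ → V} {v v' : V} (hu : ∀ n, ‖u n‖ ≤ K) (huv : WeakTendsto u v)
    (hu' : ∀ n, ‖u' n‖ ≤ K) (huv' : WeakTendsto u' v') :
    Tendsto (fun n => C n (u n) (u' n)) atTop (𝓝 (C' v v')) := by
  have h1 := hC.apply_weak P'.bound_C' hu huv v'
  have h2 : Tendsto (fun n => C n (u n) (u' n - v')) atTop (𝓝 0) := by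
    rw [tendsto_zero_iff_norm_tendsto_zero]
    refine squeeze_zero (g := fun n => M * ‖J (u n)‖ * ‖J (u' n) - J v'‖)
      (fun n => norm_nonneg _) (fun n => ?_) ?_
    · rw [← map_sub]; exact (P n).bound_C _ _
    · have h3 := (tendsto_iff_norm_sub_tendsto_zero.1 (hJ K u' v' hu' huv'))
      have h4 := ((hJ K u v hu huv).norm.const_mul M).mul h3
      simpa using h4
  have h5 := h1.add h2
  simpa using h5

/-- Constrained minimization of the Rayleigh quotient. -/
theorem exists_minimizer (P : FormPair J m M A C) (hJ : CompletelyContinuous J)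
    (hinj : Function.Injective J) (hV : ¬ FiniteDimensional ℝ V) (L : List V) :
    ∃ w, C w w = 1 ∧ (∀ v ∈ L, C v w = 0) ∧
      ∀ u, (∀ v ∈ L, C v u = 0) → A w w * C u u ≤ A u u := by
  let S : Set V := {u | C u u = 1 ∧ ∀ v ∈ L, C v u = 0}
  have scale : ∀ u, u ≠ 0 → (∀ v ∈ L, C v u = 0) → (√(C u u))⁻¹ • u ∈ S := by
    intro u hu h
    have h0 := P.pos_C hinj hu
    refine ⟨?_, fun v hv => by simp [h v hv]⟩
    have h1 : √(C u u) * √(C u u) = C u u := Real.mul_self_sqrt h0.le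
    have h2 : √(C u u) ≠ 0 := (Real.sqrt_pos.2 h0).ne'
    simp only [map_smul, LinearMap.smul_apply, smul_eq_mul]
    nth_rewrite 3 [← h1]
    field_simp
  have hne : S.Nonempty := by
    -- Finitely many linear constraints have a nonzero common solution, V being
    -- infinite-dimensional.
    let T : V →ₗ[ℝ] (Fin L.length → ℝ) := LinearMap.pi fun i => C (L.get i)
    have hT : ¬ Function.Injective T := fun h => hV (FiniteDimensional.of_injective T h)
    rw [← LinearMap.ker_eq_bot, Submodule.eq_bot_iff] at hT
    push Not at hT
    obtain ⟨u, hu, hu0⟩ := hT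
    refine ⟨_, scale u hu0 fun v hv => ?_⟩
    obtain ⟨i, rfl⟩ := List.get_of_mem hv
    exact congrFun (LinearMap.mem_ker.1 hu) i
  let Q : Set ℝ := (fun u => A u u) '' S
  have hQ : BddBelow Q := ⟨0, by rintro _ ⟨u, -, rfl⟩; exact P.nonneg_A u⟩
  obtain ⟨q, -, hq, hqQ⟩ := exists_seq_tendsto_sInf (hne.image _) hQ
  choose u huS huq using hqQ
  obtain ⟨B, hB⟩ := hq.bddAbove_range
  have hbd : ∀ n, ‖u n‖ ≤ B / m + 1 := fun n =>
    P.norm_le ((huq n).le.trans (hB ⟨n, rfl⟩))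
  obtain ⟨w, σ, hσ, hw⟩ := exists_weakTendsto_subseq hbd
  have hbd' : ∀ n, ‖(u ∘ σ) n‖ ≤ B / m + 1 := fun n => hbd _
  have hA : A w w ≤ sInf Q :=
    le_of_weakTendsto (fun _ => P) P (.const A) hbd' hw (fun n => (huq (σ n)).le)
      (hq.comp hσ.tendsto_atTop)
  refine ⟨w, ?_, ?_, ?_⟩
  -- The normalization C = 1 survives the weak limit because C sees u only through the compact map
  -- J.
  · refine tendsto_nhds_unique (tendsto_C hJ (fun _ => P) P (.const C) hbd' hw hbd' hw) ?_
    exact tendsto_const_nhds.congr fun n => (huS (σ n)).1.symm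
  · intro v hv
    have h1 := hw.apply_of_bound (C v) (|M| * ‖J‖ ^ 2 * ‖v‖) (P.bound_C' v)
    exact tendsto_nhds_unique h1 (tendsto_const_nhds.congr fun n => ((huS (σ n)).2 v hv).symm)
  · intro v hv
    by_cases hv0 : v = 0
    · simp [hv0]
    have h0 := P.pos_C hinj hv0
    have h1 := csInf_le hQ ⟨_, scale v hv0 hv, rfl⟩
    have h2 : √(C v v) * √(C v v) = C v v := Real.mul_self_sqrt h0.le
    have h3 : 0 < √(C v v) := Real.sqrt_pos.2 h0
    simp only [map_smul, LinearMap.smul_apply, smul_eq_mul] at h1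
    rw [← mul_assoc, ← mul_inv, h2, inv_mul_eq_div, le_div_iff₀ h0] at h1
    nlinarith

end FormPair

/-- `Λ` and `w` are the eigenvalues and the `C`-orthonormal eigenvectors of the pair `(A, C)`,
ordered increasingly. -/
structure IsEigenSystem (A C : V →ₗ[ℝ] V →ₗ[ℝ] ℝ) (Λ : ℕ → ℝ) (w : ℕ → V) : Prop where
  mono : Monotone Λ
  tendsto : Tendsto Λ atTop atTop
  eigen : ∀ n v, A (w n) v = Λ n * C (w n) v
  orthonormal : ∀ i j, C (w i) (w j) = if i = j then 1 else 0
  le : ∀ k u, (∀ j < k, C (w j) u = 0) → Λ k * C u u ≤ A u u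

/-- Each eigenvector minimizes the Rayleigh quotient on the C-orthogonal complement of its
predecessors. The eigenvalues are unbounded, since otherwise a C-orthonormal sequence would be
bounded in V and compactness would contradict orthonormality. -/
theorem FormPair.exists_eigenSystem [CompleteSpace V] {J : V →L[ℝ] H} {m M : ℝ}
    {A C : V →ₗ[ℝ] V →ₗ[ℝ] ℝ} (P : FormPair J m M A C) (hJ : CompletelyContinuous J)
    (hinj : Function.Injective J) (hV : ¬ FiniteDimensional ℝ V) :
    ∃ Λ w, IsEigenSystem A C Λ w := by
  choose next h1 h2 h3 using P.exists_minimizer hJ hinj hV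
  -- `L n` lists the vectors found before stage n, so the choice of a minimizer can be iterated.
  let L : ℕ → List V := fun n => Nat.rec [] (fun _ l => next l :: l) n
  have hL : ∀ n, L (n + 1) = next (L n) :: L n := fun n => rfl
  let w : ℕ → V := fun n => next (L n)
  have memL : ∀ n v, v ∈ L n ↔ ∃ k < n, v = w k := by
    intro n
    induction n with
    | zero => intro v; simp [L]
    | succ n ih =>
      intro v
      rw [hL, List.mem_cons, ih]
      constructor
      · rintro (rfl | ⟨k, hk, rfl⟩)
        · exact ⟨n, n.lt_succ_self, rfl⟩
        · exact ⟨k, hk.trans n.lt_succ_self, rfl⟩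
      · rintro ⟨k, hk, rfl⟩
        rcases Nat.lt_succ_iff_lt_or_eq.1 hk with h | rfl
        · exact Or.inr ⟨k, h, rfl⟩
        · exact Or.inl rfl
  have ortho : ∀ i j, C (w i) (w j) = if i = j then 1 else 0 := by
    have hlt : ∀ i j, i < j → C (w i) (w j) = 0 := fun i j h =>
      h2 (L j) (w i) ((memL _ _).2 ⟨i, h, rfl⟩)
    intro i j
    rcases lt_trichotomy i j with h | rfl | h
    · rw [hlt i j h, if_neg h.ne]
    · rw [if_pos rfl]; exact h1 _
    · rw [P.symm_C, hlt j i h, if_neg h.ne']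
  have hle : ∀ k u, (∀ j < k, C (w j) u = 0) → A (w k) (w k) * C u u ≤ A u u := by
    intro k u hu
    refine h3 (L k) u fun v hv => ?_
    obtain ⟨j, hj, rfl⟩ := (memL _ _).1 hv
    exact hu j hj
  have hmono : Monotone fun n => A (w n) (w n) := by
    refine monotone_nat_of_le_succ fun n => ?_
    have := hle n (w (n + 1)) fun j hj =>
      (ortho j (n + 1)).trans (if_neg (by omega))
    simpa [ortho] using this
  -- The first variation gives the equation only for test vectors C-orthogonal to the earlier w j. A
  -- general v is replaced by v − p, with p its projection on their span; p drops out because the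
  -- earlier w j are already eigenvectors.
  have heig : ∀ n v, A (w n) v = A (w n) (w n) * C (w n) v := by
    intro n
    induction n using Nat.strong_induction_on with
    | _ n ih =>
    intro v
    let S : Submodule ℝ V :=
      { carrier := {u | ∀ j < n, C (w j) u = 0}
        add_mem' := fun {x y} hx hy j hj => by rw [map_add, hx j hj, hy j hj, add_zero]
        zero_mem' := fun j _ => map_zero _
        smul_mem' := fun c x hx j hj => by rw [map_smul, hx j hj, smul_zero] }
    let p : V := ∑ j ∈ Finset.range n, C (w j) v • w j
    have hp : v - p ∈ S := by
      intro k hk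
      have : C (w k) p = C (w k) v := by
        simp only [p, map_sum, map_smul, ortho, smul_eq_mul, mul_ite, mul_one, mul_zero]
        rw [Finset.sum_ite_eq, if_pos (Finset.mem_range.2 hk)]
      rw [map_sub, this, sub_self]
    have hCp : C (w n) p = 0 := by
      simp only [p, map_sum, map_smul]
      refine Finset.sum_eq_zero fun j hj => ?_
      rw [ortho, if_neg (by have := Finset.mem_range.1 hj; omega), smul_zero]
    have hAp : A (w n) p = 0 := by
      simp only [p, map_sum, map_smul]
      refine Finset.sum_eq_zero fun j hj => ?_
      rw [P.symm_A, ih j (Finset.mem_range.1 hj), ortho,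
        if_neg (by have := Finset.mem_range.1 hj; omega), mul_zero, smul_zero]
    have hwS : w n ∈ S := fun j hj => by rw [ortho, if_neg hj.ne]
    have := P.eigen_of_minimizer (w := w n) (h1 _) hwS (fun u hu => hle n u hu) hp
    rw [map_sub, map_sub, hAp, hCp, sub_zero, sub_zero] at this
    exact this
  refine ⟨fun n => A (w n) (w n), w, hmono, ?_, heig, ortho, hle⟩
  rcases tendsto_atTop_of_monotone hmono with h | ⟨l, hl⟩
  · exact h
  exfalso
  obtain ⟨B, hB⟩ := hl.bddAbove_range
  have hbd : ∀ n, ‖w n‖ ≤ B / m + 1 := fun n => P.norm_le (hB ⟨n, rfl⟩)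
  obtain ⟨v, σ, hσ, hv⟩ := exists_weakTendsto_subseq hbd
  have hbd' : ∀ n, ‖(w ∘ σ) n‖ ≤ B / m + 1 := fun n => hbd _
  -- Pairing the subsequence with itself gives C v v = 1, pairing consecutive members gives C v v =
  -- 0.
  have t1 := FormPair.tendsto_C hJ (fun _ => P) P (.const C) hbd' hv hbd' hv
  have t2 := FormPair.tendsto_C hJ (fun _ => P) P (.const C) hbd' hv
    (u' := (w ∘ σ) ∘ (· + 1)) (fun n => hbd' _) (hv.comp (tendsto_add_atTop_nat 1))
  have e1 : C v v = 1 := tendsto_nhds_unique t1 (tendsto_const_nhds.congr fun n => by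
    simp [ortho])
  have e2 : C v v = 0 := tendsto_nhds_unique t2 (tendsto_const_nhds.congr fun n => by
    have : σ n < σ (n + 1) := hσ n.lt_succ_self
    simp only [Function.comp, ortho]
    rw [if_neg (by omega)])
  linarith

/-! ### Min-max principle and multiplicities -/

namespace IsEigenSystem

variable {A C : V →ₗ[ℝ] V →ₗ[ℝ] ℝ} {Λ : ℕ → ℝ} {w : ℕ → V}

theorem apply_sum_C (h : IsEigenSystem A C Λ w) (s : Finset ℕ) (α : ℕ → ℝ) (j : ℕ) :
    C (w j) (∑ i ∈ s, α i • w i) = if j ∈ s then α j else 0 := by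
  simp only [map_sum, map_smul, h.orthonormal, smul_eq_mul, mul_ite, mul_one, mul_zero]
  rw [Finset.sum_ite_eq]

theorem linearIndependent (h : IsEigenSystem A C Λ w) : LinearIndependent ℝ w := by
  rw [linearIndependent_iff']
  intro s g hg i hi
  have := h.apply_sum_C s g i
  rw [hg, map_zero, if_pos hi] at this
  exact this.symm

/-- In any `(k+1)`-dimensional space there is a vector whose Rayleigh quotient is at least the
`k`-th eigenvalue. -/
theorem exists_rayleigh_ge (h : IsEigenSystem A C Λ w) (k : ℕ) (v : Fin (k + 1) → V) :
    ∃ α : Fin (k + 1) → ℝ, α ≠ 0 ∧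
      Λ k * C (∑ j, α j • v j) (∑ j, α j • v j) ≤ A (∑ j, α j • v j) (∑ j, α j • v j) := by
  -- Orthogonality to the first k eigenvectors puts k conditions on k + 1 coefficients. The v j need
  -- not be independent.
  let T : (Fin (k + 1) → ℝ) →ₗ[ℝ] (Fin k → ℝ) :=
    LinearMap.pi fun i => (C (w i)) ∘ₗ (Fintype.linearCombination ℝ v)
  have hT : LinearMap.ker T ≠ ⊥ := LinearMap.ker_ne_bot_of_finrank_lt (by simp)
  obtain ⟨α, hα, hα0⟩ := (Submodule.ne_bot_iff _).1 hT
  refine ⟨α, hα0, h.le k _ fun j hj => ?_⟩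
  have := congrFun (LinearMap.mem_ker.1 hα) ⟨j, hj⟩
  simpa [T, Fintype.linearCombination_apply] using this

theorem rayleigh_sum (h : IsEigenSystem A C Λ w) (k : ℕ) (α : Fin (k + 1) → ℝ) :
    C (∑ j, α j • w j) (∑ j, α j • w j) = ∑ j, α j ^ 2 ∧
      A (∑ j, α j • w j) (∑ j, α j • w j) = ∑ j : Fin (k + 1), Λ j * α j ^ 2 := by
  have e : ∀ i : Fin (k + 1), C (w i) (∑ j, α j • w j) = α i := fun i => by
    simp [map_sum, h.orthonormal, Fin.val_inj]
  constructor
  · rw [LinearMap.map_sum₂]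
    refine Finset.sum_congr rfl fun i _ => ?_
    rw [map_smul, LinearMap.smul_apply, e, smul_eq_mul, sq]
  · rw [LinearMap.map_sum₂]
    refine Finset.sum_congr rfl fun i _ => ?_
    rw [map_smul, LinearMap.smul_apply, h.eigen, e, smul_eq_mul]
    ring

theorem rayleigh_sum_le (h : IsEigenSystem A C Λ w) (k : ℕ) (α : Fin (k + 1) → ℝ) :
    A (∑ j, α j • w j) (∑ j, α j • w j) ≤ Λ k * ∑ j, α j ^ 2 := by
  rw [(h.rayleigh_sum k α).2, Finset.mul_sum]
  refine Finset.sum_le_sum fun j _ => mul_le_mul_of_nonneg_right (h.mono ?_) (sq_nonneg _)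
  exact Nat.lt_succ_iff.1 j.2

theorem sum_sq_pos {k : ℕ} {α : Fin (k + 1) → ℝ} (hα : α ≠ 0) : 0 < ∑ j, α j ^ 2 := by
  obtain ⟨j, hj⟩ := Function.ne_iff.1 hα
  have : α j ≠ 0 := hj
  exact Finset.sum_pos' (fun _ _ => sq_nonneg _) ⟨j, Finset.mem_univ j, by positivity⟩

/-- Comparison of the eigenvalues of two pairs of forms. -/
theorem le_of_forall {A' C' : V →ₗ[ℝ] V →ₗ[ℝ] ℝ} {Λ' : ℕ → ℝ} {w' : ℕ → V}
    (h : IsEigenSystem A C Λ w) (h' : IsEigenSystem A' C' Λ' w') (hC : ∀ u, u ≠ 0 → 0 < C u u)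
    {k : ℕ} {r : ℝ} (hr : ∀ u, A' u u ≤ Λ' k * C' u u → A u u ≤ r * C u u) : Λ k ≤ r := by
  -- The trial space is spanned by the first k + 1 eigenvectors of the other pair, on which A' ≤ Λ'
  -- k · C'.
  obtain ⟨α, hα, hk⟩ := h.exists_rayleigh_ge k (fun j => w' j)
  set u := ∑ j : Fin (k + 1), α j • w' j
  have h0 : C' u u = ∑ j, α j ^ 2 := (h'.rayleigh_sum k α).1
  have h1 := hr u (by rw [h0]; exact h'.rayleigh_sum_le k α)
  have hu : u ≠ 0 := fun hu => by
    have := sum_sq_pos hα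
    rw [← h0, hu] at this
    simp at this
  exact le_of_mul_le_mul_right (hk.trans h1) (hC u hu)

end IsEigenSystem

/-- The space of all `v` with `A v = s C v`. -/
def eigenspace (A C : V →ₗ[ℝ] V →ₗ[ℝ] ℝ) (s : ℝ) : Submodule ℝ V :=
  LinearMap.ker (A - s • C)

theorem mem_eigenspace {A C : V →ₗ[ℝ] V →ₗ[ℝ] ℝ} {s : ℝ} {v : V} :
    v ∈ eigenspace A C s ↔ ∀ u, A v u = s * C v u := by
  simp [eigenspace, LinearMap.ext_iff, sub_eq_zero]

/-- The w n with Λ n = s form a basis of the eigenspace. They span it because a nonzero eigenvector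
for s that is C-orthogonal to every w n would have Rayleigh quotient s at least Λ k for all k,
although Λ → ∞. No expansion theorem is needed. -/
theorem IsEigenSystem.mk_eq_rank {V : Type} [NormedAddCommGroup V] [InnerProductSpace ℝ V]
    {J : V →L[ℝ] H} {m M : ℝ}
    {A C : V →ₗ[ℝ] V →ₗ[ℝ] ℝ} {Λ : ℕ → ℝ} {w : ℕ → V} (h : IsEigenSystem A C Λ w)
    (P : FormPair J m M A C) (hinj : Function.Injective J) (s : ℝ) :
    Cardinal.mk {n : ℕ // Λ n = s} = Module.rank ℝ (eigenspace A C s) := by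
  let b : {n : ℕ // Λ n = s} → eigenspace A C s := fun n =>
    ⟨w n, mem_eigenspace.2 fun u => by rw [h.eigen, n.2]⟩
  have hfin : {n | Λ n = s}.Finite := by
    obtain ⟨N, hN⟩ := (h.tendsto.eventually_gt_atTop s).exists_forall_of_atTop
    refine (Finset.finite_toSet (Finset.range N)).subset fun n hn => ?_
    rw [Finset.mem_coe, Finset.mem_range]
    by_contra! hc
    exact (hN n hc).ne' hn
  have hb : LinearIndependent ℝ b := by
    refine LinearIndependent.of_comp (eigenspace A C s).subtype ?_
    exact h.linearIndependent.comp _ Subtype.val_injective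
  have hspan : ⊤ ≤ Submodule.span ℝ (Set.range b) := by
    rintro ⟨v, hv⟩ -
    have hv' := mem_eigenspace.1 hv
    let p : V := ∑ n ∈ hfin.toFinset, C (w n) v • w n
    have hp : p ∈ eigenspace A C s := by
      refine Submodule.sum_mem _ fun n hn => Submodule.smul_mem _ _ ?_
      exact (b ⟨n, by simpa using hn⟩).2
    have hCp : ∀ n, C (w n) (v - p) = 0 := by
      intro n
      rw [map_sub, h.apply_sum_C hfin.toFinset (fun n => C (w n) v) n]
      split_ifs with hn
      · exact sub_self _
      -- By symmetry, eigenvectors for different eigenvalues are C-orthogonal.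
      · have h1 := hv' (w n)
        rw [P.symm_A, P.symm_C v, h.eigen] at h1
        have h2 : (Λ n - s) * C (w n) v = 0 := by linarith
        have h3 : Λ n - s ≠ 0 := fun h0 => hn (by simpa using sub_eq_zero.1 h0)
        rw [(mul_eq_zero.1 h2).resolve_left h3, sub_zero]
    have hz : v - p = 0 := by
      by_contra hne
      obtain ⟨k, hk⟩ := (h.tendsto.eventually_gt_atTop s).exists
      have h1 := h.le k (v - p) fun j _ => hCp j
      rw [mem_eigenspace.1 (Submodule.sub_mem _ hv hp) (v - p)] at h1
      have h2 := P.pos_C hinj hne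
      nlinarith
    have hvp : (⟨v, hv⟩ : eigenspace A C s) =
        ∑ n : hfin.toFinset, C (w n) v • b ⟨n, hfin.mem_toFinset.1 n.2⟩ := by
      apply Subtype.ext
      rw [AddSubmonoidClass.coe_finsetSum]
      change v = ∑ n : hfin.toFinset, C (w n) v • w n
      rw [Finset.sum_coe_sort hfin.toFinset (fun n => C (w n) v • w n)]
      exact sub_eq_zero.1 hz
    rw [hvp]
    exact Submodule.sum_mem _ fun n _ =>
      Submodule.smul_mem _ _ (Submodule.subset_span ⟨_, rfl⟩)
  simpa using (Module.Basis.mk hb hspan).mk_eq_rank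

/-- Since |αᵢ αⱼ| ≤ Σ α², entrywise closeness of two forms on finitely many vectors controls the
quadratic forms on their combinations. -/
theorem form_sum_sub_le {A A' : V →ₗ[ℝ] V →ₗ[ℝ] ℝ} {k : ℕ} (v : Fin (k + 1) → V)
    (α : Fin (k + 1) → ℝ) :
    |A (∑ j, α j • v j) (∑ j, α j • v j) - A' (∑ j, α j • v j) (∑ j, α j • v j)| ≤
      (∑ i, ∑ j, |A (v i) (v j) - A' (v i) (v j)|) * ∑ j, α j ^ 2 := by
  have e : ∀ B : V →ₗ[ℝ] V →ₗ[ℝ] ℝ, B (∑ j, α j • v j) (∑ j, α j • v j) =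
      ∑ i, ∑ j, α i * α j * B (v i) (v j) := fun B => by
    simp only [map_sum, LinearMap.sum_apply, map_smul, LinearMap.smul_apply, smul_eq_mul]
    rw [Finset.sum_comm]
    refine Finset.sum_congr rfl fun i _ => ?_
    rw [Finset.mul_sum]
    exact Finset.sum_congr rfl fun j _ => by ring
  rw [e, e, ← Finset.sum_sub_distrib, Finset.sum_mul]
  refine (Finset.abs_sum_le_sum_abs _ _).trans (Finset.sum_le_sum fun i _ => ?_)
  rw [← Finset.sum_sub_distrib, Finset.sum_mul]
  refine (Finset.abs_sum_le_sum_abs _ _).trans (Finset.sum_le_sum fun j _ => ?_)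
  rw [← mul_sub, abs_mul, mul_comm]
  gcongr
  have hs : ∀ i, α i ^ 2 ≤ ∑ j, α j ^ 2 := fun i =>
    Finset.single_le_sum (f := fun j => α j ^ 2) (fun _ _ => sq_nonneg _) (Finset.mem_univ i)
  rw [abs_le]
  constructor <;> nlinarith [hs i, hs j, sq_nonneg (α i + α j), sq_nonneg (α i - α j)]

/-! ### Continuity of the eigenvalues under convergence of the forms -/

section Convergence

variable {J : V →L[ℝ] H} {m M : ℝ} {A C : ℕ → V →ₗ[ℝ] V →ₗ[ℝ] ℝ}
  {A' C' : V →ₗ[ℝ] V →ₗ[ℝ] ℝ} {Λ : ℕ → ℕ → ℝ} {w : ℕ → ℕ → V} {Λ' : ℕ → ℝ} {w' : ℕ → V}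

/-- The eigenvectors of the limit pair are a fixed trial space on which the forms converge
uniformly. The entrywise errors, summed in `e`, enter numerator and denominator of the Rayleigh
quotient. -/
theorem IsEigenSystem.eventually_le (P : ∀ n, FormPair J m M (A n) (C n))
    (hA : FormTendsto A A') (hC : FormTendsto C C') (h : ∀ n, IsEigenSystem (A n) (C n) (Λ n) (w n))
    (h' : IsEigenSystem A' C' Λ' w') (k : ℕ) :
    ∃ e : ℕ → ℝ, Tendsto e atTop (𝓝 0) ∧ ∀ n, Λ n k * (1 - e n) ≤ Λ' k + e n := by
  let e : ℕ → ℝ := fun n => (∑ i : Fin (k + 1), ∑ j : Fin (k + 1),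
    |A n (w' i) (w' j) - A' (w' i) (w' j)|) +
    ∑ i : Fin (k + 1), ∑ j : Fin (k + 1), |C n (w' i) (w' j) - C' (w' i) (w' j)|
  have aux : ∀ {B : ℕ → V →ₗ[ℝ] V →ₗ[ℝ] ℝ} {B' : V →ₗ[ℝ] V →ₗ[ℝ] ℝ}, FormTendsto B B' →
      Tendsto (fun n => ∑ i : Fin (k + 1), ∑ j : Fin (k + 1),
        |B n (w' i) (w' j) - B' (w' i) (w' j)|) atTop (𝓝 0) := by
    intro B B' hB
    have : (0 : ℝ) = ∑ i : Fin (k + 1), ∑ j : Fin (k + 1), 0 := by simp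
    rw [this]
    refine tendsto_finsetSum _ fun i _ => tendsto_finsetSum _ fun j _ => ?_
    exact (tendsto_iff_norm_sub_tendsto_zero.1 (hB.apply (w' i) (w' j)))
  refine ⟨e, by simpa using (aux hA).add (aux hC), fun n => ?_⟩
  obtain ⟨α, hα, hk⟩ := (h n).exists_rayleigh_ge k (fun j => w' j)
  have h1 := form_sum_sub_le (A := A n) (A' := A') (fun j : Fin (k + 1) => w' j) α
  have h2 := form_sum_sub_le (A := C n) (A' := C') (fun j : Fin (k + 1) => w' j) α
  have h3 := (h'.rayleigh_sum k α).1
  have h4 := h'.rayleigh_sum_le k α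
  set u := ∑ j : Fin (k + 1), α j • w' j
  set S := ∑ j, α j ^ 2
  have hS : 0 < S := sum_sq_pos hα
  set eA := ∑ i : Fin (k + 1), ∑ j : Fin (k + 1), |A n (w' i) (w' j) - A' (w' i) (w' j)|
  set eC := ∑ i : Fin (k + 1), ∑ j : Fin (k + 1), |C n (w' i) (w' j) - C' (w' i) (w' j)|
  have hen : e n = eA + eC := rfl
  have hA0 : 0 ≤ eA := Finset.sum_nonneg fun _ _ => Finset.sum_nonneg fun _ _ => abs_nonneg _
  have hC0 : 0 ≤ eC := Finset.sum_nonneg fun _ _ => Finset.sum_nonneg fun _ _ => abs_nonneg _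
  have hΛ : 0 ≤ Λ n k := by
    have := (P n).nonneg_A (w n k)
    rwa [(h n).eigen, (h n).orthonormal, if_pos rfl, mul_one] at this
  rw [hen]
  refine le_of_mul_le_mul_right ?_ hS
  have h5 := (abs_le.1 h1).2
  have h6 := (abs_le.1 h2).1
  have h7 : Λ n k * (S - eC * S) ≤ Λ n k * C n u u :=
    mul_le_mul_of_nonneg_left (by rw [← h3] at h6 ⊢; linarith) hΛ
  have h8 : 0 ≤ Λ n k * (eA * S) := by positivity
  have h9 : 0 ≤ eC * S := by positivity
  nlinarith

/-- A finite family of bounded sequences has a common weakly convergent subsequence. -/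
theorem exists_weakTendsto_subseq_pi [CompleteSpace V] {ι : Type*} [Fintype ι] [DecidableEq ι]
    {u : ι → ℕ → V}
    {K : ℝ} (hu : ∀ i n, ‖u i n‖ ≤ K) :
    ∃ v : ι → V, ∃ σ : ℕ → ℕ, StrictMono σ ∧ ∀ i, WeakTendsto (u i ∘ σ) (v i) := by
  -- One extraction in the Hilbert sum of copies of V replaces repeated extraction over the index.
  let U : ℕ → PiLp 2 (fun _ : ι => V) := fun n => WithLp.toLp 2 fun i => u i n
  have hU : ∀ n, ‖U n‖ ≤ √(∑ _i : ι, K ^ 2) := fun n => by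
    rw [PiLp.norm_eq_of_L2]
    refine Real.sqrt_le_sqrt (Finset.sum_le_sum fun i _ => ?_)
    exact pow_le_pow_left₀ (norm_nonneg _) (hu i n) 2
  obtain ⟨v, σ, hσ, h⟩ := exists_weakTendsto_subseq hU
  refine ⟨fun i => v i, σ, hσ, fun i => ?_⟩
  exact h.map (PiLp.proj 2 (fun _ : ι => V) i : PiLp 2 (fun _ : ι => V) →L[ℝ] V)

/-- Eigenvalues depend continuously on the forms. -/
theorem IsEigenSystem.tendsto_eigenvalue [CompleteSpace V] (hJ : CompletelyContinuous J)
    (P : ∀ n, FormPair J m M (A n) (C n)) (P' : FormPair J m M A' C')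
    (hA : FormTendsto A A') (hC : FormTendsto C C') (h : ∀ n, IsEigenSystem (A n) (C n) (Λ n) (w n))
    (h' : IsEigenSystem A' C' Λ' w') (k : ℕ) :
    Tendsto (fun n => Λ n k) atTop (𝓝 (Λ' k)) := by
  obtain ⟨e, he, hle⟩ := IsEigenSystem.eventually_le P hA hC h h' k
  have hΛ0 : ∀ n j, 0 ≤ Λ n j := fun n j => by
    have := (P n).nonneg_A (w n j)
    rwa [(h n).eigen, (h n).orthonormal, if_pos rfl, mul_one] at this
  have hΛ0' : 0 ≤ Λ' k := by
    have := P'.nonneg_A (w' k)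
    rwa [h'.eigen, h'.orthonormal, if_pos rfl, mul_one] at this
  have hbd : ∀ᶠ n in atTop, Λ n k ≤ 2 * (Λ' k + 1) := by
    filter_upwards [he.eventually_lt_const (show (0 : ℝ) < 1 / 2 by norm_num)] with n hn
    have := hle n
    nlinarith [hΛ0 n k]
  -- Every subsequence `ns` is refined: a shift by N enters the bounded range, ρ makes the
  -- eigenvalues converge to some l, and σ makes the first k + 1 eigenvectors converge weakly.
  refine tendsto_of_subseq_tendsto fun ns hns => ?_
  obtain ⟨N, hN⟩ := (hns.eventually hbd).exists_forall_of_atTop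
  let τ : ℕ → ℕ := fun n => ns (n + N)
  have hτ : Tendsto τ atTop atTop := hns.comp (tendsto_add_atTop_nat N)
  have hτb : ∀ n, Λ (τ n) k ∈ Set.Icc 0 (2 * (Λ' k + 1)) := fun n =>
    ⟨hΛ0 _ _, hN _ (Nat.le_add_left _ _)⟩
  obtain ⟨l, -, ρ, hρ, hl⟩ := isCompact_Icc.tendsto_subseq hτb
  have hub : ∀ (j : Fin (k + 1)) n, ‖w (τ (ρ n)) j‖ ≤ 2 * (Λ' k + 1) / m + 1 := fun j n => by
    refine (P (τ (ρ n))).norm_le ?_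
    rw [(h _).eigen, (h _).orthonormal, if_pos rfl, mul_one]
    exact ((h _).mono (Nat.lt_succ_iff.1 j.2)).trans (hτb (ρ n)).2
  obtain ⟨v, σ, hσ, hv⟩ := exists_weakTendsto_subseq_pi hub
  let θ : ℕ → ℕ := fun n => τ (ρ (σ n))
  have hθ : Tendsto θ atTop atTop := hτ.comp (hρ.tendsto_atTop.comp hσ.tendsto_atTop)
  have hlθ : Tendsto (fun n => Λ (θ n) k) atTop (𝓝 l) := hl.comp hσ.tendsto_atTop
  have hvub : ∀ (j : Fin (k + 1)) n, ‖w (θ n) j‖ ≤ 2 * (Λ' k + 1) / m + 1 := fun j n => hub j _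
  have hup : l ≤ Λ' k := by
    have h1 : Tendsto (fun n => Λ (θ n) k * (1 - e (θ n))) atTop (𝓝 (l * (1 - 0))) :=
      hlθ.mul ((he.comp hθ).const_sub 1)
    have h2 : Tendsto (fun n => Λ' k + e (θ n)) atTop (𝓝 (Λ' k + 0)) :=
      (he.comp hθ).const_add _
    simpa using le_of_tendsto_of_tendsto' h1 h2 fun n => hle (θ n)
  have horth : ∀ i j : Fin (k + 1), C' (v i) (v j) = if i = j then 1 else 0 := by
    intro i j
    refine tendsto_nhds_unique (FormPair.tendsto_C hJ (fun n => P (θ n)) P' (hC.comp hθ)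
      (hvub i) (hv i) (hvub j) (hv j)) ?_
    refine tendsto_const_nhds.congr fun n => ?_
    rw [(h _).orthonormal]
    simp [Fin.val_inj]
  -- The weak limits v j are C'-orthonormal, hence a trial space for the limit pair; that they are
  -- eigenvectors is not needed. As α is fixed while n → ∞, lower semicontinuity is applied to a
  -- single weakly convergent sequence.
  have hlow : Λ' k ≤ l := by
    obtain ⟨α, hα, hk⟩ := h'.exists_rayleigh_ge k v
    have hS := sum_sq_pos hα
    have hCv : C' (∑ j, α j • v j) (∑ j, α j • v j) = ∑ j, α j ^ 2 := by
      simp [map_sum, horth, sq]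
    have hweak : WeakTendsto (fun n => ∑ j, α j • w (θ n) j) (∑ j, α j • v j) :=
      WeakTendsto.sum _ fun j _ => (hv j).const_smul (α j)
    have hAv : A' (∑ j, α j • v j) (∑ j, α j • v j) ≤ l * ∑ j, α j ^ 2 := by
      refine FormPair.le_of_weakTendsto (fun n => P (θ n)) P' (hA.comp hθ)
        (K := ∑ j, |α j| * (2 * (Λ' k + 1) / m + 1)) (fun n => ?_) hweak
        (fun n => (h (θ n)).rayleigh_sum_le k α) (hlθ.mul_const _)
      refine (norm_sum_le _ _).trans (Finset.sum_le_sum fun j _ => ?_)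
      rw [norm_smul, Real.norm_eq_abs]
      exact mul_le_mul_of_nonneg_left (hvub j n) (abs_nonneg _)
    rw [hCv] at hk
    exact le_of_mul_le_mul_right (hk.trans hAv) hS
  have hll : l = Λ' k := le_antisymm hup hlow
  -- σ served only to identify l; the eigenvalues converge already along ρ.
  refine ⟨fun n => ρ n + N, ?_⟩
  rw [← hll]
  exact hl

end Convergence

end Forms

/-! ### Test functions and translations -/

section Translation

variable {d : ℕ}

theorem abs_integral_inner_le {α E : Type*} [MeasurableSpace α] {μ : Measure α}
    [NormedAddCommGroup E] [InnerProductSpace ℝ E] {f g : α → E} (hf : MemLp f 2 μ)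
    (hg : MemLp g 2 μ) :
    |∫ x, inner ℝ (f x) (g x) ∂μ| ≤ (eLpNorm f 2 μ).toReal * (eLpNorm g 2 μ).toReal := by
  have h := abs_real_inner_le_norm (hf.toLp f) (hg.toLp g)
  rw [L2.inner_def, Lp.norm_toLp, Lp.norm_toLp] at h
  refine le_trans (le_of_eq ?_) h
  congr 1
  refine integral_congr_ae ?_
  filter_upwards [hf.coeFn_toLp, hg.coeFn_toLp] with x h1 h2
  rw [h1, h2]

theorem abs_integral_mul_le {α : Type*} [MeasurableSpace α] {μ : Measure α} {f g : α → ℝ}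
    (hf : MemLp f 2 μ) (hg : MemLp g 2 μ) :
    |∫ x, f x * g x ∂μ| ≤ (eLpNorm f 2 μ).toReal * (eLpNorm g 2 μ).toReal := by
  simpa [mul_comm] using abs_integral_inner_le hf hg

namespace IsTestFunction

variable {U : Set (Space d)} {η ξ : Space d → ℝ}

theorem continuous (h : IsTestFunction U η) : Continuous η := h.1.continuous

theorem memLp (h : IsTestFunction U η) (μ : Measure (Space d)) [IsFiniteMeasureOnCompacts μ] :
    MemLp η 2 μ :=
  h.continuous.memLp_of_hasCompactSupport h.2.1

theorem mono {U' : Set (Space d)} (h : IsTestFunction U η) (hU : U ⊆ U') : IsTestFunction U' η :=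
  ⟨h.1, h.2.1, h.2.2.trans hU⟩

theorem add (h : IsTestFunction U η) (h' : IsTestFunction U ξ) :
    IsTestFunction U (fun x => η x + ξ x) :=
  ⟨h.1.add h'.1, h.2.1.add h'.2.1, (tsupport_add η ξ).trans (Set.union_subset h.2.2 h'.2.2)⟩

theorem const_mul (h : IsTestFunction U η) (c : ℝ) : IsTestFunction U (fun x => c * η x) :=
  ⟨contDiff_const.mul h.1, h.2.1.mul_left (f := fun _ => c),
    (tsupport_mul_subset_right (f := fun _ => c) (g := η)).trans h.2.2⟩

theorem zero : IsTestFunction U (fun _ => 0) :=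
  ⟨contDiff_const, HasCompactSupport.zero, by simp [tsupport]⟩

theorem eq_zero (h : IsTestFunction U η) {x : Space d} (hx : x ∉ U) : η x = 0 :=
  image_eq_zero_of_notMem_tsupport fun hx' => hx (h.2.2 hx')

theorem differentiable (h : IsTestFunction U η) : Differentiable ℝ η :=
  h.1.differentiable (by simp)

theorem inner_gradient (η : Space d → ℝ) (x z : Space d) :
    inner ℝ (gradient η x) z = fderiv ℝ η x z := by
  rw [gradient, InnerProductSpace.toDual_symm_apply]

theorem continuous_gradient (h : IsTestFunction U η) : Continuous (gradient η) :=
  (LinearIsometryEquiv.continuous _).comp (h.1.continuous_fderiv (by simp))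

theorem hasCompactSupport_gradient (h : IsTestFunction U η) : HasCompactSupport (gradient η) :=
  (h.2.1.fderiv (𝕜 := ℝ)).comp_left (g := (InnerProductSpace.toDual ℝ (Space d)).symm)
    (map_zero _)

theorem exists_bound_gradient (h : IsTestFunction U η) : ∃ C, ∀ x, ‖gradient η x‖ ≤ C :=
  h.hasCompactSupport_gradient.exists_bound_of_continuous h.continuous_gradient

theorem exists_bound (h : IsTestFunction U η) : ∃ C, ∀ x, ‖η x‖ ≤ C :=
  h.2.1.exists_bound_of_continuous h.continuous

/-- A translate of a test function. -/
theorem translate (h : IsTestFunction U η) {U' : Set (Space d)} (z : Space d)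
    (hU : ∀ y ∈ U, y + z ∈ U') : IsTestFunction U' (fun x => η (x - z)) := by
  have e : (fun x => η (x - z)) = η ∘ (Homeomorph.addRight (-z)) := by
    ext x; simp [sub_eq_add_neg]
  refine ⟨h.1.comp (contDiff_id.sub contDiff_const), ?_, ?_⟩
  · rw [e]; exact h.2.1.comp_homeomorph _
  · rw [e, tsupport_comp_eq_preimage]
    intro x hx
    have := hU _ (h.2.2 hx)
    simpa using this

theorem gradient_translate (η : Space d → ℝ) (z x : Space d) :
    gradient (fun x => η (x - z)) x = gradient η (x - z) := by
  rw [gradient, gradient, fderiv_comp_sub]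

end IsTestFunction

/-- A function in `L²(U)` is determined, with its norm, by testing. -/
theorem norm_le_of_forall_test {V : Set (Space d)} (hV : IsOpen V) (g : Lp ℝ 2 (volume.restrict V))
    {K : ℝ} (hK : 0 ≤ K) (hg : ∀ η, IsTestFunction V η →
      |∫ x in V, g x * η x| ≤ K * (eLpNorm η 2 (volume.restrict V)).toReal) : ‖g‖ ≤ K := by
  let S : Submodule ℝ (Lp ℝ 2 (volume.restrict V)) :=
    { carrier := {p | ∃ η, IsTestFunction V η ∧ p =ᵐ[volume.restrict V] η}
      add_mem' := by
        rintro p q ⟨η, hη, hp⟩ ⟨ξ, hξ, hq⟩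
        exact ⟨_, hη.add hξ, (Lp.coeFn_add p q).trans (hp.add hq)⟩
      zero_mem' := ⟨_, .zero, Lp.coeFn_zero _ _ _⟩
      smul_mem' := by
        rintro c p ⟨η, hη, hp⟩
        refine ⟨_, hη.const_mul c, (Lp.coeFn_smul c p).trans ?_⟩
        filter_upwards [hp] with x hx
        simp [hx] }
  -- Density of test functions in L², by the fundamental lemma of the calculus of variations.
  have hS : Sᗮ = ⊥ := by
    rw [Submodule.eq_bot_iff]
    intro h hh
    rw [Lp.eq_zero_iff_ae_eq_zero]
    change ∀ᵐ x ∂(volume.restrict V), h x = 0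
    rw [ae_restrict_iff' hV.measurableSet]
    refine hV.ae_eq_zero_of_integral_contDiff_smul_eq_zero ?_ ?_
    · have : MemLp h 2 (volume.restrict V) := Lp.memLp h
      exact (locallyIntegrableOn_of_locallyIntegrable_restrict
        (this.locallyIntegrable (by norm_num)))
    · intro η h1 h2 h3
      have hη : IsTestFunction V η := ⟨h1, h2, h3⟩
      have := Submodule.mem_orthogonal S h |>.1 hh ((hη.memLp _).toLp η)
        ⟨η, hη, (hη.memLp _).coeFn_toLp⟩
      rw [L2.inner_def] at this
      rw [← setIntegral_eq_integral_of_forall_compl_eq_zero (s := V)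
        (fun x hx => by rw [hη.eq_zero hx, zero_smul]), ← this]
      refine integral_congr_ae ?_
      filter_upwards [(hη.memLp (volume.restrict V)).coeFn_toLp] with x hx
      simp [hx, mul_comm]
  have hdense : S.topologicalClosure = ⊤ := (Submodule.topologicalClosure_eq_top_iff).2 hS
  have hcl : ∀ p ∈ S.topologicalClosure, |inner ℝ g p| ≤ K * ‖p‖ := by
    intro p hp
    refine closure_minimal (s := (S : Set (Lp ℝ 2 (volume.restrict V))))
      (t := {p | |inner ℝ g p| ≤ K * ‖p‖}) ?_ ?_
      (by rwa [← Submodule.topologicalClosure_coe])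
    · rintro p ⟨η, hη, hp⟩
      have h1 : inner ℝ g p = ∫ x in V, g x * η x := by
        rw [L2.inner_def]
        refine integral_congr_ae ?_
        filter_upwards [hp] with x hx
        simp [hx, mul_comm]
      change |inner ℝ g p| ≤ K * ‖p‖
      rw [h1, Lp.norm_def, eLpNorm_congr_ae hp]
      exact hg η hη
    · exact isClosed_le (by fun_prop) (by fun_prop)
  -- By density the estimate may be tested with g itself, giving ‖g‖² ≤ K‖g‖.
  have := hcl g (by rw [hdense]; trivial)
  rw [real_inner_self_eq_norm_sq, abs_of_nonneg (sq_nonneg _)] at this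
  by_contra! hlt
  nlinarith [norm_nonneg g]

theorem memLp_translate {E : Type*} [NormedAddCommGroup E] {U V : Set (Space d)} {z : Space d}
    (hU : MeasurableSet U) (hV : ∀ y ∈ V, y + z ∈ U) {f : Space d → E}
    {p : ENNReal} (hf : MemLp f p (volume.restrict U)) :
    MemLp (fun y => f (y + z)) p (volume.restrict V) := by
  have h1 := ((measurePreserving_add_right (volume : Measure (Space d)) z).restrict_preimage hU)
  have h2 := hf.comp_measurePreserving h1
  exact h2.mono_measure (Measure.restrict_mono (fun y hy => hV y hy) le_rfl)

theorem eLpNorm_translate_le {E : Type*} [NormedAddCommGroup E] {U V : Set (Space d)} {z : Space d}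
    (hU : MeasurableSet U) (hV : ∀ y ∈ V, y + z ∈ U) {f : Space d → E}
    {p : ENNReal} (hf : AEStronglyMeasurable f (volume.restrict U)) :
    eLpNorm (fun y => f (y + z)) p (volume.restrict V) ≤ eLpNorm f p (volume.restrict U) := by
  have h1 := ((measurePreserving_add_right (volume : Measure (Space d)) z).restrict_preimage hU)
  rw [← eLpNorm_comp_measurePreserving hf h1]
  exact eLpNorm_mono_measure _ (Measure.restrict_mono (fun y hy => hV y hy) le_rfl)

/-- Translation estimate, tested with a smooth function. -/
theorem abs_integral_translate_sub_le {U V : Set (Space d)}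
    {f : Space d → ℝ} {G : Space d → Space d} (hfi : IntegrableOn f U) (hGi : IntegrableOn G U)
    (hG : MemLp G 2 (volume.restrict U)) (hfG : HasWeakGradient U f G) {z : Space d}
    (hV : ∀ y ∈ V, ∀ t ∈ Set.Icc (0 : ℝ) 1, y + t • z ∈ U) {η : Space d → ℝ}
    (hη : IsTestFunction V η) :
    |(∫ x in U, f x * η (x - z)) - ∫ x in U, f x * η x| ≤
      ‖z‖ * (eLpNorm G 2 (volume.restrict U)).toReal *
        (eLpNorm η 2 (volume.restrict V)).toReal := by
  obtain ⟨B, hB⟩ := hη.exists_bound_gradient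
  obtain ⟨B', hB'⟩ := hη.exists_bound
  -- Only the test function moves, so f is never differentiated classically. The weak gradient turns
  -- F' t = −∫ f ∇η(· − tz)·z into ∫ η(· − tz) G·z, and the mean value inequality finishes.
  let F : ℝ → ℝ := fun t => ∫ x in U, f x * η (x - t • z)
  let F' : ℝ → ℝ := fun t => ∫ x in U, f x * (-inner ℝ (gradient η (x - t • z)) z)
  have hmeas : ∀ t : ℝ, AEStronglyMeasurable (fun x => f x * η (x - t • z)) (volume.restrict U) :=
    fun t => hfi.aestronglyMeasurable.mul
      (hη.continuous.comp (by fun_prop)).aestronglyMeasurable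
  have hder : ∀ t, HasDerivAt F (F' t) t := by
    intro t
    refine (hasDerivAt_integral_of_dominated_loc_of_deriv_le (μ := volume.restrict U)
      (bound := fun x => ‖f x‖ * (B * ‖z‖)) (s := Set.univ) Filter.univ_mem
      (F' := fun t x => f x * (-inner ℝ (gradient η (x - t • z)) z)) ?_ ?_ ?_ ?_ ?_ ?_).2
    · exact Eventually.of_forall hmeas
    · exact hfi.mul_bdd (c := B')
        (hη.continuous.comp (by fun_prop : Continuous fun x => x - t • z)).aestronglyMeasurable
        (Eventually.of_forall fun x => hB' _)
    · refine hfi.aestronglyMeasurable.mul (Continuous.aestronglyMeasurable ?_)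
      have := hη.continuous_gradient
      fun_prop
    · refine Eventually.of_forall fun x s _ => ?_
      rw [norm_mul, norm_neg]
      gcongr
      exact (norm_inner_le_norm _ _).trans (by gcongr; exact hB _)
    · exact hfi.norm.mul_const _
    · refine Eventually.of_forall fun x s _ => ?_
      refine HasDerivAt.const_mul (f x) ?_
      have h1 : HasDerivAt (fun s : ℝ => x - s • z) (-z) s := by
        simpa using ((hasDerivAt_id s).smul_const z).const_sub x
      have h2 := ((hη.differentiable (x - s • z)).hasFDerivAt).comp_hasDerivAt s h1
      rw [IsTestFunction.inner_gradient]
      rw [map_neg] at h2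
      exact h2
  have hbound : ∀ t ∈ Set.Ico (0 : ℝ) 1, ‖F' t‖ ≤ ‖z‖ * (eLpNorm G 2 (volume.restrict U)).toReal *
        (eLpNorm η 2 (volume.restrict V)).toReal := by
    intro t ht
    have hηt : IsTestFunction U (fun x => η (x - t • z)) :=
      hη.translate (t • z) fun y hy => hV y hy t ⟨ht.1, ht.2.le⟩
    have e := hfG _ hηt
    have i1 : Integrable (fun x => f x • gradient (fun x => η (x - t • z)) x)
        (volume.restrict U) := by
      simp_rw [IsTestFunction.gradient_translate]
      exact hfi.smul_bdd B
        (hη.continuous_gradient.comp (by fun_prop : Continuous fun x => x - t • z)).aestronglyMeasurable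
        (Eventually.of_forall fun x => hB _)
    have i2 : Integrable (fun x => η (x - t • z) • G x) (volume.restrict U) :=
      hGi.bdd_smul B' hηt.continuous.aestronglyMeasurable (Eventually.of_forall fun x => hB' _)
    have e2 : F' t = ∫ x in U, inner ℝ (η (x - t • z) • z) (G x) := by
      calc F' t = -∫ x in U, inner ℝ z (f x • gradient (fun x => η (x - t • z)) x) := by
            rw [← integral_neg]
            refine integral_congr_ae (Eventually.of_forall fun x => ?_)
            simp only [IsTestFunction.gradient_translate, inner_smul_right, mul_neg]
            rw [real_inner_comm]
        _ = -inner ℝ z (∫ x in U, f x • gradient (fun x => η (x - t • z)) x) := by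
            rw [integral_inner i1]
        _ = inner ℝ z (∫ x in U, η (x - t • z) • G x) := by
            rw [e, inner_neg_right, neg_neg]
        _ = _ := by
            rw [← integral_inner i2]
            simp only [inner_smul_right, inner_smul_left, RCLike.conj_to_real]
    rw [e2, Real.norm_eq_abs]
    have m1 : MemLp (fun x => η (x - t • z)) 2 (volume.restrict U) := hηt.memLp _
    have m2 : MemLp (fun x => η (x - t • z) • z) 2 (volume.restrict U) :=
      (hηt.1.smul contDiff_const).continuous.memLp_of_hasCompactSupport
        (hηt.2.1.smul_right (f' := fun _ => z))
    refine (abs_integral_inner_le m2 hG).trans ?_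
    have n1 : eLpNorm (fun x => η (x - t • z) • z) 2 (volume.restrict U) ≤
        ENNReal.ofReal ‖z‖ * eLpNorm η 2 (volume.restrict V) := by
      calc _ ≤ ENNReal.ofReal ‖z‖ * eLpNorm (fun x => η (x - t • z)) 2 (volume.restrict U) := by
            refine eLpNorm_le_mul_eLpNorm_of_ae_le_mul (Eventually.of_forall fun x => ?_) 2
            rw [norm_smul, mul_comm]
        _ ≤ ENNReal.ofReal ‖z‖ * eLpNorm (fun x => η (x - t • z)) 2 volume := by
            gcongr; exact Measure.restrict_le_self
        _ = ENNReal.ofReal ‖z‖ * eLpNorm η 2 volume := by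
            have := eLpNorm_comp_measurePreserving (p := 2) (g := η)
              hη.continuous.aestronglyMeasurable
              (measurePreserving_sub_right (volume : Measure (Space d)) (t • z))
            rw [← this]; rfl
        _ = _ := by
            rw [eLpNorm_restrict_eq_of_support_subset]
            exact (subset_tsupport η).trans hη.2.2
    have n2 := ENNReal.toReal_mono
      (ENNReal.mul_ne_top ENNReal.ofReal_ne_top (hη.memLp (volume.restrict V)).2.ne) n1
    rw [ENNReal.toReal_mul, ENNReal.toReal_ofReal (norm_nonneg _)] at n2
    calc _ ≤ (‖z‖ * (eLpNorm η 2 (volume.restrict V)).toReal) *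
          (eLpNorm G 2 (volume.restrict U)).toReal := by gcongr
      _ = _ := by ring
  have := norm_image_sub_le_of_norm_deriv_le_segment_01' (f := F) (f' := F')
    (fun t _ => (hder t).hasDerivWithinAt) hbound
  simpa [F] using this

/-- Translation estimate: `‖f(· + z) - f‖ ≤ |z| ‖∇f‖`. -/
theorem eLpNorm_translate_sub_le {U V : Set (Space d)} (hU : MeasurableSet U) (hVo : IsOpen V)
    {f : Space d → ℝ} {G : Space d → Space d} (hfi : IntegrableOn f U) (hGi : IntegrableOn G U)
    (hf : MemLp f 2 (volume.restrict U))
    (hG : MemLp G 2 (volume.restrict U)) (hfG : HasWeakGradient U f G) {z : Space d}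
    (hV : ∀ y ∈ V, ∀ t ∈ Set.Icc (0 : ℝ) 1, y + t • z ∈ U) :
    (eLpNorm (fun y => f (y + z) - f y) 2 (volume.restrict V)).toReal ≤
      ‖z‖ * (eLpNorm G 2 (volume.restrict U)).toReal := by
  have hVz : ∀ y ∈ V, y + z ∈ U := fun y hy => by simpa using hV y hy 1 ⟨zero_le_one, le_rfl⟩
  have hVU : V ⊆ U := fun y hy => by simpa using hV y hy 0 ⟨le_rfl, zero_le_one⟩
  have m1 : MemLp (fun y => f (y + z)) 2 (volume.restrict V) := memLp_translate hU hVz hf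
  have m2 : MemLp f 2 (volume.restrict V) := hf.mono_measure (Measure.restrict_mono hVU le_rfl)
  have m := m1.sub m2
  -- Duality: the L² norm is bounded through pairings with test functions on V, and a change of
  -- variables moves the shift onto η.
  have key := norm_le_of_forall_test hVo (m.toLp _)
    (K := ‖z‖ * (eLpNorm G 2 (volume.restrict U)).toReal) (by positivity) ?_
  · rwa [Lp.norm_toLp] at key
  intro η hη
  have h := abs_integral_translate_sub_le hfi hGi hG hfG hV hη
  refine le_trans (le_of_eq ?_) h
  congr 1
  have e1 : ∫ x in U, f x * η x = ∫ x in V, f x * η x := by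
    rw [setIntegral_eq_of_subset_of_forall_sdiff_eq_zero hU hVU]
    intro x hx; rw [hη.eq_zero hx.2, mul_zero]
  have e2 : ∫ x in U, f x * η (x - z) = ∫ x in V, f (x + z) * η x := by
    rw [setIntegral_eq_integral_of_forall_compl_eq_zero (s := U),
      setIntegral_eq_integral_of_forall_compl_eq_zero (s := V),
      ← integral_add_right_eq_self _ z]
    · simp
    · intro x hx; rw [hη.eq_zero hx, mul_zero]
    · intro x hx
      rw [hη.eq_zero (fun h => hx (by simpa using hVz _ h)), mul_zero]
  rw [e1, e2, ← integral_sub (f := fun x => f (x + z) * η x) (g := fun x => f x * η x)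
    (m1.integrable_mul (hη.memLp _)) (m2.integrable_mul (hη.memLp _))]
  refine integral_congr_ae ?_
  filter_upwards [m.coeFn_toLp] with x hx
  rw [hx]
  simp [sub_mul]

end Translation

/-! ### Compactness in `L²` of bounded sequences of `H¹` -/

section Rellich

theorem toReal_eLpNorm_two_sq {α E : Type*} [MeasurableSpace α] {μ : Measure α}
    [NormedAddCommGroup E] [InnerProductSpace ℝ E] {f : α → E} (hf : MemLp f 2 μ) :
    (eLpNorm f 2 μ).toReal ^ 2 = ∫ x, ‖f x‖ ^ 2 ∂μ := by
  rw [← Lp.norm_toLp f hf, ← real_inner_self_eq_norm_sq, L2.inner_def]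
  refine integral_congr_ae ?_
  filter_upwards [hf.coeFn_toLp] with x hx
  rw [hx, real_inner_self_eq_norm_sq]

theorem eLpNorm_two_sq {α E : Type*} [MeasurableSpace α] {μ : Measure α}
    [NormedAddCommGroup E] (f : α → E) :
    eLpNorm f 2 μ ^ 2 = ∫⁻ x, ‖f x‖ₑ ^ 2 ∂μ := by
  have h := eLpNorm_nnreal_pow_eq_lintegral (f := f) (μ := μ) (p := 2) two_ne_zero
  simpa using h

theorem tendsto_sq_zero_iff {α : Type*} {l : Filter α} {x : α → ENNReal} :
    Tendsto (fun n => x n ^ 2) l (𝓝 0) ↔ Tendsto x l (𝓝 0) := by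
  constructor
  · intro h
    have := h.ennrpow_const (1 / 2 : ℝ)
    have e : ∀ n, (x n ^ 2) ^ (1 / 2 : ℝ) = x n := fun n => by
      rw [← ENNReal.rpow_natCast, ← ENNReal.rpow_mul]; norm_num
    simp only [e] at this
    simpa using this
  · intro h
    simpa using ENNReal.Tendsto.pow (n := 2) h

variable {d : ℕ}

/-- A bounded sequence in `H¹(U)` whose functions tend to zero weakly. -/
structure WeaklyNull (U : Set (Space d)) (f : ℕ → Space d → ℝ) (G : ℕ → Space d → Space d)
    (M : ℝ) : Prop where
  meas : ∀ n, StronglyMeasurable (f n)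
  int_f : ∀ n, IntegrableOn (f n) U
  int_G : ∀ n, IntegrableOn (G n) U
  memLp_f : ∀ n, MemLp (f n) 2 (volume.restrict U)
  memLp_G : ∀ n, MemLp (G n) 2 (volume.restrict U)
  grad : ∀ n, HasWeakGradient U (f n) (G n)
  bound_f : ∀ n, (eLpNorm (f n) 2 (volume.restrict U)).toReal ≤ M
  bound_G : ∀ n, (eLpNorm (G n) 2 (volume.restrict U)).toReal ≤ M
  null : ∀ x r, Metric.ball x r ⊆ U → Tendsto (fun n => ∫ y in Metric.ball x r, f n y) atTop (𝓝 0)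

theorem toReal_eLpNorm_mono {α E : Type*} [MeasurableSpace α] {μ ν : Measure α}
    [NormedAddCommGroup E] {f : α → E} (h : MemLp f 2 ν) (hμ : μ ≤ ν) :
    (eLpNorm f 2 μ).toReal ≤ (eLpNorm f 2 ν).toReal :=
  ENNReal.toReal_mono h.2.ne (eLpNorm_mono_measure _ hμ)

theorem setIntegral_ball_add {f : Space d → ℝ} (y : Space d) (δ : ℝ) :
    ∫ z in Metric.ball 0 δ, f (y + z) = ∫ x in Metric.ball y δ, f x := by
  have h1 := (measurePreserving_add_left (volume : Measure (Space d)) y)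
  have h2 := h1.setIntegral_preimage_emb (MeasurableEquiv.addLeft y).measurableEmbedding f
    (Metric.ball y δ)
  rw [← h2]
  congr 2
  ext z
  simp

/-- Local compactness: a ball on which the sequence tends to zero strongly. -/
theorem WeaklyNull.tendsto_ball {U : Set (Space d)} (hU : IsOpen U) {f : ℕ → Space d → ℝ}
    {G : ℕ → Space d → Space d} {M : ℝ} (h : WeaklyNull U f G M) {x₀ : Space d} {r : ℝ}
    (hr : 0 < r) (hball : Metric.ball x₀ (2 * r) ⊆ U) :
    Tendsto (fun n => eLpNorm (f n) 2 (volume.restrict (Metric.ball x₀ r))) atTop (𝓝 0) := by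
  set V := Metric.ball x₀ r with hVdef
  have hM : 0 ≤ M := ENNReal.toReal_nonneg.trans (h.bound_f 0)
  have hVz : ∀ z ∈ Metric.ball (0 : Space d) r, ∀ y ∈ V, ∀ t ∈ Set.Icc (0 : ℝ) 1,
      y + t • z ∈ U := by
    intro z hz y hy t ht
    apply hball
    rw [Metric.mem_ball, dist_eq_norm] at hy ⊢
    rw [mem_ball_zero_iff] at hz
    calc ‖y + t • z - x₀‖ = ‖(y - x₀) + t • z‖ := by congr 1; abel
      _ ≤ ‖y - x₀‖ + ‖t • z‖ := norm_add_le _ _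
      _ ≤ ‖y - x₀‖ + 1 * ‖z‖ := by
        rw [norm_smul, Real.norm_eq_abs, abs_of_nonneg ht.1]; gcongr; exact ht.2
      _ < 2 * r := by linarith
  have hVU : V ⊆ U := fun y hy => by
    simpa using hVz 0 (Metric.mem_ball_self hr) y hy 0 ⟨le_rfl, zero_le_one⟩
  have hVU' : volume.restrict V ≤ volume.restrict U := Measure.restrict_mono hVU le_rfl
  have mV : ∀ n, MemLp (f n) 2 (volume.restrict V) := fun n => (h.memLp_f n).mono_measure hVU'
  have bV : ∀ n, (eLpNorm (f n) 2 (volume.restrict V)).toReal ≤ M := fun n =>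
    (toReal_eLpNorm_mono (h.memLp_f n) hVU').trans (h.bound_f n)
  have hVfin : IsFiniteMeasure (volume.restrict V) :=
    ⟨by rw [Measure.restrict_apply_univ]; exact measure_ball_lt_top⟩
  -- the averages over small balls tend to zero
  have havg : ∀ δ, 0 < δ → δ < r → Tendsto (fun n =>
      (eLpNorm (fun y => ∫ z in Metric.ball 0 δ, f n (y + z)) 2 (volume.restrict V)).toReal)
      atTop (𝓝 0) ∧ ∀ n, MemLp (fun y => ∫ z in Metric.ball 0 δ, f n (y + z)) 2
        (volume.restrict V) := by
    intro δ hδ hδr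
    have hsub : ∀ y ∈ V, Metric.ball y δ ⊆ U := fun y hy x hx => hball (by
      rw [Metric.mem_ball] at hx hy ⊢
      linarith [dist_triangle x y x₀])
    -- The Cauchy–Schwarz bound for the integral of f n over a δ-ball. It is uniform in y and n and
    -- serves as the dominating constant.
    let D : ℝ := (eLpNorm (fun _ : Space d => (1 : ℝ)) 2
      (volume.restrict (Metric.ball (0 : Space d) δ))).toReal * M
    have hone : ∀ y, eLpNorm (fun _ : Space d => (1 : ℝ)) 2 (volume.restrict (Metric.ball y δ)) =
        eLpNorm (fun _ : Space d => (1 : ℝ)) 2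
          (volume.restrict (Metric.ball (0 : Space d) δ)) := fun y => by
      rw [eLpNorm_const', eLpNorm_const'] <;> simp [Measure.addHaar_ball_center volume y δ]
    have hbd : ∀ n, ∀ y ∈ V, ‖∫ z in Metric.ball 0 δ, f n (y + z)‖ ≤ D := by
      intro n y hy
      rw [setIntegral_ball_add]
      have hm := Measure.restrict_mono (μ := volume) (hsub y hy) le_rfl
      have hfin : IsFiniteMeasure (volume.restrict (Metric.ball y δ)) :=
        ⟨by rw [Measure.restrict_apply_univ]; exact measure_ball_lt_top⟩
      have h1 := abs_integral_mul_le (memLp_const (μ := volume.restrict (Metric.ball y δ)) (1 : ℝ))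
        ((h.memLp_f n).mono_measure hm)
      simp only [one_mul] at h1
      rw [Real.norm_eq_abs]
      refine h1.trans ?_
      rw [hone]
      exact mul_le_mul_of_nonneg_left
        ((toReal_eLpNorm_mono (h.memLp_f n) hm).trans (h.bound_f n)) ENNReal.toReal_nonneg
    have hmeas : ∀ n, StronglyMeasurable fun y => ∫ z in Metric.ball 0 δ, f n (y + z) := by
      intro n
      have : StronglyMeasurable (Function.uncurry fun y z => f n (y + z)) :=
        (h.meas n).comp_measurable (by fun_prop)
      exact this.integral_prod_right
    have hmem : ∀ n, MemLp (fun y => ∫ z in Metric.ball 0 δ, f n (y + z)) 2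
        (volume.restrict V) := fun n =>
      MemLp.of_bound (hmeas n).aestronglyMeasurable D
        ((ae_restrict_iff' Metric.isOpen_ball.measurableSet).2 (Eventually.of_forall (hbd n)))
    refine ⟨?_, hmem⟩
    have hlim : Tendsto (fun n => ∫ y in V, ‖∫ z in Metric.ball 0 δ, f n (y + z)‖ ^ 2) atTop
        (𝓝 (∫ y in V, (0 : ℝ))) := by
      refine tendsto_integral_of_dominated_convergence (fun _ => D ^ 2)
        (fun n => ((hmeas n).norm.pow 2).aestronglyMeasurable) (integrable_const _) ?_ ?_
      · intro n
        rw [ae_restrict_iff' Metric.isOpen_ball.measurableSet]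
        refine Eventually.of_forall fun y hy => ?_
        rw [norm_pow, norm_norm]
        exact pow_le_pow_left₀ (norm_nonneg _) (hbd n y hy) 2
      · rw [ae_restrict_iff' Metric.isOpen_ball.measurableSet]
        refine Eventually.of_forall fun y hy => ?_
        have := h.null y δ (hsub y hy)
        simp_rw [setIntegral_ball_add]
        simpa using (this.norm.pow 2)
    simp_rw [← toReal_eLpNorm_two_sq (hmem _)] at hlim
    have := hlim.sqrt
    simpa [Real.sqrt_sq ENNReal.toReal_nonneg] using this
  -- the main estimate
  have hmain : ∀ δ, 0 < δ → δ < r → ∀ n,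
      volume.real (Metric.ball (0 : Space d) δ) *
        (eLpNorm (f n) 2 (volume.restrict V)).toReal ^ 2 ≤
      volume.real (Metric.ball (0 : Space d) δ) * (M * (δ * M)) +
        M * (eLpNorm (fun y => ∫ z in Metric.ball 0 δ, f n (y + z)) 2
          (volume.restrict V)).toReal := by
    intro δ hδ hδr n
    set B := Metric.ball (0 : Space d) δ
    have hBr : ∀ z ∈ B, z ∈ Metric.ball (0 : Space d) r := fun z hz =>
      Metric.ball_subset_ball hδr.le hz
    have hBfin : IsFiniteMeasure (volume.restrict B) :=
      ⟨by rw [Measure.restrict_apply_univ]; exact measure_ball_lt_top⟩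
    have mz : ∀ z ∈ B, MemLp (fun y => f n (y + z)) 2 (volume.restrict V) := fun z hz =>
      memLp_translate hU.measurableSet
        (fun y hy => by simpa using hVz z (hBr z hz) y hy 1 ⟨zero_le_one, le_rfl⟩) (h.memLp_f n)
    have bz : ∀ z ∈ B, (eLpNorm (fun y => f n (y + z)) 2 (volume.restrict V)).toReal ≤ M :=
      fun z hz => (ENNReal.toReal_mono (h.memLp_f n).2.ne (eLpNorm_translate_le hU.measurableSet
        (fun y hy => by simpa using hVz z (hBr z hz) y hy 1 ⟨zero_le_one, le_rfl⟩)
        (h.memLp_f n).1)).trans (h.bound_f n)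
    have hmeas2 : StronglyMeasurable (fun q : Space d × Space d => f n q.2 * f n (q.2 + q.1)) :=
      ((h.meas n).comp_measurable measurable_snd).mul ((h.meas n).comp_measurable (by fun_prop))
    have hint : Integrable (Function.uncurry fun z y : Space d => f n y * f n (y + z))
        ((volume.restrict B).prod (volume.restrict V)) := by
      refine (integrable_prod_iff hmeas2.aestronglyMeasurable).2 ⟨?_, ?_⟩
      · rw [ae_restrict_iff' Metric.isOpen_ball.measurableSet]
        exact Eventually.of_forall fun z hz => (mV n).integrable_mul (mz z hz)
      · refine Integrable.of_bound (C := M * M)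
          (hmeas2.norm.integral_prod_right).aestronglyMeasurable ?_
        rw [ae_restrict_iff' Metric.isOpen_ball.measurableSet]
        refine Eventually.of_forall fun z hz => ?_
        have h1 := abs_integral_mul_le (mV n).norm (mz z hz).norm
        simp only [eLpNorm_norm] at h1
        rw [Real.norm_eq_abs]
        simp only [norm_mul]
        refine h1.trans ?_
        gcongr
        · exact bV n
        · exact bz z hz
    have hswap := integral_integral_swap hint
    -- The identity behind the estimate is |B| ‖f‖² = ∫_B ∫_V f(y)(f(y) − f(y+z)) + ∫_V f(y) ∫_B
    -- f(y+z). The translation estimate bounds the first term by |B| M · δM; the ball integrals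
    -- control the second.
    have e1 : volume.real B * (eLpNorm (f n) 2 (volume.restrict V)).toReal ^ 2 =
        ∫ z in B, ∫ y in V, f n y * f n y := by
      rw [setIntegral_const, toReal_eLpNorm_two_sq (mV n), smul_eq_mul]
      congr 2
      ext y
      rw [Real.norm_eq_abs, sq_abs, sq]
    have e2 : (∫ z in B, ∫ y in V, f n y * f n y) -
        (∫ z in B, ∫ y in V, f n y * f n (y + z)) =
        ∫ z in B, ((∫ y in V, f n y * f n y) - ∫ y in V, f n y * f n (y + z)) :=
      (integral_sub (integrable_const _) hint.integral_prod_left).symm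
    have e3 : |∫ z in B, ((∫ y in V, f n y * f n y) - ∫ y in V, f n y * f n (y + z))| ≤
        volume.real B * (M * (δ * M)) := by
      have := norm_setIntegral_le_of_norm_le_const (μ := volume) (s := B) (C := M * (δ * M))
        (f := fun z => (∫ y in V, f n y * f n y) - ∫ y in V, f n y * f n (y + z))
        measure_ball_lt_top ?_
      · rw [mul_comm]; exact this
      intro z hz
      have t := eLpNorm_translate_sub_le hU.measurableSet Metric.isOpen_ball (h.int_f n) (h.int_G n)
        (h.memLp_f n) (h.memLp_G n) (h.grad n) (hVz z (hBr z hz))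
      rw [← integral_sub (f := fun y => f n y * f n y) (g := fun y => f n y * f n (y + z))
        ((mV n).integrable_mul (mV n)) ((mV n).integrable_mul (mz z hz))]
      have h2 := abs_integral_mul_le (mV n) ((mz z hz).sub (mV n))
      rw [← abs_neg, ← integral_neg] at h2
      have h3 : ∀ y, f n y * f n y - f n y * f n (y + z) =
        -(f n y * ((fun y => f n (y + z)) - f n) y) := fun y => by simp; ring
      simp only [h3]
      rw [Real.norm_eq_abs]
      refine h2.trans ?_
      have hz' : ‖z‖ ≤ δ := (mem_ball_zero_iff.1 hz).le
      refine mul_le_mul (bV n) (t.trans ?_) ENNReal.toReal_nonneg hM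
      gcongr
      exact h.bound_G n
    have e4 : ∫ z in B, ∫ y in V, f n y * f n (y + z) ≤ M *
        (eLpNorm (fun y => ∫ z in B, f n (y + z)) 2 (volume.restrict V)).toReal := by
      rw [hswap]
      simp only [integral_const_mul]
      refine (le_abs_self _).trans ((abs_integral_mul_le (mV n) ((havg δ hδ hδr).2 n)).trans ?_)
      gcongr
      exact bV n
    have e5 := (abs_le.1 e3).2
    rw [e1]
    linarith
  have hreal : Tendsto (fun n => (eLpNorm (f n) 2 (volume.restrict V)).toReal) atTop (𝓝 0) := by
    rw [Metric.tendsto_atTop]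
    intro ε hε
    -- The translation error gets half of ε², and the ball integrals the other half for large n. The
    -- + 1 in the denominator covers M = 0.
    obtain ⟨δ, hδ, hδr, hδε⟩ : ∃ δ, 0 < δ ∧ δ < r ∧ M * (δ * M) ≤ ε ^ 2 / 2 := by
      refine ⟨min (r / 2) (ε ^ 2 / 2 / (M * M + 1)), by positivity,
        (min_le_left _ _).trans_lt (by linarith), ?_⟩
      have h1 : min (r / 2) (ε ^ 2 / 2 / (M * M + 1)) ≤ ε ^ 2 / 2 / (M * M + 1) := min_le_right _ _
      calc _ = min (r / 2) (ε ^ 2 / 2 / (M * M + 1)) * (M * M) := by ring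
        _ ≤ ε ^ 2 / 2 / (M * M + 1) * (M * M + 1) := by gcongr; linarith
        _ = ε ^ 2 / 2 := by field_simp
    have hB : 0 < volume.real (Metric.ball (0 : Space d) δ) :=
      ENNReal.toReal_pos (Metric.measure_ball_pos _ _ hδ).ne' measure_ball_lt_top.ne
    have h1 := ((havg δ hδ hδr).1.const_mul M).eventually_lt_const
      (show M * 0 < volume.real (Metric.ball (0 : Space d) δ) * (ε ^ 2 / 2) by
        rw [mul_zero]; positivity)
    obtain ⟨N, hN⟩ := h1.exists_forall_of_atTop
    refine ⟨N, fun n hn => ?_⟩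
    have h2 := hmain δ hδ hδr n
    have h3 := hN n hn
    rw [Real.dist_eq, sub_zero, abs_of_nonneg ENNReal.toReal_nonneg]
    have h4 : (eLpNorm (f n) 2 (volume.restrict V)).toReal ^ 2 < ε ^ 2 := by
      by_contra! hc
      nlinarith
    exact lt_of_pow_lt_pow_left₀ 2 hε.le h4
  exact (ENNReal.tendsto_toReal_iff (fun n => (mV n).2.ne) (by simp)).1 (by simpa using hreal)

/-- Compactness up to the boundary: near a boundary point the sequence tends to zero strongly if it
does so on compact subsets. -/
theorem WeaklyNull.tendsto_boundary {U : Set (Space d)} (hU : IsOpen U) {f : ℕ → Space d → ℝ}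
    {G : ℕ → Space d → Space d} {M : ℝ} (h : WeaklyNull U f G M)
    (hloc : ∀ K ⊆ U, IsCompact K →
      Tendsto (fun n => eLpNorm (f n) 2 (volume.restrict K)) atTop (𝓝 0))
    (hlip : HasLipschitzBoundary U) {x₀ : Space d} (hx₀ : x₀ ∈ frontier U) :
    ∃ r > 0, Tendsto (fun n => eLpNorm (f n) 2 (volume.restrict (Metric.ball x₀ r ∩ U)))
      atTop (𝓝 0) := by
  obtain ⟨e, he, r, hr, K, g, hg, hUg⟩ := hlip x₀ hx₀
  have hM : 0 ≤ M := ENNReal.toReal_nonneg.trans (h.bound_f 0)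
  refine ⟨r / 2, by positivity, ?_⟩
  set V := Metric.ball x₀ (r / 2) ∩ U with hVdef
  have hVo : IsOpen V := Metric.isOpen_ball.inter hU
  have hVU : V ⊆ U := Set.inter_subset_right
  have hproj : ∀ (y : Space d) (t : ℝ), (ℝ ∙ e)ᗮ.orthogonalProjectionOnto (y + t • e) =
      (ℝ ∙ e)ᗮ.orthogonalProjectionOnto y := fun y t => by
    rw [map_add, map_smul, Submodule.orthogonalProjectionOnto_orthogonal_apply_eq_zero
      (Submodule.mem_span_singleton_self e), smul_zero, add_zero]
  have hin : ∀ (y : Space d) (t : ℝ), inner ℝ e (y + t • e) = inner ℝ e y + t := fun y t => by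
    rw [inner_add_right, inner_smul_right, real_inner_self_eq_norm_sq, he]; simp
  have hballt : ∀ y ∈ Metric.closedBall x₀ (r / 2), ∀ t : ℝ, 0 ≤ t → t < r / 2 →
      y + t • e ∈ Metric.ball x₀ r := by
    intro y hy t ht0 ht
    rw [Metric.mem_closedBall, dist_eq_norm] at hy
    rw [Metric.mem_ball, dist_eq_norm]
    calc ‖y + t • e - x₀‖ = ‖(y - x₀) + t • e‖ := by congr 1; abel
      _ ≤ ‖y - x₀‖ + ‖t • e‖ := norm_add_le _ _
      _ = ‖y - x₀‖ + t := by rw [norm_smul, he, Real.norm_eq_abs, abs_of_nonneg ht0, mul_one]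
      _ < r := by linarith
  have hclos : ∀ y ∈ closure V, y ∈ Metric.closedBall x₀ (r / 2) ∧
      g ((ℝ ∙ e)ᗮ.orthogonalProjectionOnto y) ≤ inner ℝ e y := by
    intro y hy
    refine ⟨closure_minimal (Set.inter_subset_left.trans Metric.ball_subset_closedBall)
      Metric.isClosed_closedBall hy, ?_⟩
    have hc : IsClosed {y | g ((ℝ ∙ e)ᗮ.orthogonalProjectionOnto y) ≤ inner ℝ e y} := by
      have := hg.continuous
      exact isClosed_le (by fun_prop) (by fun_prop)
    refine closure_minimal (fun z hz => ?_) hc hy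
    exact ((hUg z (Metric.ball_subset_ball (by linarith) hz.1)).1 hz.2).le
  -- Near x₀ the set U is an epigraph in direction e, so the shift by τe carries closure V to a
  -- compact subset Q of U. It changes the norm by at most τM.
  have hmain : ∀ τ, 0 < τ → τ < r / 2 → ∃ Q ⊆ U, IsCompact Q ∧ ∀ n,
      (eLpNorm (f n) 2 (volume.restrict V)).toReal ≤
        (eLpNorm (f n) 2 (volume.restrict Q)).toReal + τ * M := by
    intro τ hτ hτr
    have hQc : IsCompact ((· + τ • e) '' closure V) := by
      refine IsCompact.image ?_ (by fun_prop)
      exact (Metric.isBounded_ball.subset Set.inter_subset_left).isCompact_closure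
    have hQU : (· + τ • e) '' closure V ⊆ U := by
      rintro _ ⟨y, hy, rfl⟩
      obtain ⟨h1, h2⟩ := hclos y hy
      refine (hUg _ (hballt y h1 τ hτ.le hτr)).2 ?_
      rw [hproj, hin]
      linarith
    refine ⟨_, hQU, hQc, fun n => ?_⟩
    have hseg : ∀ y ∈ V, ∀ t ∈ Set.Icc (0 : ℝ) 1, y + t • (τ • e) ∈ U := by
      intro y hy t ht
      rw [smul_smul]
      have hyb := Metric.ball_subset_closedBall hy.1
      have h0 : 0 ≤ t * τ := mul_nonneg ht.1 hτ.le
      have h1 : t * τ < r / 2 := by nlinarith [ht.2]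
      refine (hUg _ (hballt y hyb _ h0 h1)).2 ?_
      rw [hproj, hin]
      have := (hUg y (Metric.ball_subset_ball (by linarith) hy.1)).1 hy.2
      linarith
    have hVQ : ∀ y ∈ V, y + τ • e ∈ (· + τ • e) '' closure V := fun y hy =>
      ⟨y, subset_closure hy, rfl⟩
    have mQ : MemLp (f n) 2 (volume.restrict ((· + τ • e) '' closure V)) :=
      (h.memLp_f n).mono_measure (Measure.restrict_mono hQU le_rfl)
    have mV : MemLp (f n) 2 (volume.restrict V) :=
      (h.memLp_f n).mono_measure (Measure.restrict_mono hVU le_rfl)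
    have mz : MemLp (fun y => f n (y + τ • e)) 2 (volume.restrict V) :=
      memLp_translate hQc.measurableSet hVQ mQ
    have t1 := eLpNorm_translate_le (p := 2) hQc.measurableSet hVQ mQ.1
    have t2 := eLpNorm_translate_sub_le hU.measurableSet hVo (h.int_f n) (h.int_G n)
      (h.memLp_f n) (h.memLp_G n) (h.grad n) hseg
    have t3 : eLpNorm (f n) 2 (volume.restrict V) ≤
        eLpNorm (fun y => f n (y + τ • e)) 2 (volume.restrict V) +
          eLpNorm (fun y => f n (y + τ • e) - f n y) 2 (volume.restrict V) := by
      have := eLpNorm_sub_le (p := 2) mz.1 (mz.sub mV).1 (by norm_num)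
      rw [sub_sub_cancel] at this
      exact this
    have t4 := ENNReal.toReal_mono (ENNReal.add_ne_top.2 ⟨mz.2.ne, (mz.sub mV).2.ne⟩) t3
    rw [ENNReal.toReal_add mz.2.ne (mz.sub mV).2.ne] at t4
    refine t4.trans (add_le_add (ENNReal.toReal_mono mQ.2.ne t1) (t2.trans ?_))
    rw [norm_smul, he, mul_one, Real.norm_eq_abs, abs_of_pos hτ]
    gcongr
    exact h.bound_G n
  have mV : ∀ n, MemLp (f n) 2 (volume.restrict V) := fun n =>
    (h.memLp_f n).mono_measure (Measure.restrict_mono hVU le_rfl)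
  refine (ENNReal.tendsto_toReal_iff (fun n => (mV n).2.ne) (by simp)).1 ?_
  rw [ENNReal.toReal_zero, Metric.tendsto_atTop]
  intro ε hε
  obtain ⟨τ, hτ, hτr, hτε⟩ : ∃ τ, 0 < τ ∧ τ < r / 2 ∧ τ * M ≤ ε / 2 := by
    refine ⟨min (r / 4) (ε / 2 / (M + 1)), by positivity,
      (min_le_left _ _).trans_lt (by linarith), ?_⟩
    calc min (r / 4) (ε / 2 / (M + 1)) * M ≤ ε / 2 / (M + 1) * (M + 1) := by
          gcongr
          · exact min_le_right _ _
          · linarith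
      _ = ε / 2 := by field_simp
  obtain ⟨Q, hQU, hQ, hle⟩ := hmain τ hτ hτr
  have h1 := (ENNReal.tendsto_toReal ENNReal.zero_ne_top).comp (hloc Q hQU hQ)
  obtain ⟨N, hN⟩ := (h1.eventually_lt_const
    (show (0 : ENNReal).toReal < ε / 2 by simpa using hε)).exists_forall_of_atTop
  refine ⟨N, fun n hn => ?_⟩
  rw [Real.dist_eq, sub_zero, abs_of_nonneg ENNReal.toReal_nonneg]
  have := hN n hn
  simp only [Function.comp] at this
  linarith [hle n]

/-- Rellich's theorem for bounded sets with Lipschitz boundary. -/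
theorem WeaklyNull.tendsto {U : Set (Space d)} (hU : IsOpen U) (hbdd : Bornology.IsBounded U)
    (hlip : HasLipschitzBoundary U) {f : ℕ → Space d → ℝ}
    {G : ℕ → Space d → Space d} {M : ℝ} (h : WeaklyNull U f G M) :
    Tendsto (fun n => eLpNorm (f n) 2 (volume.restrict U)) atTop (𝓝 0) := by
  -- Local strong convergence is patched over a compact set, squared norms being subadditive over
  -- unions.
  have key : ∀ K : Set (Space d), IsCompact K →
      (∀ x ∈ K, ∃ t ∈ 𝓝[K] x,
        Tendsto (fun n => eLpNorm (f n) 2 (volume.restrict (t ∩ U))) atTop (𝓝 0)) →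
      Tendsto (fun n => eLpNorm (f n) 2 (volume.restrict (K ∩ U))) atTop (𝓝 0) := by
    intro K hK
    refine hK.induction_on
      (p := fun s => Tendsto (fun n => eLpNorm (f n) 2 (volume.restrict (s ∩ U))) atTop (𝓝 0))
      (by simp) ?_ ?_
    · intro s t hst ht
      refine tendsto_of_tendsto_of_tendsto_of_le_of_le tendsto_const_nhds ht
        (fun _ => zero_le) fun n => eLpNorm_mono_measure _
          (Measure.restrict_mono (Set.inter_subset_inter_left _ hst) le_rfl)
    · intro s t hs ht
      rw [← tendsto_sq_zero_iff] at hs ht ⊢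
      simp only [eLpNorm_two_sq] at hs ht ⊢
      refine tendsto_of_tendsto_of_tendsto_of_le_of_le tendsto_const_nhds
        (by simpa using hs.add ht) (fun _ => zero_le) fun n => ?_
      rw [Set.union_inter_distrib_right]
      exact lintegral_union_le _ _ _
  have hinner : ∀ x ∈ U, ∃ t ∈ 𝓝 x,
      Tendsto (fun n => eLpNorm (f n) 2 (volume.restrict (t ∩ U))) atTop (𝓝 0) := by
    intro x hx
    obtain ⟨r, hr, hxr⟩ := Metric.isOpen_iff.1 hU x hx
    refine ⟨Metric.ball x (r / 2), Metric.ball_mem_nhds x (by positivity), ?_⟩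
    have hsub : Metric.ball x (2 * (r / 2)) ⊆ U := by rwa [mul_div_cancel₀ r two_ne_zero]
    rw [Set.inter_eq_left.2 ((Metric.ball_subset_ball (by linarith)).trans hsub)]
    exact h.tendsto_ball hU (by positivity) hsub
  have hloc : ∀ K ⊆ U, IsCompact K →
      Tendsto (fun n => eLpNorm (f n) 2 (volume.restrict K)) atTop (𝓝 0) := by
    intro K hKU hK
    have := key K hK fun x hx => by
      obtain ⟨t, ht, h'⟩ := hinner x (hKU hx)
      exact ⟨t, mem_nhdsWithin_of_mem_nhds ht, h'⟩
    rwa [Set.inter_eq_left.2 hKU] at this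
  have := key (closure U) hbdd.isCompact_closure fun x hx => by
    by_cases hxU : x ∈ U
    · obtain ⟨t, ht, h'⟩ := hinner x hxU
      exact ⟨t, mem_nhdsWithin_of_mem_nhds ht, h'⟩
    · have hxf : x ∈ frontier U := by rw [hU.frontier_eq]; exact ⟨hx, hxU⟩
      obtain ⟨r, hr, h'⟩ := h.tendsto_boundary hU hloc hlip hxf
      exact ⟨_, mem_nhdsWithin_of_mem_nhds (Metric.ball_mem_nhds x hr), h'⟩
  rwa [Set.inter_eq_right.2 subset_closure] at this

end Rellich

/-! ### Sobolev spaces as Hilbert spaces -/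

section SobolevSpaces

variable {d : ℕ}

/-- `L²(U) × L²(U; ℝᵈ)` as a Hilbert space. -/
abbrev L2Hilbert (U : Set (Space d)) : Type :=
  WithLp 2 (Lp ℝ 2 (volume.restrict U) × Lp (Space d) 2 (volume.restrict U))

/-- The test functions on `U`. -/
def testSpace (U : Set (Space d)) : Submodule ℝ (Space d → ℝ) where
  carrier := {η | IsTestFunction U η}
  add_mem' h h' := h.add h'
  zero_mem' := .zero
  smul_mem' c _ h := h.const_mul c

theorem IsTestFunction.memLp_gradient {U : Set (Space d)} {η : Space d → ℝ}
    (h : IsTestFunction U η) (μ : Measure (Space d)) [IsFiniteMeasureOnCompacts μ] :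
    MemLp (gradient η) 2 μ :=
  h.continuous_gradient.memLp_of_hasCompactSupport h.hasCompactSupport_gradient

/-- The pair `(η, ∇η)` for a test function. -/
def testEmbedding (U : Set (Space d)) : testSpace U →ₗ[ℝ] L2Hilbert U where
  toFun η := WithLp.toLp 2 ((η.2.memLp _).toLp η.1, (η.2.memLp_gradient _).toLp (gradient η.1))
  map_add' η ξ := by
    rw [← WithLp.toLp_add]
    congr 1
    ext1
    · exact (MemLp.toLp_add (η.2.memLp (volume.restrict U)) (ξ.2.memLp (volume.restrict U))).symm ▸
        rfl
    · rw [Prod.snd_add, ← MemLp.toLp_add, MemLp.toLp_eq_toLp_iff]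
      refine Eventually.of_forall fun x => ?_
      change gradient (fun x => η.1 x + ξ.1 x) x = gradient η.1 x + gradient ξ.1 x
      rw [gradient, fderiv_fun_add (η.2.differentiable x) (ξ.2.differentiable x), map_add]
      rfl
  map_smul' c η := by
    rw [RingHom.id_apply, ← WithLp.toLp_smul]
    congr 1
    ext1
    · exact (MemLp.toLp_const_smul c (η.2.memLp (volume.restrict U))).symm ▸ rfl
    · rw [Prod.smul_snd, ← MemLp.toLp_const_smul, MemLp.toLp_eq_toLp_iff]
      refine Eventually.of_forall fun x => ?_
      change gradient (fun x => c * η.1 x) x = c • gradient η.1 x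
      rw [gradient, fderiv_const_mul (η.2.differentiable x), map_smul]
      rfl

theorem testEmbedding_fst {U : Set (Space d)} (η : testSpace U) :
    (testEmbedding U η).fst =ᵐ[volume.restrict U] η.1 := (η.2.memLp _).coeFn_toLp

theorem testEmbedding_snd {U : Set (Space d)} (η : testSpace U) :
    (testEmbedding U η).snd =ᵐ[volume.restrict U] gradient η.1 := (η.2.memLp_gradient _).coeFn_toLp

/-- `H¹₀(U)` as a closed subspace. -/
def hilbertH10 (U : Set (Space d)) : Submodule ℝ (L2Hilbert U) :=
  (LinearMap.range (testEmbedding U)).topologicalClosure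

/-- The Hilbert norm and the product norm induce the same topology, so the two closures agree. -/
theorem mem_hilbertH10 {U : Set (Space d)} {p : L2Hilbert U} :
    p ∈ hilbertH10 U ↔ WithLp.ofLp p ∈ sobolevH10 U := by
  have e : (LinearMap.range (testEmbedding U) : Set (L2Hilbert U)) =
      (WithLp.homeomorphProd 2 _ _) ⁻¹' {p : L2Pair U | ∃ η : Space d → ℝ, IsTestFunction U η ∧
        p.1 =ᵐ[volume.restrict U] η ∧ p.2 =ᵐ[volume.restrict U] gradient η} := by
    ext q
    constructor
    · rintro ⟨η, rfl⟩
      exact ⟨η.1, η.2, testEmbedding_fst η, testEmbedding_snd η⟩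
    · rintro ⟨η, hη, h1, h2⟩
      refine ⟨⟨η, hη⟩, ?_⟩
      apply WithLp.ofLp_injective
      ext1
      · exact Lp.ext ((testEmbedding_fst ⟨η, hη⟩).trans h1.symm)
      · exact Lp.ext ((testEmbedding_snd ⟨η, hη⟩).trans h2.symm)
  rw [← SetLike.mem_coe, hilbertH10, Submodule.topologicalClosure_coe, e,
    ← Homeomorph.preimage_closure]
  rfl

/-- The pairs `(∇η · v, η v)`, whose orthogonal complement is `H¹(U)`. -/
def gradientTests (U : Set (Space d)) : Set (L2Hilbert U) :=
  {q | ∃ η : Space d → ℝ, ∃ v : Space d, IsTestFunction U η ∧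
    q.fst =ᵐ[volume.restrict U] (fun x => inner ℝ (gradient η x) v) ∧
    q.snd =ᵐ[volume.restrict U] fun x => η x • v}

/-- `H¹(U)` as a closed subspace. -/
def hilbertH1 (U : Set (Space d)) : Submodule ℝ (L2Hilbert U) :=
  (Submodule.span ℝ (gradientTests U))ᗮ

/-- Pairing with constant vectors v makes the vector identity a family of orthogonality relations in
`L2Hilbert`. Thus H¹ is an orthogonal complement, hence closed and weakly closed. -/
theorem hasWeakGradient_iff {U : Set (Space d)} {f : Space d → ℝ} {G : Space d → Space d}
    (hf : MemLp f 2 (volume.restrict U)) (hG : MemLp G 2 (volume.restrict U)) :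
    HasWeakGradient U f G ↔ ∀ η, IsTestFunction U η → ∀ v,
      (∫ x in U, f x * inner ℝ (gradient η x) v) + ∫ x in U, η x * inner ℝ (G x) v = 0 := by
  refine forall_congr' fun η => forall_congr' fun hη => ?_
  have i1 : Integrable (fun x => f x • gradient η x) (volume.restrict U) :=
    memLp_one_iff_integrable.1 ((hη.memLp_gradient _).smul hf)
  have i2 : Integrable (fun x => η x • G x) (volume.restrict U) :=
    memLp_one_iff_integrable.1 (hG.smul (hη.memLp _))
  have e : ∀ v, (∫ x in U, f x * inner ℝ (gradient η x) v) + ∫ x in U, η x * inner ℝ (G x) v =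
      inner ℝ v ((∫ x in U, f x • gradient η x) + ∫ x in U, η x • G x) := fun v => by
    rw [inner_add_right, ← integral_inner i1, ← integral_inner i2]
    simp only [inner_smul_right, real_inner_comm]
  simp only [e]
  rw [eq_neg_iff_add_eq_zero]
  constructor
  · intro h v; rw [h, inner_zero_right]
  · intro h; exact inner_self_eq_zero.1 (h _)

theorem mem_hilbertH1 {U : Set (Space d)} {p : L2Hilbert U} :
    p ∈ hilbertH1 U ↔ WithLp.ofLp p ∈ sobolevH1 U := by
  have e1 : ∀ (q : L2Hilbert U) (η : Space d → ℝ) (v : Space d),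
      q.fst =ᵐ[volume.restrict U] (fun x => inner ℝ (gradient η x) v) →
      q.snd =ᵐ[volume.restrict U] (fun x => η x • v) →
      inner ℝ q p = (∫ x in U, p.fst x * inner ℝ (gradient η x) v) +
        ∫ x in U, η x * inner ℝ (p.snd x) v := by
    intro q η v h1 h2
    rw [WithLp.prod_inner_apply, L2.inner_def, L2.inner_def]
    congr 1
    · refine integral_congr_ae ?_
      filter_upwards [h1] with x hx
      change inner ℝ (q.fst x) (p.fst x) = _
      rw [hx]; simp
    · refine integral_congr_ae ?_
      filter_upwards [h2] with x hx
      change inner ℝ (q.snd x) (p.snd x) = _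
      rw [hx, inner_smul_left, real_inner_comm]; simp
  change _ ↔ HasWeakGradient U p.fst p.snd
  rw [hasWeakGradient_iff (Lp.memLp _) (Lp.memLp _), hilbertH1, Submodule.mem_orthogonal]
  constructor
  · intro h η hη v
    have m1 : MemLp (fun x => inner ℝ (gradient η x) v) 2 (volume.restrict U) :=
      (hη.memLp_gradient _).inner_const v
    have m2 : MemLp (fun x => η x • v) 2 (volume.restrict U) :=
      (hη.1.smul contDiff_const).continuous.memLp_of_hasCompactSupport
        (hη.2.1.smul_right (f' := fun _ => v))
    rw [← e1 (WithLp.toLp 2 (m1.toLp _, m2.toLp _)) η v m1.coeFn_toLp m2.coeFn_toLp]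
    exact h _ (Submodule.subset_span ⟨η, v, hη, m1.coeFn_toLp, m2.coeFn_toLp⟩)
  · intro h q hq
    induction hq using Submodule.span_induction with
    | mem q hq =>
      obtain ⟨η, v, hη, h1, h2⟩ := hq
      rw [e1 q η v h1 h2]
      exact h η hη v
    | zero => exact inner_zero_left _
    | add x y _ _ hx hy => rw [inner_add_left, hx, hy, add_zero]
    | smul a x _ hx => rw [inner_smul_left, hx, mul_zero]

theorem isClosed_hilbertH1 (U : Set (Space d)) : IsClosed (hilbertH1 U : Set (L2Hilbert U)) :=
  Submodule.isClosed_orthogonal _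

theorem isClosed_hilbertH10 (U : Set (Space d)) : IsClosed (hilbertH10 U : Set (L2Hilbert U)) :=
  Submodule.isClosed_topologicalClosure _

theorem IsTestFunction.hasWeakGradient {U : Set (Space d)} {η : Space d → ℝ}
    (hη : IsTestFunction U η) : HasWeakGradient U η (gradient η) := by
  rw [hasWeakGradient_iff (hη.memLp _) (hη.memLp_gradient _)]
  intro ξ hξ v
  simp only [IsTestFunction.inner_gradient]
  have c : ∀ {ζ : Space d → ℝ}, IsTestFunction U ζ → Continuous fun x => fderiv ℝ ζ x v :=
    fun hζ => (hζ.1.continuous_fderiv (by simp)).clm_apply continuous_const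
  have h := integral_mul_fderiv_eq_neg_fderiv_mul_of_integrable (μ := volume) (f := η) (g := ξ)
    (v := v)
    (((c hη).mul hξ.continuous).integrable_of_hasCompactSupport (hξ.2.1.mul_left))
    ((hη.continuous.mul (c hξ)).integrable_of_hasCompactSupport (hη.2.1.mul_right))
    ((hη.continuous.mul hξ.continuous).integrable_of_hasCompactSupport (hη.2.1.mul_right))
    (fun x _ => hη.differentiable x) (fun x _ => hξ.differentiable x)
  rw [setIntegral_eq_integral_of_forall_compl_eq_zero
      (fun x hx => by rw [hη.eq_zero hx, zero_mul]),
    setIntegral_eq_integral_of_forall_compl_eq_zero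
      (fun x hx => by rw [hξ.eq_zero hx, zero_mul]), h]
  simp only [mul_comm (ξ _)]
  exact neg_add_cancel _

theorem HasWeakGradient.congr {U : Set (Space d)} {f f' : Space d → ℝ} {G G' : Space d → Space d}
    (h : HasWeakGradient U f G) (hf : f =ᵐ[volume.restrict U] f')
    (hG : G =ᵐ[volume.restrict U] G') : HasWeakGradient U f' G' := fun η hη => by
  have e1 : ∫ x in U, f' x • gradient η x = ∫ x in U, f x • gradient η x :=
    integral_congr_ae (hf.mono fun x hx => by simp only [hx])
  have e2 : ∫ x in U, η x • G' x = ∫ x in U, η x • G x :=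
    integral_congr_ae (hG.mono fun x hx => by simp only [hx])
  rw [e1, e2, h η hη]

theorem hilbertH10_le (U : Set (Space d)) : hilbertH10 U ≤ hilbertH1 U := by
  refine Submodule.topologicalClosure_minimal _ ?_ (isClosed_hilbertH1 U)
  rintro _ ⟨η, rfl⟩
  rw [mem_hilbertH1]
  exact (IsTestFunction.hasWeakGradient η.2).congr (testEmbedding_fst η).symm
    (testEmbedding_snd η).symm

theorem HasWeakGradient.eq_zero {U : Set (Space d)} (hU : IsOpen U) {f : Space d → ℝ}
    {G : Space d → Space d} (h : HasWeakGradient U f G) (hf : f =ᵐ[volume.restrict U] 0)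
    (hG : MemLp G 2 (volume.restrict U)) : G =ᵐ[volume.restrict U] 0 := by
  change ∀ᵐ x ∂(volume.restrict U), G x = 0
  rw [ae_restrict_iff' hU.measurableSet]
  refine hU.ae_eq_zero_of_integral_contDiff_smul_eq_zero ?_ ?_
  · exact locallyIntegrableOn_of_locallyIntegrable_restrict
      (hG.locallyIntegrable (by norm_num))
  · intro η h1 h2 h3
    have hη : IsTestFunction U η := ⟨h1, h2, h3⟩
    have h0 := h η hη
    rw [integral_congr_ae (g := fun _ => 0) (hf.mono fun x hx => by simp [hx]),
      integral_zero, eq_comm, neg_eq_zero] at h0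
    rw [← h0, setIntegral_eq_integral_of_forall_compl_eq_zero]
    intro x hx; rw [hη.eq_zero hx, zero_smul]

/-- Uniqueness of the weak gradient; it makes the value map injective on H¹. -/
theorem snd_eq_zero_of_fst_eq_zero {U : Set (Space d)} (hU : IsOpen U) {p : L2Hilbert U}
    (hp : p ∈ hilbertH1 U) (h : p.fst = 0) : p = 0 := by
  have h1 : HasWeakGradient U p.fst p.snd := mem_hilbertH1.1 hp
  have h2 : p.snd =ᵐ[volume.restrict U] 0 :=
    h1.eq_zero hU (by rw [h]; exact Lp.coeFn_zero _ _ _) (Lp.memLp _)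
  apply WithLp.ofLp_injective
  ext1
  · exact h
  · exact Lp.ext (h2.trans (Lp.coeFn_zero _ _ _).symm)

/-- Functions with vanishing weak gradient are locally constant. -/
theorem HasWeakGradient.ae_const_ball {U : Set (Space d)} (hU : IsOpen U) {f : Space d → ℝ}
    (hfm : StronglyMeasurable f)
    (hfi : IntegrableOn f U) (hf : MemLp f 2 (volume.restrict U)) (h : HasWeakGradient U f 0)
    {x₀ : Space d} {r : ℝ} (hr : 0 < r) (hball : Metric.ball x₀ (3 * r) ⊆ U) :
    ∃ c, ∀ᵐ x ∂(volume.restrict (Metric.ball x₀ r)), f x = c := by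
  set V := Metric.ball x₀ r
  have hVz : ∀ z ∈ Metric.ball (0 : Space d) (2 * r), ∀ y ∈ V, ∀ t ∈ Set.Icc (0 : ℝ) 1,
      y + t • z ∈ U := by
    intro z hz y hy t ht
    apply hball
    rw [Metric.mem_ball, dist_eq_norm] at hy ⊢
    rw [mem_ball_zero_iff] at hz
    calc ‖y + t • z - x₀‖ = ‖(y - x₀) + t • z‖ := by congr 1; abel
      _ ≤ ‖y - x₀‖ + ‖t • z‖ := norm_add_le _ _
      _ ≤ ‖y - x₀‖ + 1 * ‖z‖ := by
        rw [norm_smul, Real.norm_eq_abs, abs_of_nonneg ht.1]; gcongr; exact ht.2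
      _ < 3 * r := by linarith
  have h1 : ∀ z ∈ Metric.ball (0 : Space d) (2 * r),
      ∀ᵐ y ∂(volume.restrict V), f (y + z) = f y := by
    intro z hz
    have t := eLpNorm_translate_sub_le hU.measurableSet Metric.isOpen_ball hfi
      (integrable_zero _ _ _) hf MemLp.zero h (hVz z hz)
    have hm : MemLp (fun y => f (y + z) - f y) 2 (volume.restrict V) :=
      (memLp_translate hU.measurableSet
        (fun y hy => by simpa using hVz z hz y hy 1 ⟨zero_le_one, le_rfl⟩) hf).sub
        (hf.mono_measure (Measure.restrict_mono (fun y hy => by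
          simpa using hVz z hz y hy 0 ⟨le_rfl, zero_le_one⟩) le_rfl))
    have t2 : eLpNorm (fun y => f (y + z) - f y) 2 (volume.restrict V) = 0 := by
      have : (eLpNorm (fun y => f (y + z) - f y) 2 (volume.restrict V)).toReal = 0 :=
        le_antisymm (by simpa using t) ENNReal.toReal_nonneg
      exact ((ENNReal.toReal_eq_zero_iff _).1 this).resolve_right hm.2.ne
    rw [eLpNorm_eq_zero_iff hm.1 two_ne_zero] at t2
    exact t2.mono fun y hy => sub_eq_zero.1 hy
  have hmeas : MeasurableSet {q : Space d × Space d | f (q.2 + q.1) = f q.2} := by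
    refine measurableSet_eq_fun ?_ ?_
    · exact hfm.measurable.comp (by fun_prop)
    · exact hfm.measurable.comp (by fun_prop)
  -- The exceptional set of y depends on z. Fubini exchanges the quantifiers, so that one y serves
  -- almost every z; shifts of length below 2r reach all of V from it.
  have h3 : ∀ᵐ y ∂(volume.restrict V), ∀ᵐ z ∂(volume.restrict (Metric.ball (0 : Space d) (2 * r))),
      f (y + z) = f y := by
    refine (Measure.ae_ae_comm hmeas).1 ?_
    rw [ae_restrict_iff' Metric.isOpen_ball.measurableSet]
    exact Eventually.of_forall h1
  rw [ae_restrict_iff' Metric.isOpen_ball.measurableSet] at h3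
  have h4 : ∃ y ∈ V, ∀ᵐ z ∂(volume.restrict (Metric.ball (0 : Space d) (2 * r))),
      f (y + z) = f y := by
    by_contra hc
    have : volume V = 0 := measure_mono_null (fun y hy => by
      simp only [Set.mem_compl_iff, Set.mem_ofPred_eq]
      intro hy'
      exact hc ⟨y, hy, hy' hy⟩) (mem_ae_iff.1 h3)
    exact (Metric.measure_ball_pos _ _ hr).ne' this
  obtain ⟨y, hy, h5⟩ := h4
  refine ⟨f y, ?_⟩
  rw [ae_restrict_iff' Metric.isOpen_ball.measurableSet] at h5 ⊢
  have h6 := (measurePreserving_sub_right (volume : Measure (Space d)) y).quasiMeasurePreserving.ae h5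
  filter_upwards [h6] with x hx hxV
  have := hx (by
    rw [mem_ball_zero_iff, ← dist_eq_norm]
    rw [Metric.mem_ball] at hxV hy
    linarith [dist_triangle_right x y x₀])
  simpa using this

/-- Functions with vanishing weak gradient on a connected open set are constant. -/
theorem HasWeakGradient.ae_const {U : Set (Space d)} (hU : IsOpen U) (hconn : IsConnected U)
    {f : Space d → ℝ} (hfm : StronglyMeasurable f)
    (hfi : IntegrableOn f U) (hf : MemLp f 2 (volume.restrict U)) (h : HasWeakGradient U f 0) :
    ∃ c, ∀ᵐ x ∂(volume.restrict U), f x = c := by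
  have hloc : ∀ x : U, ∃ c, ∃ r > 0, ∀ᵐ y ∂(volume.restrict (Metric.ball (x : Space d) r)),
      f y = c := by
    rintro ⟨x, hx⟩
    obtain ⟨r, hr, hxr⟩ := Metric.isOpen_iff.1 hU x hx
    obtain ⟨c, hc⟩ := h.ae_const_ball hU hfm hfi hf (x₀ := x) (r := r / 3) (by positivity)
      (by rwa [mul_div_cancel₀ r three_ne_zero])
    exact ⟨c, r / 3, by positivity, hc⟩
  choose c r hr hc using hloc
  have hne : ∀ {s : Set (Space d)} {a b : ℝ}, IsOpen s → s.Nonempty →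
      (∀ᵐ y ∂(volume.restrict s), f y = a) → (∀ᵐ y ∂(volume.restrict s), f y = b) → a = b := by
    intro s a b hs hsn ha hb
    have : (ae (volume.restrict s)).NeBot := by
      rw [ae_neBot, Ne, Measure.restrict_eq_zero]
      exact (hs.measure_pos _ hsn).ne'
    obtain ⟨y, h1, h2⟩ := (ha.and hb).exists
    rw [← h1, ← h2]
  -- Values on overlapping balls agree because the overlap has positive measure; connectedness makes
  -- the value global.
  have hlc : IsLocallyConstant c := by
    rw [IsLocallyConstant.iff_eventually_eq]
    intro x
    have : ∀ᶠ y : U in 𝓝 x, (y : Space d) ∈ Metric.ball (x : Space d) (r x) :=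
      continuous_subtype_val.continuousAt.eventually (Metric.ball_mem_nhds _ (hr x))
    filter_upwards [this] with y hy
    refine hne (s := Metric.ball (y : Space d) (r y) ∩ Metric.ball (x : Space d) (r x))
      (Metric.isOpen_ball.inter Metric.isOpen_ball) ⟨y, Metric.mem_ball_self (hr y), hy⟩
      (ae_restrict_of_ae_restrict_of_subset Set.inter_subset_left (hc y))
      (ae_restrict_of_ae_restrict_of_subset Set.inter_subset_right (hc x))
  have : ConnectedSpace U := isConnected_iff_connectedSpace.1 hconn
  obtain ⟨x₀⟩ : Nonempty U := inferInstance
  refine ⟨c x₀, ?_⟩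
  have hall : ∀ x, c x = c x₀ := fun x => hlc.apply_eq_of_preconnectedSpace x x₀
  have hset : volume ({y | f y ≠ c x₀} ∩ U) = 0 := by
    refine measure_null_of_locally_null _ fun x hx => ?_
    refine ⟨Metric.ball x (r ⟨x, hx.2⟩) ∩ {y | f y ≠ c x₀}, ?_, ?_⟩
    · have : Metric.ball x (r ⟨x, hx.2⟩) ∈ 𝓝[{y | f y ≠ c x₀} ∩ U] x :=
        mem_nhdsWithin_of_mem_nhds (Metric.ball_mem_nhds x (hr ⟨x, hx.2⟩))
      filter_upwards [this, self_mem_nhdsWithin] with y h1 h2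
      exact ⟨h1, h2.1⟩
    · have := hc ⟨x, hx.2⟩
      rw [hall, ae_restrict_iff' Metric.isOpen_ball.measurableSet] at this
      refine measure_mono_null ?_ (mem_ae_iff.1 this)
      rintro y ⟨h1, h2⟩ h3
      exact h2 (h3 h1)
  rw [ae_restrict_iff' hU.measurableSet]
  refine measure_mono_null ?_ hset
  intro y hy
  simp only [Set.mem_compl_iff, Set.mem_ofPred_eq, Classical.not_imp] at hy
  exact ⟨hy.2, hy.1⟩

/-- Poincaré's inequality in `H¹₀(U)`. -/
theorem norm_fst_le_of_mem_hilbertH10 (hd : 1 ≤ d) {U : Set (Space d)}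
    (hbdd : Bornology.IsBounded U) : ∃ K, ∀ p ∈ hilbertH10 U, ‖p.fst‖ ≤ K * ‖p.snd‖ := by
  obtain ⟨R, hR, hUR⟩ := hbdd.subset_ball_lt 0 (0 : Space d)
  -- A shift of length 2R moves the R-ball, which contains U, off U. On that ball η(· + z) − η
  -- equals −η, and the translation estimate becomes Poincaré's inequality.
  let z : Space d := EuclideanSpace.single ⟨0, hd⟩ (2 * R)
  have hz : ‖z‖ = 2 * R := by
    simp only [z, PiLp.norm_single, Real.norm_eq_abs]
    exact abs_of_pos (by positivity)
  refine ⟨2 * R, fun p hp => ?_⟩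
  refine closure_minimal (s := (LinearMap.range (testEmbedding U) : Set (L2Hilbert U)))
    (t := {p | ‖p.fst‖ ≤ 2 * R * ‖p.snd‖}) ?_ ?_
    (by rwa [← Submodule.topologicalClosure_coe])
  · rintro _ ⟨⟨η, hη : IsTestFunction U η⟩, rfl⟩
    change ‖(hη.memLp _).toLp η‖ ≤ 2 * R * ‖(hη.memLp_gradient _).toLp (gradient η)‖
    rw [Lp.norm_toLp, Lp.norm_toLp]
    have hη' : IsTestFunction Set.univ η := hη.mono (Set.subset_univ _)
    have t := eLpNorm_translate_sub_le (U := Set.univ) (V := Metric.ball (0 : Space d) R)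
      MeasurableSet.univ Metric.isOpen_ball
      (hη.continuous.integrable_of_hasCompactSupport hη.2.1).integrableOn
      (hη.continuous_gradient.integrable_of_hasCompactSupport
        hη.hasCompactSupport_gradient).integrableOn (hη.memLp _) (hη.memLp_gradient _)
      hη'.hasWeakGradient (z := z) (fun _ _ _ _ => Set.mem_univ _)
    rw [hz, Measure.restrict_univ] at t
    have e1 : eLpNorm (fun y => η (y + z) - η y) 2 (volume.restrict (Metric.ball (0 : Space d) R)) =
        eLpNorm η 2 (volume.restrict (Metric.ball (0 : Space d) R)) := by
      rw [← eLpNorm_neg]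
      refine eLpNorm_congr_ae ?_
      refine (ae_restrict_iff' Metric.isOpen_ball.measurableSet).2 (Eventually.of_forall ?_)
      intro y hy
      have : y + z ∉ U := fun h => by
        have h1 := mem_ball_zero_iff.1 (hUR h)
        have h2 := mem_ball_zero_iff.1 hy
        have h3 : ‖z‖ ≤ ‖y + z‖ + ‖y‖ := by
          have := norm_sub_le (y + z) y
          rwa [add_sub_cancel_left] at this
        linarith
      simp [hη.eq_zero this]
    have e2 : eLpNorm η 2 (volume.restrict (Metric.ball (0 : Space d) R)) = eLpNorm η 2 volume :=
      eLpNorm_restrict_eq_of_support_subset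
        ((subset_tsupport η).trans (hη.2.2.trans hUR))
    have e3 : eLpNorm η 2 (volume.restrict U) = eLpNorm η 2 volume :=
      eLpNorm_restrict_eq_of_support_subset ((subset_tsupport η).trans hη.2.2)
    have e4 : eLpNorm (gradient η) 2 (volume.restrict U) = eLpNorm (gradient η) 2 volume := by
      refine eLpNorm_restrict_eq_of_support_subset fun x hx => ?_
      refine hη.2.2 (support_fderiv_subset ℝ fun h0 => hx ?_)
      rw [gradient, h0, map_zero]
    rw [e3, e4, ← e2, ← e1]
    exact t
  · exact isClosed_le (by fun_prop) (by fun_prop)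

/-- Polynomials in one coordinate times a bump function are test functions. They form an
infinite-dimensional space because a polynomial vanishing on an interval is zero. -/
theorem not_finiteDimensional_hilbertH10 (hd : 1 ≤ d) {U : Set (Space d)} (hU : IsOpen U)
    (hne : U.Nonempty) : ¬ FiniteDimensional ℝ (hilbertH10 U) := by
  intro hfin
  obtain ⟨x₀, hx₀⟩ := hne
  obtain ⟨r, hr, hball⟩ := Metric.isOpen_iff.1 hU x₀ hx₀
  let b : ContDiffBump x₀ := ⟨r / 3, r / 2, by positivity, by linarith⟩
  let i₀ : Fin d := ⟨0, hd⟩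
  have hb : IsTestFunction U b := ⟨b.contDiff, b.hasCompactSupport, by
    rw [b.tsupport_eq]
    exact (Metric.closedBall_subset_ball (by change r / 2 < r; linarith)).trans hball⟩
  have hpb : ∀ p : Polynomial ℝ, IsTestFunction U fun x => p.eval (x i₀) * b x := fun p => by
    refine ⟨?_, hb.2.1.mul_left (f := fun x : Space d => p.eval (x i₀)),
      (tsupport_mul_subset_right (f := fun x : Space d => p.eval (x i₀)) (g := b)).trans hb.2.2⟩
    have h1 : ContDiff ℝ ∞ fun x : Space d => x i₀ := by fun_prop
    have h2 : ContDiff ℝ ∞ fun x : Space d => p.eval (x i₀) := by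
      have h3 := p.contDiff_aeval (𝕜 := ℝ) ∞
      simp only [Polynomial.coe_aeval_eq_eval] at h3
      exact h3.comp h1
    exact h2.mul hb.1
  let Φ : Polynomial ℝ →ₗ[ℝ] testSpace U :=
    { toFun := fun p => ⟨_, hpb p⟩
      map_add' := fun p q => by
        ext x
        change (p + q).eval (x i₀) * b x = p.eval (x i₀) * b x + q.eval (x i₀) * b x
        rw [Polynomial.eval_add, add_mul]
      map_smul' := fun c p => by
        ext x
        change (c • p).eval (x i₀) * b x = c * (p.eval (x i₀) * b x)
        rw [Polynomial.eval_smul, smul_eq_mul, mul_assoc] }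
  let Θ : Polynomial ℝ →ₗ[ℝ] hilbertH10 U := ((testEmbedding U).comp Φ).codRestrict _ fun p =>
    Submodule.le_topologicalClosure _ ⟨Φ p, rfl⟩
  have hΘ : Function.Injective Θ := by
    rw [← LinearMap.ker_eq_bot, LinearMap.ker_eq_bot']
    intro p hp
    have h1 : testEmbedding U (Φ p) = 0 := congrArg Subtype.val hp
    have h2 : (Φ p).1 =ᵐ[volume.restrict U] fun _ => (0 : ℝ) := by
      refine (testEmbedding_fst (Φ p)).symm.trans ?_
      rw [h1]
      exact Lp.coeFn_zero _ _ _
    have h3 := Measure.eqOn_open_of_ae_eq h2 hU (hpb p).continuous.continuousOn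
      continuousOn_const
    refine Polynomial.eq_zero_of_infinite_isRoot p ?_
    refine (Set.Ioo_infinite (show x₀ i₀ < x₀ i₀ + r / 3 by linarith)).mono fun t ht => ?_
    set x : Space d := x₀ + EuclideanSpace.single i₀ (t - x₀ i₀) with hx
    have hxi : x i₀ = t := by simp [hx]
    have hxb : x ∈ Metric.closedBall x₀ (r / 3) := by
      rw [Metric.mem_closedBall, dist_eq_norm, hx, add_sub_cancel_left,
        PiLp.norm_single, Real.norm_eq_abs, abs_of_pos (by linarith [ht.1])]
      linarith [ht.2]
    have hxU : x ∈ U := hball (Metric.closedBall_subset_ball (by linarith) hxb)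
    have h4 : p.eval (x i₀) * b x = 0 := h3 hxU
    rwa [b.one_of_mem_closedBall hxb, mul_one, hxi] at h4
  have : Module.Finite ℝ (Polynomial ℝ) := FiniteDimensional.of_injective Θ hΘ
  exact Polynomial.not_finite this

end SobolevSpaces

/-! ### The compact embedding of H¹ into L² -/

section Compactness

variable {d : ℕ}

theorem norm_fst_le {U : Set (Space d)} (p : L2Hilbert U) : ‖p.fst‖ ≤ ‖p‖ := by
  refine le_of_sq_le_sq ?_ (norm_nonneg _)
  rw [WithLp.prod_norm_sq_eq_of_L2]
  exact le_add_of_nonneg_right (sq_nonneg _)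

theorem norm_snd_le {U : Set (Space d)} (p : L2Hilbert U) : ‖p.snd‖ ≤ ‖p‖ := by
  refine le_of_sq_le_sq ?_ (norm_nonneg _)
  rw [WithLp.prod_norm_sq_eq_of_L2]
  exact le_add_of_nonneg_left (sq_nonneg _)

/-- Weak convergence in `H¹(U)` implies strong convergence in `L²(U)`. -/
theorem WeakTendsto.tendsto_fst {U : Set (Space d)} (hU : IsOpen U) (hbdd : Bornology.IsBounded U)
    (hlip : HasLipschitzBoundary U) {u : ℕ → L2Hilbert U} {v : L2Hilbert U}
    (hu : ∀ n, u n ∈ hilbertH1 U) (hv : v ∈ hilbertH1 U) {M : ℝ} (hM : ∀ n, ‖u n‖ ≤ M)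
    (h : WeakTendsto u v) : Tendsto (fun n => (u n).fst) atTop (𝓝 v.fst) := by
  have hfin : IsFiniteMeasure (volume.restrict U) :=
    ⟨by rw [Measure.restrict_apply_univ]; exact hbdd.measure_lt_top⟩
  have hMv : ∀ n, ‖u n - v‖ ≤ M + ‖v‖ := fun n =>
    (norm_sub_le _ _).trans (add_le_add_left (hM n) _)
  have hnull : WeaklyNull U (fun n => (u n - v).fst) (fun n => (u n - v).snd) (M + ‖v‖) :=
    { meas := fun n => Lp.stronglyMeasurable _
      int_f := fun n => (Lp.memLp (u n - v).fst).integrable (by norm_num)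
      int_G := fun n => (Lp.memLp (u n - v).snd).integrable (by norm_num)
      memLp_f := fun n => Lp.memLp _
      memLp_G := fun n => Lp.memLp _
      grad := fun n => mem_hilbertH1.1 (Submodule.sub_mem _ (hu n) hv)
      bound_f := fun n => (norm_fst_le _).trans (hMv n)
      bound_G := fun n => (norm_snd_le _).trans (hMv n)
      -- The integral over a ball is an inner product with an indicator function.
      null := by
        intro x r hxr
        have hfb : volume.restrict U (Metric.ball x r) ≠ ⊤ := measure_ne_top _ _
        have h1 := h (WithLp.toLp 2 (indicatorConstLp 2 Metric.isOpen_ball.measurableSet hfb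
          (1 : ℝ), 0))
        have h2 : ∀ n, ∫ y in Metric.ball x r, (u n - v).fst y =
            inner ℝ (u n) (WithLp.toLp 2 (indicatorConstLp 2 Metric.isOpen_ball.measurableSet hfb
              (1 : ℝ), 0)) - inner ℝ v (WithLp.toLp 2
              (indicatorConstLp 2 Metric.isOpen_ball.measurableSet hfb (1 : ℝ), 0)) := by
          intro n
          rw [← inner_sub_left, WithLp.prod_inner_apply]
          simp only [inner_zero_right, add_zero]
          rw [real_inner_comm, L2.inner_indicatorConstLp_one,
            Measure.restrict_restrict Metric.isOpen_ball.measurableSet,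
            Set.inter_eq_left.2 hxr]
          rfl
        simp only [h2]
        have := h1.sub_const (inner ℝ v (WithLp.toLp 2
          (indicatorConstLp 2 Metric.isOpen_ball.measurableSet hfb (1 : ℝ), 0)))
        rwa [sub_self] at this }
  have h1 := (ENNReal.tendsto_toReal ENNReal.zero_ne_top).comp (hnull.tendsto hU hbdd hlip)
  rw [tendsto_iff_norm_sub_tendsto_zero]
  exact h1

end Compactness

/-! ### Weighted forms -/

section Weights

variable {α E : Type*} [MeasurableSpace α] {μ : Measure α} [NormedAddCommGroup E]
  [InnerProductSpace ℝ E]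

/-- A measurable function with `m ≤ θ ≤ K` a.e. -/
structure IsWeight (μ : Measure α) (m K : ℝ) (θ : α → ℝ) : Prop where
  meas : AEStronglyMeasurable θ μ
  ge : ∀ᵐ x ∂μ, m ≤ θ x
  le : ∀ᵐ x ∂μ, |θ x| ≤ K

theorem IsWeight.memLp_smul {m K : ℝ} {θ : α → ℝ} (h : IsWeight μ m K θ) {f : α → E}
    (hf : MemLp f 2 μ) : MemLp (fun x => θ x • f x) 2 μ :=
  MemLp.of_le_mul (c := K) hf (h.meas.smul hf.1) (h.le.mono fun x hx => by
    rw [norm_smul]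
    exact mul_le_mul_of_nonneg_right hx (norm_nonneg _))

theorem IsWeight.integrable {m K : ℝ} {θ : α → ℝ} (h : IsWeight μ m K θ) (u v : Lp E 2 μ) :
    Integrable (fun x => θ x * inner ℝ (u x) (v x)) μ :=
  (L2.integrable_inner (𝕜 := ℝ) u v).bdd_mul (c := K) h.meas h.le

open Classical in
/-- The form `∫ θ u · v` on `L²`. -/
def weightForm (μ : Measure α) (E : Type*) [NormedAddCommGroup E] [InnerProductSpace ℝ E]
    (θ : α → ℝ) : Lp E 2 μ →ₗ[ℝ] Lp E 2 μ →ₗ[ℝ] ℝ :=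
  -- Bilinearity needs integrability; the default 0 keeps the form defined for every θ.
  if h : ∃ m K, IsWeight μ m K θ then
    LinearMap.mk₂ ℝ (fun u v => ∫ x, θ x * inner ℝ (u x) (v x) ∂μ)
      (fun u u' v => by
        obtain ⟨m, K, h⟩ := h
        rw [← integral_add (h.integrable u v) (h.integrable u' v)]
        refine integral_congr_ae ?_
        filter_upwards [Lp.coeFn_add u u'] with x hx
        rw [hx, Pi.add_apply, inner_add_left, mul_add])
      (fun c u v => by
        rw [smul_eq_mul, ← integral_const_mul]
        refine integral_congr_ae ?_
        filter_upwards [Lp.coeFn_smul c u] with x hx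
        rw [hx, Pi.smul_apply, inner_smul_left, RCLike.conj_to_real, mul_left_comm])
      (fun u v v' => by
        obtain ⟨m, K, h⟩ := h
        rw [← integral_add (h.integrable u v) (h.integrable u v')]
        refine integral_congr_ae ?_
        filter_upwards [Lp.coeFn_add v v'] with x hx
        rw [hx, Pi.add_apply, inner_add_right, mul_add])
      (fun c u v => by
        rw [smul_eq_mul, ← integral_const_mul]
        refine integral_congr_ae ?_
        filter_upwards [Lp.coeFn_smul c v] with x hx
        rw [hx, Pi.smul_apply, inner_smul_right, mul_left_comm])
  else 0

namespace IsWeight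

variable {m K : ℝ} {θ : α → ℝ}

theorem weightForm_apply (h : IsWeight μ m K θ) (u v : Lp E 2 μ) :
    weightForm μ E θ u v = ∫ x, θ x * inner ℝ (u x) (v x) ∂μ := by
  rw [weightForm, dif_pos ⟨m, K, h⟩]
  rfl

theorem weightForm_symm (h : IsWeight μ m K θ) (u v : Lp E 2 μ) :
    weightForm μ E θ u v = weightForm μ E θ v u := by
  rw [h.weightForm_apply, h.weightForm_apply]
  simp only [real_inner_comm]

theorem abs_weightForm_le (h : IsWeight μ m K θ) (u v : Lp E 2 μ) :
    |weightForm μ E θ u v| ≤ K * ‖u‖ * ‖v‖ := by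
  rw [h.weightForm_apply]
  -- For μ = 0 the bound by K is vacuous and K may be negative, but then all norms vanish; otherwise
  -- some point shows 0 ≤ K.
  rcases eq_or_ne (ae μ) ⊥ with hμ | hμ
  · have hμ0 : μ = 0 := ae_eq_bot.1 hμ
    subst hμ0
    simp [Lp.norm_def]
  have : (ae μ).NeBot := ⟨hμ⟩
  obtain ⟨x, hx⟩ := h.le.exists
  have hK : 0 ≤ K := (abs_nonneg _).trans hx
  have h1 := abs_integral_inner_le (h.memLp_smul (Lp.memLp u)) (Lp.memLp v)
  have h2 : eLpNorm (fun x => θ x • u x) 2 μ ≤ ENNReal.ofReal K * eLpNorm u 2 μ := by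
    refine eLpNorm_le_mul_eLpNorm_of_ae_le_mul (h.le.mono fun x hx => ?_) 2
    rw [norm_smul]
    exact mul_le_mul_of_nonneg_right hx (norm_nonneg _)
  have h3 := ENNReal.toReal_mono
    (ENNReal.mul_ne_top ENNReal.ofReal_ne_top (Lp.memLp u).2.ne) h2
  rw [ENNReal.toReal_mul, ENNReal.toReal_ofReal hK] at h3
  simp only [inner_smul_left, RCLike.conj_to_real] at h1
  refine h1.trans ?_
  rw [Lp.norm_def, Lp.norm_def]
  gcongr

theorem le_weightForm (h : IsWeight μ m K θ) (u : Lp E 2 μ) :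
    m * ‖u‖ ^ 2 ≤ weightForm μ E θ u u := by
  rw [h.weightForm_apply, ← real_inner_self_eq_norm_sq, L2.inner_def, ← integral_const_mul]
  refine integral_mono_ae ((L2.integrable_inner (𝕜 := ℝ) u u).const_mul m) (h.integrable u u) ?_
  filter_upwards [h.ge] with x hx
  exact mul_le_mul_of_nonneg_right hx real_inner_self_nonneg

/-- By Cauchy–Schwarz the error is at most ‖(θₙ − θ')v‖‖u‖, and dominated convergence applies for
each fixed v. Since a.e. convergence of the weights gives no uniformity in v, `FormTendsto` asks for
no more. -/
theorem tendsto_weightForm {θ : ℕ → α → ℝ} {θ' : α → ℝ} (h : ∀ n, IsWeight μ m K (θ n))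
    (h' : IsWeight μ m K θ') (hlim : ∀ᵐ x ∂μ, Tendsto (fun n => θ n x) atTop (𝓝 (θ' x)))
    (v : Lp E 2 μ) : ∃ δ : ℕ → ℝ, Tendsto δ atTop (𝓝 0) ∧
      ∀ n u, |weightForm μ E (θ n) u v - weightForm μ E θ' u v| ≤ δ n * ‖u‖ := by
  have hs : ∀ n, IsWeight μ (-(2 * K)) (2 * K) (fun x => θ n x - θ' x) := fun n => by
    have hb : ∀ᵐ x ∂μ, |θ n x - θ' x| ≤ 2 * K := by
      filter_upwards [(h n).le, h'.le] with x h1 h2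
      exact (abs_sub _ _).trans (by linarith)
    exact ⟨(h n).meas.sub h'.meas, hb.mono fun x hx => (abs_le.1 hx).1, hb⟩
  have hm := fun n => (hs n).memLp_smul (Lp.memLp v)
  refine ⟨fun n => (eLpNorm (fun x => (θ n x - θ' x) • v x) 2 μ).toReal, ?_, fun n u => ?_⟩
  · have hl : Tendsto (fun n => ∫ x, ‖(θ n x - θ' x) • v x‖ ^ 2 ∂μ) atTop
        (𝓝 (∫ _x, (0 : ℝ) ∂μ)) := by
      refine tendsto_integral_of_dominated_convergence (fun x => (2 * K) ^ 2 * ‖v x‖ ^ 2)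
        (fun n => ((hm n).1.norm.pow 2)) ?_ ?_ ?_
      · exact ((memLp_two_iff_integrable_sq_norm (Lp.memLp v).1).1 (Lp.memLp v)).const_mul _
      · intro n
        filter_upwards [(hs n).le] with x hx
        rw [norm_pow, norm_norm, norm_smul, mul_pow, Real.norm_eq_abs]
        gcongr
      · filter_upwards [hlim] with x hx
        have h1 := (((hx.sub_const (θ' x)).smul_const (v x)).norm.pow 2)
        simpa using h1
    simp only [← toReal_eLpNorm_two_sq (hm _)] at hl
    simpa [Real.sqrt_sq ENNReal.toReal_nonneg] using hl.sqrt
  · rw [(h n).weightForm_apply, h'.weightForm_apply,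
      ← integral_sub ((h n).integrable u v) (h'.integrable u v)]
    have h1 := abs_integral_inner_le (Lp.memLp u) (hm n)
    simp only [inner_smul_right] at h1
    rw [mul_comm, Lp.norm_def]
    simpa only [sub_mul] using h1

end IsWeight

end Weights

/-! ### The eigenvalue problems -/

section Problem

variable {d : ℕ} {Ω : Set (Space d)}

/-- Bounds for the coefficient functions on the range `[-1, 1]` of the phase fields. -/
structure CoefficientBounds (m M : ℝ) (a b c : ℝ → ℝ) : Prop where
  pos : 0 < m
  cont_a : Continuous a
  cont_b : Continuous b
  cont_c : Continuous c
  ge : ∀ x ∈ Set.Icc (-1 : ℝ) 1, m ≤ a x ∧ 0 ≤ b x ∧ m ≤ c x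
  le : ∀ x ∈ Set.Icc (-1 : ℝ) 1, a x ≤ M ∧ b x ≤ M ∧ c x ≤ M

theorem AreCoefficients.exists_bounds {a b c : ℝ → ℝ} (h : AreCoefficients a b c) :
    ∃ m M, CoefficientBounds m M a b c := by
  obtain ⟨C, hC, hac⟩ := h.lower_bound
  have ca := h.regular_a.1.continuous
  have cb := h.regular_b.1.continuous
  have cc := h.regular_c.1.continuous
  obtain ⟨A, hA⟩ := (isCompact_Icc (a := (-1 : ℝ)) (b := 1)).bddAbove_image ca.continuousOn
  obtain ⟨B, hB⟩ := (isCompact_Icc (a := (-1 : ℝ)) (b := 1)).bddAbove_image cb.continuousOn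
  obtain ⟨K, hK⟩ := (isCompact_Icc (a := (-1 : ℝ)) (b := 1)).bddAbove_image cc.continuousOn
  refine ⟨C, max A (max B K), hC, ca, cb, cc,
    fun x _ => ⟨(hac x).1.le, h.nonneg_b x, (hac x).2.le⟩, fun x hx => ⟨?_, ?_, ?_⟩⟩
  · exact (hA ⟨x, hx, rfl⟩).trans (le_max_left _ _)
  · exact (hB ⟨x, hx, rfl⟩).trans ((le_max_left _ _).trans (le_max_right _ _))
  · exact (hK ⟨x, hx, rfl⟩).trans ((le_max_right _ _).trans (le_max_right _ _))

theorem CoefficientBounds.neumann {m M : ℝ} {a b c : ℝ → ℝ} (h : CoefficientBounds m M a b c) :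
    CoefficientBounds m M a (fun _ => 0) c :=
  ⟨h.pos, h.cont_a, continuous_const, h.cont_c, fun x hx => ⟨(h.ge x hx).1, le_rfl, (h.ge x hx).2.2⟩,
    fun x hx => ⟨(h.le x hx).1, (h.ge x hx).2.1.trans (h.le x hx).2.1, (h.le x hx).2.2⟩⟩

theorem CoefficientBounds.le_bound {m M : ℝ} {a b c : ℝ → ℝ} (h : CoefficientBounds m M a b c) :
    m ≤ M :=
  (h.ge 0 (by norm_num)).1.trans (h.le 0 (by norm_num)).1

theorem CoefficientBounds.one :
    CoefficientBounds 1 1 (fun _ => 1) (fun _ => 0) (fun _ => 1) :=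
  ⟨one_pos, continuous_const, continuous_const, continuous_const, by simp, by simp⟩

/-- `φ` is measurable with values in `[-1, 1]`. -/
structure IsPhase (Ω : Set (Space d)) (φ : Space d → ℝ) : Prop where
  meas : AEStronglyMeasurable φ (volume.restrict Ω)
  bound : ∀ᵐ x ∂(volume.restrict Ω), |φ x| ≤ 1

theorem IsPhase.isWeight {φ : Space d → ℝ} (h : IsPhase Ω φ) {f : ℝ → ℝ} (hf : Continuous f)
    {m M : ℝ} (hm0 : 0 ≤ m) (hm : ∀ x ∈ Set.Icc (-1 : ℝ) 1, m ≤ f x)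
    (hM : ∀ x ∈ Set.Icc (-1 : ℝ) 1, f x ≤ M) :
    IsWeight (volume.restrict Ω) m M (fun x => f (φ x)) where
  meas := hf.comp_aestronglyMeasurable h.meas
  ge := h.bound.mono fun x hx => hm _ (abs_le.1 hx)
  le := h.bound.mono fun x hx => by
    rw [abs_of_nonneg (hm0.trans (hm _ (abs_le.1 hx)))]
    exact hM _ (abs_le.1 hx)

variable {V : Type} [NormedAddCommGroup V] [InnerProductSpace ℝ V]
  (J : V →L[ℝ] Lp ℝ 2 (volume.restrict Ω)) (D : V →L[ℝ] Lp (Space d) 2 (volume.restrict Ω))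

/-- `∫ a(φ) ∇u · ∇v`. -/
def gradForm (a : ℝ → ℝ) (φ : Space d → ℝ) : V →ₗ[ℝ] V →ₗ[ℝ] ℝ :=
  (weightForm (volume.restrict Ω) (Space d) fun x => a (φ x)).compl₁₂
    (D : V →ₗ[ℝ] _) (D : V →ₗ[ℝ] _)

/-- `∫ c(φ) u v`. -/
def massForm (c : ℝ → ℝ) (φ : Space d → ℝ) : V →ₗ[ℝ] V →ₗ[ℝ] ℝ :=
  (weightForm (volume.restrict Ω) ℝ fun x => c (φ x)).compl₁₂
    (J : V →ₗ[ℝ] _) (J : V →ₗ[ℝ] _)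

/-- `∫ a(φ) ∇u · ∇v + b(φ) u v + c(φ) u v`. -/
def energyForm (a b c : ℝ → ℝ) (φ : Space d → ℝ) : V →ₗ[ℝ] V →ₗ[ℝ] ℝ :=
  gradForm D a φ + massForm J b φ + massForm J c φ

variable {J D}

theorem energyForm_apply (a b c : ℝ → ℝ) (φ : Space d → ℝ) (u v : V) : energyForm J D a b c φ u v =
    gradForm D a φ u v + massForm J b φ u v + massForm J c φ u v := rfl

/-- The Hilbert space norm is `(‖u‖² + ‖∇u‖²)^{1/2}`. -/
def IsGraphNorm (J : V →L[ℝ] Lp ℝ 2 (volume.restrict Ω))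
    (D : V →L[ℝ] Lp (Space d) 2 (volume.restrict Ω)) : Prop :=
  ∀ u, ‖u‖ ^ 2 = ‖J u‖ ^ 2 + ‖D u‖ ^ 2

theorem IsGraphNorm.value_le (hn : IsGraphNorm J D) (u : V) : ‖J u‖ ≤ ‖u‖ :=
  le_of_sq_le_sq ((hn u).symm ▸ le_add_of_nonneg_right (sq_nonneg _)) (norm_nonneg _)

theorem IsGraphNorm.grad_le (hn : IsGraphNorm J D) (u : V) : ‖D u‖ ≤ ‖u‖ :=
  le_of_sq_le_sq ((hn u).symm ▸ le_add_of_nonneg_left (sq_nonneg _)) (norm_nonneg _)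

theorem gradForm_symm {a : ℝ → ℝ} {φ : Space d → ℝ} {m K : ℝ}
    (h : IsWeight (volume.restrict Ω) m K (fun x => a (φ x))) (u v : V) :
    gradForm D a φ u v = gradForm D a φ v u := h.weightForm_symm _ _

theorem massForm_symm {a : ℝ → ℝ} {φ : Space d → ℝ} {m K : ℝ}
    (h : IsWeight (volume.restrict Ω) m K (fun x => a (φ x))) (u v : V) :
    massForm J a φ u v = massForm J a φ v u := h.weightForm_symm _ _

theorem abs_gradForm_le {a : ℝ → ℝ} {φ : Space d → ℝ} {m K : ℝ}
    (h : IsWeight (volume.restrict Ω) m K (fun x => a (φ x))) (u v : V) :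
    |gradForm D a φ u v| ≤ K * ‖D u‖ * ‖D v‖ := h.abs_weightForm_le _ _

theorem abs_massForm_le {a : ℝ → ℝ} {φ : Space d → ℝ} {m K : ℝ}
    (h : IsWeight (volume.restrict Ω) m K (fun x => a (φ x))) (u v : V) :
    |massForm J a φ u v| ≤ K * ‖J u‖ * ‖J v‖ := h.abs_weightForm_le _ _

theorem le_gradForm {a : ℝ → ℝ} {φ : Space d → ℝ} {m K : ℝ}
    (h : IsWeight (volume.restrict Ω) m K (fun x => a (φ x))) (u : V) :
    m * ‖D u‖ ^ 2 ≤ gradForm D a φ u u := h.le_weightForm _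

theorem le_massForm {a : ℝ → ℝ} {φ : Space d → ℝ} {m K : ℝ}
    (h : IsWeight (volume.restrict Ω) m K (fun x => a (φ x))) (u : V) :
    m * ‖J u‖ ^ 2 ≤ massForm J a φ u u := h.le_weightForm _

theorem tendsto_gradForm (hn : IsGraphNorm J D) {a : ℝ → ℝ} {φ : Space d → ℝ}
    {ψ : ℕ → Space d → ℝ} {m K : ℝ}
    (hψ : ∀ n, IsWeight (volume.restrict Ω) m K (fun x => a (ψ n x)))
    (hφ : IsWeight (volume.restrict Ω) m K (fun x => a (φ x)))
    (hlim : ∀ᵐ x ∂(volume.restrict Ω), Tendsto (fun n => a (ψ n x)) atTop (𝓝 (a (φ x)))) :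
    FormTendsto (fun n => gradForm D a (ψ n)) (gradForm D a φ) := fun v => by
  obtain ⟨δ, h0, h1⟩ := IsWeight.tendsto_weightForm hψ hφ hlim (D v)
  refine ⟨fun n => |δ n|, by simpa using h0.abs, fun n u => (h1 n (D u)).trans ?_⟩
  exact mul_le_mul (le_abs_self _) (hn.grad_le u) (norm_nonneg _) (abs_nonneg _)

theorem tendsto_massForm (hn : IsGraphNorm J D) {a : ℝ → ℝ} {φ : Space d → ℝ}
    {ψ : ℕ → Space d → ℝ} {m K : ℝ}
    (hψ : ∀ n, IsWeight (volume.restrict Ω) m K (fun x => a (ψ n x)))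
    (hφ : IsWeight (volume.restrict Ω) m K (fun x => a (φ x)))
    (hlim : ∀ᵐ x ∂(volume.restrict Ω), Tendsto (fun n => a (ψ n x)) atTop (𝓝 (a (φ x)))) :
    FormTendsto (fun n => massForm J a (ψ n)) (massForm J a φ) := fun v => by
  obtain ⟨δ, h0, h1⟩ := IsWeight.tendsto_weightForm hψ hφ hlim (J v)
  refine ⟨fun n => |δ n|, by simpa using h0.abs, fun n u => (h1 n (J u)).trans ?_⟩
  exact mul_le_mul (le_abs_self _) (hn.value_le u) (norm_nonneg _) (abs_nonneg _)

theorem gradForm_eq_integral {a : ℝ → ℝ} {φ : Space d → ℝ} {m K : ℝ}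
    (h : IsWeight (volume.restrict Ω) m K (fun x => a (φ x))) (u v : V) :
    gradForm D a φ u v = ∫ x in Ω, a (φ x) * inner ℝ (D u x) (D v x) := h.weightForm_apply _ _

theorem massForm_eq_integral {a : ℝ → ℝ} {φ : Space d → ℝ} {m K : ℝ}
    (h : IsWeight (volume.restrict Ω) m K (fun x => a (φ x))) (u v : V) :
    massForm J a φ u v = ∫ x in Ω, a (φ x) * (J u x * J v x) := by
  refine (h.weightForm_apply _ _).trans ?_
  simp [mul_comm]

attribute [irreducible] gradForm massForm

/-! ### Bounds and limits of the forms, uniform in the phase field -/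

section Bounds

variable {m M : ℝ} {a b c : ℝ → ℝ} {φ : Space d → ℝ}

theorem CoefficientBounds.weight_a (h : CoefficientBounds m M a b c) (hφ : IsPhase Ω φ) :
    IsWeight (volume.restrict Ω) m M (fun x => a (φ x)) :=
  hφ.isWeight h.cont_a h.pos.le (fun x hx => (h.ge x hx).1) fun x hx => (h.le x hx).1

theorem CoefficientBounds.weight_b (h : CoefficientBounds m M a b c) (hφ : IsPhase Ω φ) :
    IsWeight (volume.restrict Ω) 0 M (fun x => b (φ x)) :=
  hφ.isWeight h.cont_b le_rfl (fun x hx => (h.ge x hx).2.1) fun x hx => (h.le x hx).2.1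

theorem CoefficientBounds.weight_c (h : CoefficientBounds m M a b c) (hφ : IsPhase Ω φ) :
    IsWeight (volume.restrict Ω) m M (fun x => c (φ x)) :=
  hφ.isWeight h.cont_c h.pos.le (fun x hx => (h.ge x hx).2.2) fun x hx => (h.le x hx).2.2

/-- The shifted energy dominates the mass. -/
theorem CoefficientBounds.energyForm_ge (h : CoefficientBounds m M a b c) (hφ : IsPhase Ω φ)
    (u : V) : m * ‖D u‖ ^ 2 + massForm J c φ u u ≤ energyForm J D a b c φ u u := by
  have h1 := le_gradForm (D := D) (h.weight_a hφ) u
  have h2 := le_massForm (J := J) (h.weight_b hφ) u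
  rw [energyForm_apply]
  linarith

/-- The added mass supplies the ‖J u‖² part of coercivity, which the Neumann problem lacks; 3M
counts the three summands. No constant depends on φ. -/
theorem CoefficientBounds.formPair (hn : IsGraphNorm J D) (h : CoefficientBounds m M a b c)
    (hφ : IsPhase Ω φ) :
    FormPair J m (3 * M) (energyForm J D a b c φ) (massForm J c φ) where
  pos := h.pos
  symm_A u v := by
    rw [energyForm_apply, energyForm_apply, gradForm_symm (h.weight_a hφ) u v,
      massForm_symm (h.weight_b hφ) u v, massForm_symm (h.weight_c hφ) u v]
  symm_C u v := massForm_symm (h.weight_c hφ) u v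
  coercive u := by
    have h1 := h.energyForm_ge (J := J) (D := D) hφ u
    have h2 := le_massForm (J := J) (h.weight_c hφ) u
    rw [hn u]
    linarith
  bound_A u v := by
    have hM : 0 ≤ M := h.pos.le.trans h.le_bound
    have h1 := abs_gradForm_le (D := D) (h.weight_a hφ) u v
    have h2 := abs_massForm_le (J := J) (h.weight_b hφ) u v
    have h3 := abs_massForm_le (J := J) (h.weight_c hφ) u v
    have h4 : M * ‖D u‖ * ‖D v‖ ≤ M * ‖u‖ * ‖v‖ := by
      gcongr
      exacts [hn.grad_le u, hn.grad_le v]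
    have h5 : M * ‖J u‖ * ‖J v‖ ≤ M * ‖u‖ * ‖v‖ := by
      gcongr
      exacts [hn.value_le u, hn.value_le v]
    rw [energyForm_apply]
    refine (abs_add_three _ _ _).trans ?_
    linarith
  lower_C u := le_massForm (h.weight_c hφ) u
  bound_C u v := by
    have hM : 0 ≤ M := h.pos.le.trans h.le_bound
    refine (abs_massForm_le (J := J) (h.weight_c hφ) u v).trans ?_
    gcongr
    linarith

variable {ψ : ℕ → Space d → ℝ}

theorem CoefficientBounds.tendsto_massForm (hn : IsGraphNorm J D) (h : CoefficientBounds m M a b c)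
    (hψ : ∀ n, IsPhase Ω (ψ n)) (hφ : IsPhase Ω φ)
    (hlim : ∀ᵐ x ∂(volume.restrict Ω), Tendsto (fun n => ψ n x) atTop (𝓝 (φ x))) :
    FormTendsto (fun n => massForm J c (ψ n)) (massForm J c φ) :=
  PhaseField.tendsto_massForm hn (fun n => h.weight_c (hψ n)) (h.weight_c hφ)
    (hlim.mono fun _ hx => (h.cont_c.tendsto _).comp hx)

theorem CoefficientBounds.tendsto_energyForm (hn : IsGraphNorm J D) (h : CoefficientBounds m M a b c)
    (hψ : ∀ n, IsPhase Ω (ψ n)) (hφ : IsPhase Ω φ)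
    (hlim : ∀ᵐ x ∂(volume.restrict Ω), Tendsto (fun n => ψ n x) atTop (𝓝 (φ x))) :
    FormTendsto (fun n => energyForm J D a b c (ψ n)) (energyForm J D a b c φ) :=
  ((tendsto_gradForm hn (fun n => h.weight_a (hψ n)) (h.weight_a hφ)
    (hlim.mono fun _ hx => (h.cont_a.tendsto _).comp hx)).add
    (PhaseField.tendsto_massForm hn (fun n => h.weight_b (hψ n)) (h.weight_b hφ)
    (hlim.mono fun _ hx => (h.cont_b.tendsto _).comp hx))).add
    (h.tendsto_massForm hn hψ hφ hlim)

end Bounds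

theorem reference_forms (φ : Space d → ℝ) (hφ : IsPhase Ω φ) (u : V) :
    energyForm J D (fun _ => 1) (fun _ => 0) (fun _ => 1) φ u u = ‖D u‖ ^ 2 + ‖J u‖ ^ 2 ∧
      massForm J (fun _ => 1) φ u u = ‖J u‖ ^ 2 := by
  have e0 := massForm_eq_integral (J := J) (φ := φ) (a := fun _ => _)
    (CoefficientBounds.one.weight_b hφ) u u
  have e1 := massForm_eq_integral (J := J) (φ := φ) (a := fun _ => _)
    (CoefficientBounds.one.weight_c hφ) u u
  have e2 := gradForm_eq_integral (D := D) (φ := φ) (a := fun _ => _)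
    (CoefficientBounds.one.weight_a hφ) u u
  have e3 : massForm J (fun _ => 1) φ u u = ‖J u‖ ^ 2 := by
    rw [e1, ← real_inner_self_eq_norm_sq, L2.inner_def]
    simp [pow_two]
  refine ⟨?_, e3⟩
  rw [energyForm_apply, e3, e0, e2, ← real_inner_self_eq_norm_sq (D u), L2.inner_def]
  simp

/-- Comparison with the reference problem, from below. -/
theorem IsEigenSystem.lower_bound {m M : ℝ} {a b c : ℝ → ℝ} {φ : Space d → ℝ}
    (hn : IsGraphNorm J D) (hinj : Function.Injective J)
    (h : CoefficientBounds m M a b c) (hφ : IsPhase Ω φ) {Λ Λ' : ℕ → ℝ} {w w' : ℕ → V}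
    (hs : IsEigenSystem (energyForm J D a b c φ) (massForm J c φ) Λ w)
    (hs' : IsEigenSystem (energyForm J D (fun _ => 1) (fun _ => 0) (fun _ => 1) φ)
      (massForm J (fun _ => 1) φ) Λ' w') (k : ℕ) :
    1 ≤ Λ k ∧ m * (Λ' k - 1) ≤ M * (Λ k - 1) := by
  have hΛ : 1 ≤ Λ k := by
    have h1 := h.energyForm_ge (J := J) (D := D) hφ (w k)
    rw [hs.eigen, hs.orthonormal, if_pos rfl, mul_one] at h1
    exact (le_add_of_nonneg_left (mul_nonneg h.pos.le (sq_nonneg _))).trans h1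
  refine ⟨hΛ, ?_⟩
  have P := CoefficientBounds.formPair hn h hφ
  have P' := CoefficientBounds.formPair hn .one hφ
  have hA := reference_forms (J := J) (D := D) φ hφ
  -- For a trial vector the mass in the energy cancels against the shift, leaving m‖D u‖² ≤ (Λ k −
  -- 1) C(u,u). So unshifted eigenvalues are compared and positivity is not lost.
  have key : Λ' k ≤ 1 + M / m * (Λ k - 1) := by
    refine hs'.le_of_forall hs (fun u hu => P'.pos_C hinj hu) fun u hu => ?_
    rw [(hA u).1, (hA u).2]
    have h1 := h.energyForm_ge (J := J) (D := D) hφ u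
    have h2 := (le_abs_self _).trans (abs_massForm_le (J := J) (h.weight_c hφ) u u)
    have h3 : m * ‖D u‖ ^ 2 ≤ (Λ k - 1) * (M * ‖J u‖ * ‖J u‖) :=
      (by linarith : m * ‖D u‖ ^ 2 ≤ (Λ k - 1) * massForm J c φ u u).trans
        (mul_le_mul_of_nonneg_left h2 (sub_nonneg.2 hΛ))
    have h4 : ‖D u‖ ^ 2 ≤ M / m * (Λ k - 1) * ‖J u‖ ^ 2 := by
      rw [div_mul_eq_mul_div, div_mul_eq_mul_div, le_div_iff₀ h.pos]
      linarith
    linarith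
  have hm := h.pos
  have : m * (M / m * (Λ k - 1)) = M * (Λ k - 1) := by field_simp
  nlinarith

/-- Comparison with the reference problem, from above. -/
theorem IsEigenSystem.upper_bound {m M : ℝ} {a b c : ℝ → ℝ} {φ : Space d → ℝ}
    (hn : IsGraphNorm J D) (hinj : Function.Injective J)
    (h : CoefficientBounds m M a b c) (hφ : IsPhase Ω φ) {Λ Λ' : ℕ → ℝ} {w w' : ℕ → V}
    (hs : IsEigenSystem (energyForm J D a b c φ) (massForm J c φ) Λ w)
    (hs' : IsEigenSystem (energyForm J D (fun _ => 1) (fun _ => 0) (fun _ => 1) φ)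
      (massForm J (fun _ => 1) φ) Λ' w') (k : ℕ) :
    Λ k ≤ 3 * M / m * Λ' k := by
  have hM : 0 ≤ M := h.pos.le.trans h.le_bound
  have P := CoefficientBounds.formPair hn h hφ
  have P' := CoefficientBounds.formPair hn .one hφ
  have hΛ' := (IsEigenSystem.lower_bound hn hinj .one hφ hs' hs' k).1
  refine hs.le_of_forall hs' (fun u hu => P.pos_C hinj hu) fun u hu => ?_
  have h1 := (le_abs_self _).trans (P.bound_A u u)
  have h2 := P'.coercive u
  have h3 := (le_abs_self _).trans (abs_massForm_le (J := J) (φ := φ) (a := fun _ => 1)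
    (CoefficientBounds.one.weight_c hφ) u u)
  have h4 := P.lower_C u
  have h5 : ‖u‖ ^ 2 ≤ Λ' k * ‖J u‖ ^ 2 := by
    have : Λ' k * massForm J (fun _ => 1) φ u u ≤ Λ' k * (1 * ‖J u‖ * ‖J u‖) :=
      mul_le_mul_of_nonneg_left h3 (by linarith)
    linarith
  have h6 : ‖J u‖ ^ 2 ≤ massForm J c φ u u / m := by
    rw [le_div_iff₀ h.pos, mul_comm]; exact h4
  calc _ ≤ 3 * M * ‖u‖ ^ 2 := by linarith
    _ ≤ 3 * M * (Λ' k * (massForm J c φ u u / m)) := by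
      gcongr
      exact h5.trans (mul_le_mul_of_nonneg_left h6 (by linarith))
    _ = _ := by ring

/-- The eigenfunctions in the space `S` of pairs `(w, ∇w)`. -/
def eigenfunctions (S : Set (L2Pair Ω)) (a b c : ℝ → ℝ) (φ : Space d → ℝ) (s : ℝ) :
    Set (L2Pair Ω) :=
  {w | w ∈ S ∧ w.1 ≠ 0 ∧ ∀ η ∈ S,
    (∫ x in Ω, a (φ x) * inner ℝ (w.2 x) (η.2 x)) + (∫ x in Ω, b (φ x) * (w.1 x * η.1 x)) =
      s * ∫ x in Ω, c (φ x) * (w.1 x * η.1 x)}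

theorem neumannEigenfunctions_eq (a c : ℝ → ℝ) (φ : PhaseFields Ω) :
    neumannEigenfunctions Ω a c φ = eigenfunctions (sobolevH1 Ω) a (fun _ => 0) c φ := by
  ext s w
  simp [neumannEigenfunctions, eigenfunctions]

/-- The Hilbert space `V`, with the maps `u ↦ u` and `u ↦ ∇u`, is a model of the space `S` of pairs
`(u, ∇u)`, and it is compactly embedded in `L²`. -/
structure IsModel (S : Set (L2Pair Ω)) (J : V →L[ℝ] Lp ℝ 2 (volume.restrict Ω))
    (D : V →L[ℝ] Lp (Space d) 2 (volume.restrict Ω)) : Prop where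
  graph : IsGraphNorm J D
  inj : Function.Injective J
  compact : CompletelyContinuous J
  infinite : ¬ FiniteDimensional ℝ V
  range : ∀ p : L2Pair Ω, p ∈ S ↔ ∃ u, (J u, D u) = p

/-- An eigenvalue s of the weak problem is s + 1 for the shifted pair. Injectivity of J turns the
requirement that the function be nonzero into u ≠ 0. -/
theorem IsModel.span_eigenfunctions {m M : ℝ} {a b c : ℝ → ℝ} {φ : Space d → ℝ}
    {S : Set (L2Pair Ω)} (hS : IsModel S J D) (h : CoefficientBounds m M a b c) (hφ : IsPhase Ω φ)
    (s : ℝ) :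
    Submodule.span ℝ (eigenfunctions S a b c φ s) =
      (eigenspace (energyForm J D a b c φ) (massForm J c φ) (s + 1)).map
        (J.prod D : V →ₗ[ℝ] L2Pair Ω) := by
  have key : ∀ u v : V, energyForm J D a b c φ u v = (s + 1) * massForm J c φ u v ↔
      (∫ x in Ω, a (φ x) * inner ℝ (D u x) (D v x)) + (∫ x in Ω, b (φ x) * (J u x * J v x)) =
      s * ∫ x in Ω, c (φ x) * (J u x * J v x) := by
    intro u v
    rw [energyForm_apply, gradForm_eq_integral (h.weight_a hφ) u v,
      massForm_eq_integral (h.weight_b hφ) u v, massForm_eq_integral (h.weight_c hφ) u v,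
      add_one_mul, add_left_inj]
  apply le_antisymm
  · rw [Submodule.span_le]
    rintro w ⟨hw, -, hw'⟩
    obtain ⟨u, rfl⟩ := (hS.range _).1 hw
    exact ⟨u, mem_eigenspace.2 fun v => (key u v).2 (hw' _ ((hS.range _).2 ⟨v, rfl⟩)), rfl⟩
  · rintro _ ⟨u, hu, rfl⟩
    by_cases hu0 : u = 0
    · rw [hu0, map_zero]; exact zero_mem _
    refine Submodule.subset_span ⟨(hS.range _).2 ⟨u, rfl⟩, ?_, fun η hη => ?_⟩
    · intro h0
      exact hu0 (hS.inj (h0.trans (map_zero J).symm))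
    · obtain ⟨v, rfl⟩ := (hS.range _).1 hη
      exact (key u v).1 (mem_eigenspace.1 hu v)

theorem IsModel.isEigenvalueList {m M : ℝ} {a b c : ℝ → ℝ} {φ : Space d → ℝ}
    {S : Set (L2Pair Ω)} (hS : IsModel S J D) (h : CoefficientBounds m M a b c) (hφ : IsPhase Ω φ)
    {Λ : ℕ → ℝ} {w : ℕ → V} (hs : IsEigenSystem (energyForm J D a b c φ) (massForm J c φ) Λ w) :
    IsEigenvalueList (eigenfunctions S a b c φ) (fun n => Λ n - 1) where
  mono := fun _ _ hij => sub_le_sub_right (hs.mono hij) 1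
  tendsto := tendsto_atTop_add_const_right _ _ hs.tendsto
  multiplicity s := by
    have hP : Function.Injective (J.prod D : V →ₗ[ℝ] L2Pair Ω) := fun u v huv =>
      hS.inj (congrArg Prod.fst huv)
    rw [hS.span_eigenfunctions h hφ,
      ← (Submodule.equivMapOfInjective _ hP _).rank_eq,
      ← hs.mk_eq_rank (CoefficientBounds.formPair hS.graph h hφ) hS.inj]
    simp only [sub_eq_iff_eq_add]

/-- The `n`-th element of the list of eigenvalues. -/
def listedEigenvalue (S : Set (L2Pair Ω)) (a b c : ℝ → ℝ) (φ : Space d → ℝ) (n : ℕ) : ℝ :=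
  Classical.epsilon (IsEigenvalueList (eigenfunctions S a b c φ)) n

/-- Since a list exists, the choice operator returns one, and by uniqueness it is the list built
from the eigensystem. -/
theorem IsModel.exists_system [CompleteSpace V] {m M : ℝ} {a b c : ℝ → ℝ} {φ : Space d → ℝ}
    {S : Set (L2Pair Ω)} (hS : IsModel S J D) (h : CoefficientBounds m M a b c)
    (hφ : IsPhase Ω φ) :
    IsEigenvalueList (eigenfunctions S a b c φ) (listedEigenvalue S a b c φ) ∧
    ∃ w, IsEigenSystem (energyForm J D a b c φ) (massForm J c φ)
      (fun n => listedEigenvalue S a b c φ n + 1) w := by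
  obtain ⟨Λ, w, hs⟩ := (CoefficientBounds.formPair hS.graph h hφ).exists_eigenSystem
    hS.compact hS.inj hS.infinite
  have h1 := hS.isEigenvalueList h hφ hs
  have h2 : IsEigenvalueList (eigenfunctions S a b c φ) (listedEigenvalue S a b c φ) :=
    Classical.epsilon_spec (p := IsEigenvalueList (eigenfunctions S a b c φ)) ⟨_, h1⟩
  refine ⟨h2, w, ?_⟩
  have h3 : (fun n => listedEigenvalue S a b c φ n + 1) = Λ := by
    rw [h2.unique h1]; funext n; ring
  rwa [h3]

theorem IsPhase.zero : IsPhase Ω (fun _ => 0) :=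
  ⟨aestronglyMeasurable_const, Eventually.of_forall fun _ => by simp⟩

/-- Constant coefficients ignore the phase, so one reference system serves every φ. -/
theorem energyForm_one_phase (φ : Space d → ℝ) :
    energyForm J D (fun _ => 1) (fun _ => 0) (fun _ => 1) φ =
      energyForm J D (fun _ => 1) (fun _ => 0) (fun _ => 1) (fun _ => 0) := by
  unfold energyForm gradForm massForm
  rfl

theorem massForm_one_phase (φ : Space d → ℝ) :
    massForm J (fun _ => 1) φ = massForm J (fun _ => 1) (fun _ => 0) := by
  unfold massForm
  rfl

/-- The eigenvalues of the reference problem with `a = c = 1` and `b = 0`. -/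
def referenceEigenvalue (S : Set (L2Pair Ω)) (n : ℕ) : ℝ :=
  listedEigenvalue S (fun _ => 1) (fun _ => 0) (fun _ => 1) (fun _ => 0) n

/-- Bounds for the eigenvalues, uniform in the phase field. -/
theorem IsModel.eigenvalue_bounds [CompleteSpace V] {m M : ℝ} {a b c : ℝ → ℝ} {φ : Space d → ℝ}
    {S : Set (L2Pair Ω)} (hS : IsModel S J D) (h : CoefficientBounds m M a b c)
    (hφ : IsPhase Ω φ) (k : ℕ) :
    0 ≤ listedEigenvalue S a b c φ k ∧ m * referenceEigenvalue S k ≤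
      M * listedEigenvalue S a b c φ k ∧
      listedEigenvalue S a b c φ k ≤ 3 * M / m * (referenceEigenvalue S k + 1) := by
  obtain ⟨-, w, hw⟩ := hS.exists_system h hφ
  obtain ⟨-, w', hw'⟩ := hS.exists_system .one (IsPhase.zero (Ω := Ω))
  rw [← energyForm_one_phase φ, ← massForm_one_phase φ] at hw'
  have h1 := IsEigenSystem.lower_bound hS.graph hS.inj h hφ hw hw' k
  have h2 := IsEigenSystem.upper_bound hS.graph hS.inj h hφ hw hw' k
  simp only [add_sub_cancel_right, le_add_iff_nonneg_left] at h1
  exact ⟨h1.1, h1.2, (le_add_of_nonneg_right zero_le_one).trans h2⟩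

theorem IsModel.tendsto_eigenvalue [CompleteSpace V] {m M : ℝ} {a b c : ℝ → ℝ}
    {ψ : ℕ → Space d → ℝ} {φ : Space d → ℝ}
    {S : Set (L2Pair Ω)} (hS : IsModel S J D) (h : CoefficientBounds m M a b c)
    (hψ : ∀ n, IsPhase Ω (ψ n)) (hφ : IsPhase Ω φ)
    (hlim : ∀ᵐ x ∂(volume.restrict Ω), Tendsto (fun n => ψ n x) atTop (𝓝 (φ x))) (k : ℕ) :
    Tendsto (fun n => listedEigenvalue S a b c (ψ n) k) atTop
      (𝓝 (listedEigenvalue S a b c φ k)) := by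
  obtain ⟨-, w', hw'⟩ := hS.exists_system h hφ
  choose w hw using fun n => (hS.exists_system h (hψ n)).2
  have := IsEigenSystem.tendsto_eigenvalue hS.compact
    (fun n => CoefficientBounds.formPair hS.graph h (hψ n))
    (CoefficientBounds.formPair hS.graph h hφ)
    (CoefficientBounds.tendsto_energyForm hS.graph h hψ hφ hlim)
    (CoefficientBounds.tendsto_massForm hS.graph h hψ hφ hlim) hw hw' k
  simpa using this.sub_const 1

/-- The eigenvector equation, tested with the eigenvector, for the reference problem. -/
theorem IsModel.reference_system [CompleteSpace V] {S : Set (L2Pair Ω)} (hS : IsModel S J D) :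
    ∃ w : ℕ → V, LinearIndependent ℝ w ∧
      ∀ n, ‖D (w n)‖ ^ 2 = referenceEigenvalue S n * ‖J (w n)‖ ^ 2 := by
  obtain ⟨-, w, hw⟩ := hS.exists_system .one (IsPhase.zero (Ω := Ω))
  refine ⟨w, hw.linearIndependent, fun n => ?_⟩
  have e := hw.eigen n (w n)
  obtain ⟨e1, e2⟩ := reference_forms (J := J) (D := D) (fun _ => 0) IsPhase.zero (w n)
  rw [e1, e2] at e
  simp only [referenceEigenvalue]
  linarith

/-- The function of an element of `V`. -/
def valueL (V : Submodule ℝ (L2Hilbert Ω)) : V →L[ℝ] Lp ℝ 2 (volume.restrict Ω) :=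
  (WithLp.fstL 2 ℝ _ _).comp V.subtypeL

/-- The gradient of an element of `V`. -/
def gradL (V : Submodule ℝ (L2Hilbert Ω)) : V →L[ℝ] Lp (Space d) 2 (volume.restrict Ω) :=
  (WithLp.sndL 2 ℝ _ _).comp V.subtypeL

/-- A closed subspace of `H¹(Ω)` between `H¹₀(Ω)` and `H¹(Ω)`, on a bounded Lipschitz domain. -/
structure IsAdmissibleSpace (V : Submodule ℝ (L2Hilbert Ω)) : Prop where
  closed : IsClosed (V : Set (L2Hilbert Ω))
  le : V ≤ hilbertH1 Ω
  ge : hilbertH10 Ω ≤ V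
  dim : 1 ≤ d
  isOpen : IsOpen Ω
  nonempty : Ω.Nonempty
  bounded : Bornology.IsBounded Ω
  lipschitz : HasLipschitzBoundary Ω

namespace IsAdmissibleSpace

variable {V : Submodule ℝ (L2Hilbert Ω)}

theorem completeSpace (hV : IsAdmissibleSpace V) : CompleteSpace V := hV.closed.completeSpace_coe

theorem completelyContinuous (hV : IsAdmissibleSpace V) : CompletelyContinuous (valueL V) :=
  fun _ u v hM huv => by
    have := hV.completeSpace
    exact (huv.map V.subtypeL).tendsto_fst hV.isOpen hV.bounded hV.lipschitz
      (fun n => hV.le (u n).2) (hV.le v.2) hM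

theorem injective (hV : IsAdmissibleSpace V) : Function.Injective (valueL V) := by
  refine (injective_iff_map_eq_zero (valueL V)).2 fun u hu => ?_
  exact Subtype.ext (snd_eq_zero_of_fst_eq_zero hV.isOpen (hV.le u.2) hu)

theorem not_finiteDimensional (hV : IsAdmissibleSpace V) : ¬ FiniteDimensional ℝ V := fun _ =>
  not_finiteDimensional_hilbertH10 hV.dim hV.isOpen hV.nonempty
    (FiniteDimensional.of_injective _ (Submodule.inclusion_injective hV.ge))

theorem isGraphNorm (V : Submodule ℝ (L2Hilbert Ω)) : IsGraphNorm (valueL V) (gradL V) := fun u =>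
  WithLp.prod_norm_sq_eq_of_L2 (u : L2Hilbert Ω)

end IsAdmissibleSpace

theorem IsAdmissibleSpace.isModel {V : Submodule ℝ (L2Hilbert Ω)} (hV : IsAdmissibleSpace V)
    {S : Set (L2Pair Ω)} (hS : ∀ p : L2Hilbert Ω, p ∈ V ↔ WithLp.ofLp p ∈ S) :
    IsModel S (valueL V) (gradL V) where
  graph := IsAdmissibleSpace.isGraphNorm V
  inj := hV.injective
  compact := hV.completelyContinuous
  infinite := hV.not_finiteDimensional
  range p := by
    constructor
    · intro hp
      exact ⟨⟨WithLp.toLp 2 p, (hS _).2 hp⟩, rfl⟩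
    · rintro ⟨u, rfl⟩
      exact (hS _).1 u.2

end Problem

/-! ### The Dirichlet and the Neumann problem -/

section DirichletNeumann

variable {d : ℕ} {Ω : Set (Space d)}

theorem IsModel.reference_nonneg {V : Type} [NormedAddCommGroup V] [InnerProductSpace ℝ V]
    [CompleteSpace V]
    {J : V →L[ℝ] Lp ℝ 2 (volume.restrict Ω)} {D : V →L[ℝ] Lp (Space d) 2 (volume.restrict Ω)}
    {S : Set (L2Pair Ω)} (hS : IsModel S J D) (k : ℕ) : 0 ≤ referenceEigenvalue S k :=
  (hS.eigenvalue_bounds .one IsPhase.zero k).1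

theorem IsModel.reference_pos_of_injective {V : Type} [NormedAddCommGroup V]
    [InnerProductSpace ℝ V] [CompleteSpace V]
    {J : V →L[ℝ] Lp ℝ 2 (volume.restrict Ω)} {D : V →L[ℝ] Lp (Space d) 2 (volume.restrict Ω)}
    {S : Set (L2Pair Ω)} (hS : IsModel S J D) (hD : ∀ u, D u = 0 → u = 0) (k : ℕ) :
    0 < referenceEigenvalue S k := by
  refine (hS.reference_nonneg k).lt_of_ne fun h0 => ?_
  obtain ⟨w, hw, h⟩ := hS.reference_system
  have h1 := h k
  rw [← h0, zero_mul, sq_eq_zero_iff, norm_eq_zero] at h1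
  exact hw.ne_zero k (hD _ h1)

/-- If the k-th eigenvalue vanished, so would the 0-th. Then w 0 and w k, which are independent,
would both have values that are multiples of e. -/
theorem IsModel.reference_pos_of_constants {V : Type} [NormedAddCommGroup V]
    [InnerProductSpace ℝ V] [CompleteSpace V]
    {J : V →L[ℝ] Lp ℝ 2 (volume.restrict Ω)} {D : V →L[ℝ] Lp (Space d) 2 (volume.restrict Ω)}
    {S : Set (L2Pair Ω)} (hS : IsModel S J D) (e : Lp ℝ 2 (volume.restrict Ω))
    (hD : ∀ u, D u = 0 → ∃ t : ℝ, J u = t • e) {k : ℕ} (hk : 1 ≤ k) :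
    0 < referenceEigenvalue S k := by
  refine (hS.reference_nonneg k).lt_of_ne fun h0 => ?_
  have h0' : referenceEigenvalue S 0 = 0 := by
    have hmono := (hS.exists_system .one (IsPhase.zero (Ω := Ω))).1.mono (Nat.zero_le k)
    exact le_antisymm (hmono.trans h0.ge) (hS.reference_nonneg 0)
  obtain ⟨w, hw, h⟩ := hS.reference_system
  have h1 := h k
  rw [← h0, zero_mul, sq_eq_zero_iff, norm_eq_zero] at h1
  have h2 := h 0
  rw [h0', zero_mul, sq_eq_zero_iff, norm_eq_zero] at h2
  obtain ⟨t, ht⟩ := hD _ h1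
  obtain ⟨t', ht'⟩ := hD _ h2
  have hpair : LinearIndependent ℝ ![w 0, w k] := by
    have := hw.comp ![0, k] (by
      intro i j hij
      fin_cases i <;> fin_cases j <;> simp_all
      omega)
    have e : w ∘ ![0, k] = ![w 0, w k] := by
      ext i; fin_cases i <;> rfl
    rwa [e] at this
  have hdep : t • w 0 + (-t') • w k = 0 := by
    apply hS.inj
    rw [map_add, map_smul, map_smul, map_zero, ht, ht', smul_smul, smul_smul, ← add_smul]
    have : t * t' + -t' * t = 0 := by ring
    rw [this, zero_smul]
  have := (LinearIndependent.pair_iff.1 hpair t (-t') hdep).1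
  rw [this, zero_smul] at ht
  exact hw.ne_zero k (hS.inj (ht.trans (map_zero J).symm))

theorem isAdmissibleSpace_hilbertH10 (hd : 1 ≤ d) (hΩ_open : IsOpen Ω) (hΩ_conn : IsConnected Ω)
    (hΩ_bdd : Bornology.IsBounded Ω) (hΩ_lip : HasLipschitzBoundary Ω) :
    IsAdmissibleSpace (hilbertH10 Ω) :=
  ⟨isClosed_hilbertH10 Ω, hilbertH10_le Ω, le_rfl, hd, hΩ_open, hΩ_conn.nonempty, hΩ_bdd, hΩ_lip⟩

theorem isAdmissibleSpace_hilbertH1 (hd : 1 ≤ d) (hΩ_open : IsOpen Ω) (hΩ_conn : IsConnected Ω)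
    (hΩ_bdd : Bornology.IsBounded Ω) (hΩ_lip : HasLipschitzBoundary Ω) :
    IsAdmissibleSpace (hilbertH1 Ω) :=
  ⟨isClosed_hilbertH1 Ω, le_rfl, hilbertH10_le Ω, hd, hΩ_open, hΩ_conn.nonempty, hΩ_bdd, hΩ_lip⟩

theorem hasWeakGradient_const {U : Set (Space d)} (t : ℝ) :
    HasWeakGradient U (fun _ => t) (fun _ => 0) := by
  intro η hη
  simp only [smul_zero, integral_zero, neg_zero]
  rw [integral_smul]
  have h0 : ∫ x in U, gradient η x = 0 := by
    rw [setIntegral_eq_integral_of_forall_compl_eq_zero]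
    · refine ext_inner_left ℝ fun v => ?_
      rw [← integral_inner (hη.continuous_gradient.integrable_of_hasCompactSupport
        hη.hasCompactSupport_gradient), inner_zero_right]
      have h := integral_mul_fderiv_eq_neg_fderiv_mul_of_integrable (μ := volume)
        (f := fun _ : Space d => (1 : ℝ)) (g := η) (v := v) (by simp)
        (by
          simp only [one_mul]
          refine Continuous.integrable_of_hasCompactSupport
            ((hη.1.continuous_fderiv (by simp)).clm_apply continuous_const) ?_
          exact (hη.2.1.fderiv (𝕜 := ℝ)).comp_left (g := fun L : Space d →L[ℝ] ℝ => L v) rfl)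
        (by simpa using hη.continuous.integrable_of_hasCompactSupport hη.2.1)
        (fun x _ => differentiableAt_const _) (fun x _ => hη.differentiable x)
      simp only [one_mul, fderiv_fun_const, Pi.zero_apply, zero_apply, zero_mul,
        integral_zero, neg_zero] at h
      rw [← h]
      refine integral_congr_ae (Eventually.of_forall fun x => ?_)
      exact (real_inner_comm _ _).trans (IsTestFunction.inner_gradient η x v)
    · intro x hx
      have : x ∉ tsupport (fderiv ℝ η) := fun h => hx (hη.2.2 (tsupport_fderiv_subset ℝ h))
      rw [gradient, image_eq_zero_of_notMem_tsupport this, map_zero]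
  rw [h0, smul_zero]

/-- The data of a boundary value problem on `Ω`: a model of the space of admissible functions
together with positive lower bounds for the eigenvalues from `k₀` on. -/
structure IsSpectralSpace (S : Set (L2Pair Ω)) (k₀ : ℕ) : Prop where
  model : ∃ (V : Type) (_ : NormedAddCommGroup V) (_ : InnerProductSpace ℝ V)
    (_ : CompleteSpace V) (J : V →L[ℝ] Lp ℝ 2 (volume.restrict Ω))
    (D : V →L[ℝ] Lp (Space d) 2 (volume.restrict Ω)), IsModel S J D
  pos : ∀ k, k₀ ≤ k → 0 < referenceEigenvalue S k

/-- Poincaré's inequality excludes nonzero functions with zero gradient, so positivity starts at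
index 0 of the list. -/
theorem isSpectralSpace_sobolevH10 (hd : 1 ≤ d) (hΩ_open : IsOpen Ω) (hΩ_conn : IsConnected Ω)
    (hΩ_bdd : Bornology.IsBounded Ω) (hΩ_lip : HasLipschitzBoundary Ω) :
    IsSpectralSpace (sobolevH10 Ω) 0 := by
  have hV := isAdmissibleSpace_hilbertH10 hd hΩ_open hΩ_conn hΩ_bdd hΩ_lip
  have hS := hV.isModel (S := sobolevH10 Ω) fun p => mem_hilbertH10
  have := hV.completeSpace
  refine ⟨⟨_, _, _, this, _, _, hS⟩, fun k _ => hS.reference_pos_of_injective (fun u hu => ?_) k⟩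
  obtain ⟨K, hK⟩ := norm_fst_le_of_mem_hilbertH10 hd hΩ_bdd
  apply hS.inj
  rw [map_zero]
  have h1 : ‖valueL _ u‖ ≤ K * ‖gradL _ u‖ := hK u u.2
  rw [hu, norm_zero, mul_zero] at h1
  exact norm_le_zero_iff.1 h1

/-- On a connected domain only constants have zero gradient, so positivity starts at index 1. -/
theorem isSpectralSpace_sobolevH1 (hd : 1 ≤ d) (hΩ_open : IsOpen Ω) (hΩ_conn : IsConnected Ω)
    (hΩ_bdd : Bornology.IsBounded Ω) (hΩ_lip : HasLipschitzBoundary Ω) :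
    IsSpectralSpace (sobolevH1 Ω) 1 := by
  have hV := isAdmissibleSpace_hilbertH1 hd hΩ_open hΩ_conn hΩ_bdd hΩ_lip
  have hS := hV.isModel (S := sobolevH1 Ω) fun p => mem_hilbertH1
  have := hV.completeSpace
  have hfin : IsFiniteMeasure (volume.restrict Ω) :=
    ⟨by rw [Measure.restrict_apply_univ]; exact hΩ_bdd.measure_lt_top⟩
  have hone : MemLp (fun _ : Space d => (1 : ℝ)) 2 (volume.restrict Ω) := memLp_const 1
  refine ⟨⟨_, _, _, this, _, _, hS⟩, fun k hk =>
    hS.reference_pos_of_constants (hone.toLp _) (fun u hu => ?_) hk⟩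
  set f := valueL (hilbertH1 Ω) u
  have hwg : HasWeakGradient Ω f (gradL (hilbertH1 Ω) u) := mem_hilbertH1.1 u.2
  rw [hu] at hwg
  obtain ⟨t, ht⟩ := (hwg.congr (EventuallyEq.rfl) (Lp.coeFn_zero _ _ _)).ae_const hΩ_open hΩ_conn
    (Lp.stronglyMeasurable f) ((Lp.memLp f).integrable (by norm_num)) (Lp.memLp f)
  refine ⟨t, Lp.ext ?_⟩
  filter_upwards [ht, Lp.coeFn_smul t (hone.toLp _), hone.coeFn_toLp] with x h1 h2 h3
  rw [h1, h2, Pi.smul_apply, h3, smul_eq_mul, mul_one]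

theorem IsSpectralSpace.isEigenvalueList {S : Set (L2Pair Ω)} {k₀ : ℕ} (hS : IsSpectralSpace S k₀)
    {m M : ℝ} {a b c : ℝ → ℝ} {φ : Space d → ℝ} (h : CoefficientBounds m M a b c)
    (hφ : IsPhase Ω φ) :
    IsEigenvalueList (eigenfunctions S a b c φ) (listedEigenvalue S a b c φ) := by
  obtain ⟨V, _, _, _, J, D, hM⟩ := hS.model
  exact (hM.exists_system h hφ).1

theorem IsSpectralSpace.eigenvalue_bounds {S : Set (L2Pair Ω)} {k₀ : ℕ}
    (hS : IsSpectralSpace S k₀)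
    {m M : ℝ} {a b c : ℝ → ℝ} {φ : Space d → ℝ} (h : CoefficientBounds m M a b c)
    (hφ : IsPhase Ω φ) (k : ℕ) :
    0 ≤ listedEigenvalue S a b c φ k ∧ listedEigenvalue S a b c φ k ∈
      Set.Icc (m / M * referenceEigenvalue S k) (3 * M / m * (referenceEigenvalue S k + 1)) := by
  obtain ⟨V, _, _, _, J, D, hM⟩ := hS.model
  have := hM.eigenvalue_bounds h hφ k
  refine ⟨this.1, ?_, this.2.2⟩
  rw [div_mul_eq_mul_div, div_le_iff₀ (h.pos.trans_le h.le_bound), mul_comm _ M]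
  exact this.2.1

theorem IsSpectralSpace.eigenvalue_pos {S : Set (L2Pair Ω)} {k₀ : ℕ}
    (hS : IsSpectralSpace S k₀)
    {m M : ℝ} {a b c : ℝ → ℝ} {φ : Space d → ℝ} (h : CoefficientBounds m M a b c)
    (hφ : IsPhase Ω φ) {k : ℕ} (hk : k₀ ≤ k) : 0 < listedEigenvalue S a b c φ k :=
  lt_of_lt_of_le (mul_pos (div_pos h.pos (h.pos.trans_le h.le_bound)) (hS.pos k hk))
    (hS.eigenvalue_bounds h hφ k).2.1

theorem IsSpectralSpace.tendsto_eigenvalue {S : Set (L2Pair Ω)} {k₀ : ℕ}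
    (hS : IsSpectralSpace S k₀)
    {m M : ℝ} {a b c : ℝ → ℝ} {ψ : ℕ → Space d → ℝ} {φ : Space d → ℝ}
    (h : CoefficientBounds m M a b c) (hψ : ∀ n, IsPhase Ω (ψ n)) (hφ : IsPhase Ω φ)
    (hlim : ∀ᵐ x ∂(volume.restrict Ω), Tendsto (fun n => ψ n x) atTop (𝓝 (φ x))) (k : ℕ) :
    Tendsto (fun n => listedEigenvalue S a b c (ψ n) k) atTop
      (𝓝 (listedEigenvalue S a b c φ k)) := by
  obtain ⟨V, _, _, _, J, D, hM⟩ := hS.model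
  exact hM.tendsto_eigenvalue h hψ hφ hlim k

/-- The first Neumann eigenvalue vanishes. -/
theorem listedEigenvalue_neumann_zero {k₀ : ℕ}
    (hS : IsSpectralSpace (sobolevH1 Ω) k₀) (hΩ_bdd : Bornology.IsBounded Ω) (hne : volume Ω ≠ 0)
    {m M : ℝ} {a c : ℝ → ℝ}
    {φ : Space d → ℝ} (h : CoefficientBounds m M a (fun _ => 0) c) (hφ : IsPhase Ω φ) :
    listedEigenvalue (sobolevH1 Ω) a (fun _ => 0) c φ 0 = 0 := by
  refine le_antisymm ?_ (hS.eigenvalue_bounds h hφ 0).1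
  obtain ⟨V, _, _, _, J, D, hM⟩ := hS.model
  obtain ⟨-, w, hw⟩ := hM.exists_system h hφ
  have hfin : IsFiniteMeasure (volume.restrict Ω) :=
    ⟨by rw [Measure.restrict_apply_univ]; exact hΩ_bdd.measure_lt_top⟩
  have hone : MemLp (fun _ : Space d => (1 : ℝ)) 2 (volume.restrict Ω) := memLp_const 1
  obtain ⟨u, hu⟩ := (hM.range (hone.toLp _, 0)).1
    ((hasWeakGradient_const 1).congr hone.coeFn_toLp.symm (Lp.coeFn_zero _ _ _).symm)
  have hJ : J u = hone.toLp _ := congrArg Prod.fst hu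
  have hD : D u = 0 := congrArg Prod.snd hu
  have hu0 : u ≠ 0 := by
    rintro rfl
    rw [map_zero] at hJ
    have h1 := congrArg norm hJ
    rw [norm_zero, Lp.norm_toLp, eq_comm, ENNReal.toReal_eq_zero_iff] at h1
    have h2 := (eLpNorm_eq_zero_iff hone.1 two_ne_zero).1 (h1.resolve_right hone.2.ne)
    have h3 : (ae (volume.restrict Ω)).NeBot := by rwa [ae_neBot, Ne, Measure.restrict_eq_zero]
    obtain ⟨x, hx⟩ := h2.exists
    exact one_ne_zero hx
  -- The energy of the constant function is just its mass, so the shifted eigenvalue is at most 1.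
  have h1 := hw.le 0 u (fun j hj => absurd hj (Nat.not_lt_zero j))
  have h2 := abs_gradForm_le (D := D) (h.weight_a hφ) u u
  rw [hD, norm_zero, mul_zero, abs_le, neg_zero] at h2
  have h3 : massForm J (fun _ => 0) φ u u = 0 := by
    rw [massForm_eq_integral (h.weight_b hφ)]; simp
  have h4 := (CoefficientBounds.formPair hM.graph h hφ).pos_C hM.inj hu0
  rw [energyForm_apply, h3] at h1
  nlinarith

end DirichletNeumann

/-! ### The Ginzburg-Landau energy -/

section Energy

variable {d : ℕ} {U : Set (Space d)}

/-- Weak gradients are unique, so the choice in `weakGradient` is immaterial. -/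
theorem weakGradient_eq (hU : IsOpen U) {p : L2Hilbert U} (hp : p ∈ hilbertH1 U)
    {f : Space d → ℝ} (h : p.fst =ᵐ[volume.restrict U] f) : weakGradient U f = p.snd := by
  obtain ⟨q, hq, hq1, hq2⟩ := Classical.epsilon_spec
    (p := fun G => ∃ p ∈ sobolevH1 U, p.1 =ᵐ[volume.restrict U] f ∧ p.2 = G)
    ⟨p.snd, WithLp.ofLp p, mem_hilbertH1.1 hp, h, rfl⟩
  have hq' : WithLp.toLp 2 q ∈ hilbertH1 U := mem_hilbertH1.2 hq
  have h0 : p - WithLp.toLp 2 q = 0 := by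
    refine snd_eq_zero_of_fst_eq_zero hU (sub_mem hp hq') ?_
    exact sub_eq_zero.2 (Lp.ext (h.trans hq1.symm))
  have h1 : p.snd = q.2 := congrArg WithLp.snd (sub_eq_zero.1 h0)
  rw [h1]
  exact hq2.symm

theorem integrable_comp_of_abs_le_one {α : Type*} [MeasurableSpace α] {μ : Measure α}
    [IsFiniteMeasure μ] {f : α → ℝ} (hf : AEStronglyMeasurable f μ) (hb : ∀ᵐ x ∂μ, |f x| ≤ 1)
    {g : ℝ → ℝ} (hg : Continuous g) : Integrable (fun x => g (f x)) μ := by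
  obtain ⟨B, hB⟩ := (isCompact_Icc (a := (-1 : ℝ)) (b := 1)).exists_bound_of_continuousOn
    hg.continuousOn
  exact .of_bound (hg.comp_aestronglyMeasurable hf) B (hb.mono fun x hx => hB _ (abs_le.1 hx))

theorem tendsto_integral_comp {α : Type*} [MeasurableSpace α] {μ : Measure α}
    [IsFiniteMeasure μ] {f : ℕ → α → ℝ} {f' : α → ℝ} (hf : ∀ n, AEStronglyMeasurable (f n) μ)
    (hb : ∀ n, ∀ᵐ x ∂μ, |f n x| ≤ 1)
    (hlim : ∀ᵐ x ∂μ, Tendsto (fun n => f n x) atTop (𝓝 (f' x)))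
    {g : ℝ → ℝ} (hg : Continuous g) :
    Tendsto (fun n => ∫ x, g (f n x) ∂μ) atTop (𝓝 (∫ x, g (f' x) ∂μ)) := by
  obtain ⟨B, hB⟩ := (isCompact_Icc (a := (-1 : ℝ)) (b := 1)).exists_bound_of_continuousOn
    hg.continuousOn
  exact tendsto_integral_of_dominated_convergence (fun _ => B)
    (fun n => hg.comp_aestronglyMeasurable (hf n)) (integrable_const B)
    (fun n => (hb n).mono fun x hx => hB _ (abs_le.1 hx))
    (hlim.mono fun x hx => (hg.tendsto _).comp hx)

theorem norm_sq_eq_integral {E : Type*} [NormedAddCommGroup E] [InnerProductSpace ℝ E]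
    (f : Lp E 2 (volume.restrict U)) : ‖f‖ ^ 2 = ∫ x in U, ‖f x‖ ^ 2 := by
  rw [Lp.norm_def, toReal_eLpNorm_two_sq (Lp.memLp f)]

theorem energy_eq [IsFiniteMeasure (volume.restrict U)] (hU : IsOpen U) {p : L2Hilbert U}
    (hp : p ∈ hilbertH1 U)
    {f : Space d → ℝ} (h : p.fst =ᵐ[volume.restrict U] f)
    (hb : ∀ᵐ x ∂(volume.restrict U), |f x| ≤ 1) {g : ℝ → ℝ} (hg : Continuous g) (ε : ℝ) :
    energy U g ε f = ε / 2 * ‖p.snd‖ ^ 2 + 1 / ε * ∫ x in U, g (f x) := by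
  have hf : AEStronglyMeasurable f (volume.restrict U) := (Lp.aestronglyMeasurable p.fst).congr h
  rw [energy, weakGradient_eq hU hp h, integral_add, integral_const_mul, integral_const_mul,
    norm_sq_eq_integral]
  · exact (Lp.memLp p.snd).integrable_norm_pow two_ne_zero |>.const_mul _
  · exact (integrable_comp_of_abs_le_one hf hb hg).const_mul _

theorem IsDoubleWell.continuous {ψ₀ : ℝ → ℝ} (h : IsDoubleWell ψ₀) : Continuous ψ₀ :=
  h.regular.1.continuous

theorem IsDoubleWell.nonneg {ψ₀ : ℝ → ℝ} (h : IsDoubleWell ψ₀) {x : ℝ}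
    (hx : x ∈ Set.Icc (-1 : ℝ) 1) : 0 ≤ ψ₀ x := by
  have h1 : (-1 : ℝ) ∈ {x | ∀ y, potential ψ₀ x ≤ potential ψ₀ y} := by
    rw [h.minimum_points]; exact Set.mem_insert _ _
  have h2 := h1 x
  rw [h.minimum_value.1, potential, if_pos hx, add_zero] at h2
  exact EReal.coe_nonneg.1 h2

end Energy

/-! ### Admissible phase fields -/

section Admissible

variable {d : ℕ} {Ω S₀ S₁ : Set (Space d)}

/-- The design domain with the regions of prescribed phase. -/
structure IsDesign (Ω S₀ S₁ : Set (Space d)) : Prop where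
  bounded : Bornology.IsBounded Ω
  null₀ : NullMeasurableSet S₀ volume
  null₁ : NullMeasurableSet S₁ volume
  disjoint : Disjoint S₀ S₁
  isOpen : IsOpen (Ω \ (S₀ ∪ S₁))
  lipschitz : HasLipschitzBoundary (Ω \ (S₀ ∪ S₁))

theorem IsDesign.isFiniteMeasure (h : IsDesign Ω S₀ S₁) : IsFiniteMeasure (volume.restrict Ω) :=
  ⟨by rw [Measure.restrict_apply_univ]; exact h.bounded.measure_lt_top⟩

theorem IsDesign.isFiniteMeasure_diff (h : IsDesign Ω S₀ S₁) :
    IsFiniteMeasure (volume.restrict (Ω \ (S₀ ∪ S₁))) :=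
  ⟨by rw [Measure.restrict_apply_univ]; exact (h.bounded.subset Set.sdiff_subset).measure_lt_top⟩

/-- The set of admissible phase fields. -/
abbrev admissible (Ω S₀ S₁ : Set (Space d)) (β₁ β₂ : ℝ) : Set (PhaseFields Ω) :=
  constraintG Ω S₀ S₁ β₁ β₂ ∩ constraintU Ω S₀ S₁

theorem IsDesign.ae_of_diff (h : IsDesign Ω S₀ S₁) {P : Space d → Prop}
    (hP : ∀ᵐ x ∂(volume.restrict (Ω \ (S₀ ∪ S₁))), P x) :
    ∀ᵐ x ∂(volume.restrict Ω), x ∈ Ω \ (S₀ ∪ S₁) → P x :=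
  ae_restrict_of_ae ((ae_restrict_iff' h.isOpen.measurableSet).1 hP)

theorem ae_diff {P : Space d → Prop} (hP : ∀ᵐ x ∂(volume.restrict Ω), P x) :
    ∀ᵐ x ∂(volume.restrict (Ω \ (S₀ ∪ S₁))), P x :=
  ae_restrict_of_ae_restrict_of_subset Set.sdiff_subset hP

theorem mem_diff_or {x : Space d} (hx : x ∈ Ω) : x ∈ S₀ ∨ x ∈ S₁ ∨ x ∈ Ω \ (S₀ ∪ S₁) := by
  by_cases h0 : x ∈ S₀
  · exact .inl h0
  by_cases h1 : x ∈ S₁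
  · exact .inr (.inl h1)
  · exact .inr (.inr ⟨hx, fun h => h.elim h0 h1⟩)

theorem IsDesign.isPhase (h : IsDesign Ω S₀ S₁) (hΩ : MeasurableSet Ω) {β₁ β₂ : ℝ}
    {φ : PhaseFields Ω}
    (hφ : φ ∈ admissible Ω S₀ S₁ β₁ β₂) : IsPhase Ω φ where
  meas := Lp.aestronglyMeasurable φ
  bound := by
    filter_upwards [hφ.2.1, hφ.2.2, h.ae_of_diff hφ.1.2.1, ae_restrict_mem hΩ] with x h0 h1 h2 hx
    rcases mem_diff_or (S₀ := S₀) (S₁ := S₁) hx with h | h | h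
    · rw [h0 h]; simp
    · rw [h1 h]; simp
    · exact h2 h

/-- The constant β₁ on Ω', continued by the prescribed values, meets every constraint. -/
theorem IsDesign.nonempty_admissible (h : IsDesign Ω S₀ S₁) {β₁ β₂ : ℝ} (hβ : β₁ ≤ β₂)
    (hβ₁ : β₁ ∈ Set.Ioo (-1 : ℝ) 1) : (admissible Ω S₀ S₁ β₁ β₂).Nonempty := by
  have := h.isFiniteMeasure
  have := h.isFiniteMeasure_diff
  classical
  let f : Space d → ℝ := fun x =>
    β₁ + S₀.indicator (fun _ => -1 - β₁) x + S₁.indicator (fun _ => 1 - β₁) x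
  have hf : AEStronglyMeasurable f (volume.restrict Ω) :=
    (aestronglyMeasurable_const.add (aestronglyMeasurable_const.indicator₀
      (h.null₀.mono_ac Measure.absolutelyContinuous_restrict))).add
      (aestronglyMeasurable_const.indicator₀
      (h.null₁.mono_ac Measure.absolutelyContinuous_restrict))
  have f0 : ∀ x ∈ S₀, f x = -1 := fun x hx => by
    simp [f, hx, Set.disjoint_left.1 h.disjoint hx]
  have f1 : ∀ x ∈ S₁, f x = 1 := fun x hx => by
    simp [f, hx, Set.disjoint_right.1 h.disjoint hx]
  have f2 : ∀ x ∈ Ω \ (S₀ ∪ S₁), f x = β₁ := fun x hx => by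
    have h0 : x ∉ S₀ := fun h0 => hx.2 (.inl h0)
    have h1 : x ∉ S₁ := fun h1 => hx.2 (.inr h1)
    simp [f, h0, h1]
  have hb : ∀ x, ‖f x‖ ≤ 3 := fun x => by
    have hβ' : |β₁| ≤ 1 := abs_le.2 ⟨hβ₁.1.le, hβ₁.2.le⟩
    by_cases h0 : x ∈ S₀
    · rw [f0 x h0]; norm_num
    by_cases h1 : x ∈ S₁
    · rw [f1 x h1]; norm_num
    · simp only [f, h0, h1, not_false_eq_true, Set.indicator_of_notMem, add_zero, Real.norm_eq_abs]
      linarith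
  have hm : MemLp f 1 (volume.restrict Ω) := .of_bound hf 3 (Eventually.of_forall hb)
  have e : ∀ᵐ x ∂(volume.restrict (Ω \ (S₀ ∪ S₁))), hm.toLp f x = β₁ := by
    filter_upwards [ae_diff hm.coeFn_toLp, ae_restrict_mem h.isOpen.measurableSet] with x h1 h2
    rw [h1, f2 x h2]
  have ei : ∫ x in Ω \ (S₀ ∪ S₁), hm.toLp f x = β₁ * volume.real (Ω \ (S₀ ∪ S₁)) := by
    rw [integral_congr_ae e, setIntegral_const, smul_eq_mul, mul_comm]
  have hc : MemLp (fun _ : Space d => β₁) 2 (volume.restrict (Ω \ (S₀ ∪ S₁))) := memLp_const _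
  refine ⟨hm.toLp f, ⟨⟨(hc.toLp _, 0), ?_, hc.coeFn_toLp.trans ?_⟩, ?_, ei.ge, ?_⟩, ?_, ?_⟩
  · exact (hasWeakGradient_const β₁).congr hc.coeFn_toLp.symm (Lp.coeFn_zero _ _ _).symm
  · exact e.mono fun x hx => hx.symm
  · exact e.mono fun x hx => by rw [hx]; exact abs_le.2 ⟨hβ₁.1.le, hβ₁.2.le⟩
  · rw [ei]; exact mul_le_mul_of_nonneg_right hβ measureReal_nonneg
  · exact hm.coeFn_toLp.mono fun x hx hx' => hx.trans (f0 x hx')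
  · exact hm.coeFn_toLp.mono fun x hx hx' => hx.trans (f1 x hx')

theorem exists_hilbertH1 {β₁ β₂ : ℝ} {φ : PhaseFields Ω} (hφ : φ ∈ admissible Ω S₀ S₁ β₁ β₂) :
    ∃ p ∈ hilbertH1 (Ω \ (S₀ ∪ S₁)), p.fst =ᵐ[volume.restrict (Ω \ (S₀ ∪ S₁))] φ := by
  obtain ⟨p, hp, hp'⟩ := hφ.1.1
  exact ⟨WithLp.toLp 2 p, mem_hilbertH1.2 hp, hp'⟩

theorem IsDesign.integral_potential_nonneg {β₁ β₂ : ℝ}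
    {φ : PhaseFields Ω} (hφ : φ ∈ admissible Ω S₀ S₁ β₁ β₂) {ψ₀ : ℝ → ℝ} (hψ₀ : IsDoubleWell ψ₀) :
    0 ≤ ∫ x in Ω \ (S₀ ∪ S₁), ψ₀ (φ x) :=
  integral_nonneg_of_ae (hφ.1.2.1.mono fun _ hx => hψ₀.nonneg (abs_le.1 hx))

theorem IsDesign.energy_nonneg (h : IsDesign Ω S₀ S₁) {β₁ β₂ : ℝ}
    {φ : PhaseFields Ω} (hφ : φ ∈ admissible Ω S₀ S₁ β₁ β₂) {ψ₀ : ℝ → ℝ} (hψ₀ : IsDoubleWell ψ₀)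
    {ε : ℝ} (hε : 0 < ε) : 0 ≤ energy (Ω \ (S₀ ∪ S₁)) ψ₀ ε φ := by
  have := h.isFiniteMeasure_diff
  obtain ⟨p, hp, hp'⟩ := exists_hilbertH1 hφ
  rw [energy_eq h.isOpen hp hp' hφ.1.2.1 hψ₀.continuous]
  have := IsDesign.integral_potential_nonneg hφ hψ₀
  positivity

/-- Phase fields with bounded energy have bounded `H¹` norm. -/
theorem IsDesign.norm_le (h : IsDesign Ω S₀ S₁) {β₁ β₂ : ℝ}
    {φ : PhaseFields Ω} (hφ : φ ∈ admissible Ω S₀ S₁ β₁ β₂) {ψ₀ : ℝ → ℝ} (hψ₀ : IsDoubleWell ψ₀)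
    {ε : ℝ} (hε : 0 < ε) {C : ℝ} (hC : energy (Ω \ (S₀ ∪ S₁)) ψ₀ ε φ ≤ C)
    {p : L2Hilbert (Ω \ (S₀ ∪ S₁))} (hp : p ∈ hilbertH1 (Ω \ (S₀ ∪ S₁)))
    (hp' : p.fst =ᵐ[volume.restrict (Ω \ (S₀ ∪ S₁))] φ) :
    ‖p‖ ≤ volume.real (Ω \ (S₀ ∪ S₁)) + 2 / ε * C + 1 := by
  have := h.isFiniteMeasure_diff
  rw [energy_eq h.isOpen hp hp' hφ.1.2.1 hψ₀.continuous] at hC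
  have h0 := IsDesign.integral_potential_nonneg hφ hψ₀
  have h1 : ‖p.snd‖ ^ 2 ≤ 2 / ε * C := by
    have : ε / 2 * ‖p.snd‖ ^ 2 ≤ C :=
      (le_add_of_nonneg_right (by positivity)).trans hC
    rw [div_mul_eq_mul_div, le_div_iff₀ hε]
    linarith
  have h2 : ‖p.fst‖ ^ 2 ≤ volume.real (Ω \ (S₀ ∪ S₁)) := by
    rw [norm_sq_eq_integral]
    calc _ ≤ ∫ x in Ω \ (S₀ ∪ S₁), (1 : ℝ) := by
          refine integral_mono_of_nonneg (Eventually.of_forall fun _ => sq_nonneg _)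
            (integrable_const _) ?_
          filter_upwards [hp', hφ.1.2.1] with x hx hx'
          rw [hx, Real.norm_eq_abs]
          exact pow_le_one₀ (abs_nonneg _) hx'
      _ = _ := by simp
  have h3 : ‖p‖ ^ 2 = ‖p.fst‖ ^ 2 + ‖p.snd‖ ^ 2 := WithLp.prod_norm_sq_eq_of_L2 p
  nlinarith [sq_nonneg (‖p‖ - 1)]

/-- The constraints pass to a.e. limits, the mean value by dominated convergence with |φ| ≤ 1. Only
membership in H¹ does not, and it is assumed. -/
theorem IsDesign.mem_admissible_of_tendsto (h : IsDesign Ω S₀ S₁) {β₁ β₂ : ℝ}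
    {φ : ℕ → PhaseFields Ω} (hφ : ∀ n, φ n ∈ admissible Ω S₀ S₁ β₁ β₂) {φ' : PhaseFields Ω}
    (hlim : ∀ᵐ x ∂(volume.restrict Ω), Tendsto (fun n => φ n x) atTop (𝓝 (φ' x)))
    (h1 : MemH1 (Ω \ (S₀ ∪ S₁)) φ') : φ' ∈ admissible Ω S₀ S₁ β₁ β₂ := by
  have := h.isFiniteMeasure_diff
  have hi : Tendsto (fun n => ∫ x in Ω \ (S₀ ∪ S₁), φ n x) atTop
      (𝓝 (∫ x in Ω \ (S₀ ∪ S₁), φ' x)) :=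
    tendsto_integral_comp (fun n => (Lp.stronglyMeasurable (φ n)).aestronglyMeasurable)
      (fun n => (hφ n).1.2.1) (ae_diff hlim) continuous_id
  refine ⟨⟨h1, ?_, ge_of_tendsto' hi fun n => (hφ n).1.2.2.1,
    le_of_tendsto' hi fun n => (hφ n).1.2.2.2⟩, ?_, ?_⟩
  · filter_upwards [ae_diff hlim, ae_all_iff.2 fun n => (hφ n).1.2.1] with x hx hx'
    exact le_of_tendsto' hx.abs hx'
  · filter_upwards [hlim, ae_all_iff.2 fun n => (hφ n).2.1] with x hx hx' hS
    refine tendsto_nhds_unique hx ?_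
    simp only [hx' _ hS, tendsto_const_nhds]
  · filter_upwards [hlim, ae_all_iff.2 fun n => (hφ n).2.2] with x hx hx' hS
    refine tendsto_nhds_unique hx ?_
    simp only [hx' _ hS, tendsto_const_nhds]

/-- The energy is sequentially lower semicontinuous with respect to weak convergence in `H¹`. -/
theorem energy_le_of_tendsto {U : Set (Space d)} [IsFiniteMeasure (volume.restrict U)]
    (hU : IsOpen U) {p : ℕ → L2Hilbert U}
    {q : L2Hilbert U} (hp : ∀ n, p n ∈ hilbertH1 U) (hq : q ∈ hilbertH1 U) (hpq : WeakTendsto p q)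
    {f : ℕ → Space d → ℝ} {f' : Space d → ℝ} (hf : ∀ n, (p n).fst =ᵐ[volume.restrict U] f n)
    (hf' : q.fst =ᵐ[volume.restrict U] f') (hb : ∀ n, ∀ᵐ x ∂(volume.restrict U), |f n x| ≤ 1)
    (hlim : ∀ᵐ x ∂(volume.restrict U), Tendsto (fun n => f n x) atTop (𝓝 (f' x)))
    {g : ℝ → ℝ} (hg : Continuous g) {ε : ℝ} (hε : 0 < ε) {e : ℝ}
    (he : Tendsto (fun n => energy U g ε (f n)) atTop (𝓝 e)) : energy U g ε f' ≤ e := by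
  have hb' : ∀ᵐ x ∂(volume.restrict U), |f' x| ≤ 1 := by
    filter_upwards [hlim, ae_all_iff.2 hb] with x hx hx'
    exact le_of_tendsto' hx.abs hx'
  have hi := tendsto_integral_comp
    (fun n => (Lp.stronglyMeasurable (p n).fst).aestronglyMeasurable.congr (hf n)) hb hlim hg
  have hs : Tendsto (fun n => inner ℝ (p n).snd q.snd) atTop (𝓝 (inner ℝ q.snd q.snd)) :=
    hpq.map (WithLp.sndL 2 ℝ _ _) q.snd
  rw [energy_eq hU hq hf' hb' hg]
  -- The bound 2⟨∇pₙ, ∇q⟩ − ‖∇q‖² ≤ ‖∇pₙ‖² has a weakly continuous left side.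
  have hl : Tendsto (fun n => ε / 2 * (2 * inner ℝ (p n).snd q.snd - ‖q.snd‖ ^ 2) +
      1 / ε * ∫ x in U, g (f n x)) atTop
      (𝓝 (ε / 2 * (2 * inner ℝ q.snd q.snd - ‖q.snd‖ ^ 2) + 1 / ε * ∫ x in U, g (f' x))) :=
    (((hs.const_mul 2).sub_const _).const_mul _).add (hi.const_mul _)
  rw [real_inner_self_eq_norm_sq, two_mul, add_sub_cancel_right] at hl
  refine le_of_tendsto_of_tendsto' hl he fun n => ?_
  rw [energy_eq hU (hp n) (hf n) (hb n) hg]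
  gcongr
  have := norm_sub_sq_real (p n).snd q.snd
  nlinarith [sq_nonneg ‖(p n).snd - q.snd‖]

/-- Phase fields with bounded energy are relatively compact with respect to convergence almost
everywhere, and the energy is lower semicontinuous. -/
theorem IsDesign.exists_subseq (h : IsDesign Ω S₀ S₁) (hΩ : MeasurableSet Ω) {β₁ β₂ : ℝ}
    {φ : ℕ → PhaseFields Ω} (hφ : ∀ n, φ n ∈ admissible Ω S₀ S₁ β₁ β₂) {ψ₀ : ℝ → ℝ}
    (hψ₀ : IsDoubleWell ψ₀) {ε : ℝ} (hε : 0 < ε) {C : ℝ}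
    (hC : ∀ n, energy (Ω \ (S₀ ∪ S₁)) ψ₀ ε (φ n) ≤ C) :
    ∃ φ' ∈ admissible Ω S₀ S₁ β₁ β₂, ∃ σ : ℕ → ℕ, StrictMono σ ∧
      (∀ᵐ x ∂(volume.restrict Ω), Tendsto (fun n => φ (σ n) x) atTop (𝓝 (φ' x))) ∧
      ∀ e, Tendsto (fun n => energy (Ω \ (S₀ ∪ S₁)) ψ₀ ε (φ (σ n))) atTop (𝓝 e) →
        energy (Ω \ (S₀ ∪ S₁)) ψ₀ ε φ' ≤ e := by
  have := h.isFiniteMeasure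
  have := h.isFiniteMeasure_diff
  choose p hp hpφ using fun n => exists_hilbertH1 (hφ n)
  have hM : ∀ n, ‖p n‖ ≤ volume.real (Ω \ (S₀ ∪ S₁)) + 2 / ε * C + 1 := fun n =>
    h.norm_le (hφ n) hψ₀ hε (hC n) (hp n) (hpφ n)
  obtain ⟨q, τ, hτ, hpq⟩ := exists_weakTendsto_subseq hM
  have hq : q ∈ hilbertH1 (Ω \ (S₀ ∪ S₁)) := by
    refine (Submodule.mem_orthogonal' _ _).2 fun y hy => ?_
    refine tendsto_nhds_unique (hpq y) ?_
    have : ∀ n, inner ℝ ((p ∘ τ) n) y = 0 := fun n =>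
      (Submodule.mem_orthogonal' _ _).1 (hp (τ n)) y hy
    simp only [this, tendsto_const_nhds]
  have hst := hpq.tendsto_fst h.isOpen (h.bounded.subset Set.sdiff_subset) h.lipschitz
    (fun n => hp (τ n)) hq (fun n => hM (τ n))
  obtain ⟨κ, hκ, hae⟩ := (tendstoInMeasure_of_tendsto_Lp hst).exists_seq_tendsto_ae
  classical
  -- The weak limit lives on Ω' only. On S₀ and S₁ all φ n agree a.e., so `φ 0` supplies the values
  -- there.
  let f : Space d → ℝ := (Ω \ (S₀ ∪ S₁)).piecewise q.fst (φ 0)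
  have hf : StronglyMeasurable f :=
    StronglyMeasurable.piecewise h.isOpen.measurableSet (Lp.stronglyMeasurable q.fst)
      (Lp.stronglyMeasurable (φ 0))
  have hlim : ∀ᵐ x ∂(volume.restrict Ω),
      Tendsto (fun n => φ (τ (κ n)) x) atTop (𝓝 (f x)) := by
    filter_upwards [h.ae_of_diff hae, h.ae_of_diff (ae_all_iff.2 hpφ),
      ae_all_iff.2 fun n => (hφ n).2.1, ae_all_iff.2 fun n => (hφ n).2.2,
      ae_restrict_mem hΩ] with x h1 h2 h3 h4 hx
    rcases mem_diff_or (S₀ := S₀) (S₁ := S₁) hx with hS | hS | hS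
    · have : f x = φ 0 x := Set.piecewise_eq_of_notMem _ _ _ fun hx' => hx'.2 (.inl hS)
      simp only [this, h3 _ hS, tendsto_const_nhds]
    · have : f x = φ 0 x := Set.piecewise_eq_of_notMem _ _ _ fun hx' => hx'.2 (.inr hS)
      simp only [this, h4 _ hS, tendsto_const_nhds]
    · have : f x = q.fst x := Set.piecewise_eq_of_mem _ _ _ hS
      rw [this]
      have := h1 hS
      simp only [h2 hS] at this
      exact this
  have hm : MemLp f 1 (volume.restrict Ω) := by
    refine .of_bound hf.aestronglyMeasurable 1 ?_
    filter_upwards [hlim, ae_all_iff.2 fun n => (h.isPhase hΩ (hφ n)).bound] with x hx hx'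
    exact le_of_tendsto' hx.abs fun n => hx' _
  have hlim' : ∀ᵐ x ∂(volume.restrict Ω),
      Tendsto (fun n => φ (τ (κ n)) x) atTop (𝓝 (hm.toLp f x)) := by
    filter_upwards [hlim, hm.coeFn_toLp] with x h1 h2
    rwa [h2]
  have hqf : q.fst =ᵐ[volume.restrict (Ω \ (S₀ ∪ S₁))] hm.toLp f := by
    filter_upwards [ae_diff hm.coeFn_toLp, ae_restrict_mem h.isOpen.measurableSet] with x h1 h2
    rw [h1]
    exact (Set.piecewise_eq_of_mem _ _ _ h2).symm
  refine ⟨hm.toLp f, h.mem_admissible_of_tendsto (fun n => hφ (τ (κ n))) hlim'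
    ⟨_, mem_hilbertH1.1 hq, hqf⟩, τ ∘ κ, hτ.comp hκ, hlim', fun e he => ?_⟩
  exact energy_le_of_tendsto h.isOpen (fun n => hp (τ (κ n))) hq (hpq.comp hκ.tendsto_atTop)
    (fun n => hpφ _) hqf (fun n => (hφ _).1.2.1) (ae_diff hlim') hψ₀.continuous hε he

/-- The direct method. -/
theorem IsDesign.exists_isMinOn (h : IsDesign Ω S₀ S₁) (hΩ : MeasurableSet Ω) {β₁ β₂ : ℝ}
    (hne : (admissible Ω S₀ S₁ β₁ β₂).Nonempty) {ψ₀ : ℝ → ℝ}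
    (hψ₀ : IsDoubleWell ψ₀) {ε : ℝ} (hε : 0 < ε) {γ : ℝ} (hγ : 0 < γ) {F : PhaseFields Ω → ℝ}
    {B : ℝ} (hB : ∀ φ ∈ admissible Ω S₀ S₁ β₁ β₂, B ≤ F φ)
    (hF : ∀ (φ : ℕ → PhaseFields Ω) (φ' : PhaseFields Ω),
      (∀ n, φ n ∈ admissible Ω S₀ S₁ β₁ β₂) → φ' ∈ admissible Ω S₀ S₁ β₁ β₂ →
      (∀ᵐ x ∂(volume.restrict Ω), Tendsto (fun n => φ n x) atTop (𝓝 (φ' x))) →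
      Tendsto (fun n => F (φ n)) atTop (𝓝 (F φ'))) :
    ∃ φ ∈ admissible Ω S₀ S₁ β₁ β₂,
      IsMinOn (fun φ : PhaseFields Ω => F φ + γ * energy (Ω \ (S₀ ∪ S₁)) ψ₀ ε φ)
        (admissible Ω S₀ S₁ β₁ β₂) φ := by
  set I : PhaseFields Ω → ℝ := fun φ => F φ + γ * energy (Ω \ (S₀ ∪ S₁)) ψ₀ ε φ with hI
  have hbdd : BddBelow (I '' admissible Ω S₀ S₁ β₁ β₂) := by
    refine ⟨B, ?_⟩
    rintro _ ⟨φ, hφ, rfl⟩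
    exact (hB φ hφ).trans (le_add_of_nonneg_right
      (mul_nonneg hγ.le (h.energy_nonneg hφ hψ₀ hε)))
  obtain ⟨s, hs, hs', hs''⟩ := exists_seq_tendsto_sInf (hne.image I) hbdd
  choose φ hφ hφs using hs''
  -- The values s n decrease and F ≥ B, hence this bound.
  have hC : ∀ n, energy (Ω \ (S₀ ∪ S₁)) ψ₀ ε (φ n) ≤ (s 0 - B) / γ := fun n => by
    rw [le_div_iff₀ hγ, mul_comm]
    have h1 : F (φ n) + γ * energy (Ω \ (S₀ ∪ S₁)) ψ₀ ε (φ n) = s n := hφs n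
    have := hs (Nat.zero_le n)
    linarith [hB _ (hφ n)]
  obtain ⟨φ', hφ', σ, hσ, hlim, hle⟩ := h.exists_subseq hΩ hφ hψ₀ hε hC
  refine ⟨φ', hφ', fun θ hθ => ?_⟩
  have h1 := hF _ φ' (fun n => hφ (σ n)) hφ' hlim
  -- Along σ the energies equal (s − F)/γ and converge because s and F do; lower semicontinuity
  -- applies to this limit.
  have h2 := hle _ ((((hs'.comp hσ.tendsto_atTop).sub h1).div_const γ).congr fun n => by
    have h1 : F (φ (σ n)) + γ * energy (Ω \ (S₀ ∪ S₁)) ψ₀ ε (φ (σ n)) = s (σ n) := hφs _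
    rw [Function.comp_apply, ← h1, add_sub_cancel_left, mul_div_cancel_left₀ _ hγ.ne'])
  have h3 : I φ' ≤ sInf (I '' admissible Ω S₀ S₁ β₁ β₂) := by
    rw [le_div_iff₀ hγ] at h2
    simp only [hI]
    linarith
  exact h3.trans (csInf_le hbdd ⟨θ, hθ, rfl⟩)

/-- Minimization of a function of finitely many eigenvalues plus the energy. -/
theorem IsDesign.exists_minimizer (h : IsDesign Ω S₀ S₁) (hΩ : MeasurableSet Ω) {β₁ β₂ : ℝ}
    (hne : (admissible Ω S₀ S₁ β₁ β₂).Nonempty) {ψ₀ : ℝ → ℝ}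
    (hψ₀ : IsDoubleWell ψ₀) {ε : ℝ} (hε : 0 < ε) {γ : ℝ} (hγ : 0 < γ)
    {S : Set (L2Pair Ω)} {k₀ : ℕ} (hS : IsSpectralSpace S k₀) {m M : ℝ} {a b c : ℝ → ℝ}
    (habc : CoefficientBounds m M a b c) {l : ℕ} {κ : Fin l → ℕ} (hκ : ∀ j, k₀ ≤ κ j)
    {Ψ : (Fin l → ℝ) → ℝ} (hΨ : ContinuousOn Ψ {x | ∀ j, 0 < x j}) :
    ∃ φ ∈ admissible Ω S₀ S₁ β₁ β₂, IsMinOn (fun φ : PhaseFields Ω =>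
      Ψ (fun j => listedEigenvalue S a b c φ (κ j)) + γ * energy (Ω \ (S₀ ∪ S₁)) ψ₀ ε φ)
        (admissible Ω S₀ S₁ β₁ β₂) φ := by
  have hphase : ∀ φ ∈ admissible Ω S₀ S₁ β₁ β₂, IsPhase Ω φ := fun φ => h.isPhase hΩ
  -- A compact box inside the open orthant containing all eigenvalue vectors; it bounds Ψ from below
  -- where needed.
  let K : Set (Fin l → ℝ) := Set.univ.pi fun j => Set.Icc (m / M * referenceEigenvalue S (κ j))
    (3 * M / m * (referenceEigenvalue S (κ j) + 1))
  have hK : IsCompact K := isCompact_univ_pi fun _ => isCompact_Icc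
  have hKpos : K ⊆ {x | ∀ j, 0 < x j} := fun x hx j =>
    (mul_pos (div_pos habc.pos (habc.pos.trans_le habc.le_bound)) (hS.pos _ (hκ j))).trans_le
      (hx j trivial).1
  obtain ⟨B, hB⟩ := hK.bddBelow_image (hΨ.mono hKpos)
  refine h.exists_isMinOn hΩ hne hψ₀ hε hγ (B := B)
    (fun φ hφ => hB ⟨_, fun j _ => (hS.eigenvalue_bounds habc (hphase φ hφ) _).2, rfl⟩)
    fun φ φ' hφ hφ' hlim => ?_
  have hopen : IsOpen {x : Fin l → ℝ | ∀ j, 0 < x j} := by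
    simp only [Set.ofPred_forall]
    exact isOpen_iInter_of_finite fun j => isOpen_lt continuous_const (continuous_apply j)
  have hc : ContinuousAt Ψ (fun j => listedEigenvalue S a b c φ' (κ j)) :=
    hΨ.continuousAt (hopen.mem_nhds fun j => hS.eigenvalue_pos habc (hphase φ' hφ') (hκ j))
  exact hc.tendsto.comp (tendsto_pi_nhds.2 fun j =>
    hS.tendsto_eigenvalue habc (fun n => hphase _ (hφ n)) (hphase _ hφ') hlim (κ j))

end Admissible

end

end PhaseField

theorem mainTheorem9
    -- the design domain
    (d : ℕ) (hd : 1 ≤ d) (Ω : Set (PhaseField.Space d))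
    (hΩ_open : IsOpen Ω) (hΩ_conn : IsConnected Ω) (hΩ_bdd : Bornology.IsBounded Ω)
    (hΩ_lip : PhaseField.HasLipschitzBoundary Ω)
    -- the regions where the pure phases are prescribed
    (S₀ S₁ : Set (PhaseField.Space d))
    (hS₀ : NullMeasurableSet S₀ volume) (hS₁ : NullMeasurableSet S₁ volume)
    (hS₀Ω : S₀ ⊆ Ω) (hS₁Ω : S₁ ⊆ Ω) (hS : Disjoint S₀ S₁)
    (hΩ'_open : IsOpen (Ω \ (S₀ ∪ S₁)))
    (hΩ'_lip : PhaseField.HasLipschitzBoundary (Ω \ (S₀ ∪ S₁)))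
    -- the bounds on the mean value
    (β₁ β₂ : ℝ) (hβ : β₁ ≤ β₂) (hβ₁ : β₁ ∈ Set.Ioo (-1 : ℝ) 1) (hβ₂ : β₂ ∈ Set.Ioo (-1 : ℝ) 1)
    -- the interface parameter, the weight, the potential and the coefficients
    (ε : ℝ) (hε : 0 < ε) (γ : ℝ) (hγ : 0 < γ)
    (ψ₀ : ℝ → ℝ) (hψ₀ : PhaseField.IsDoubleWell ψ₀)
    (a b c : ℝ → ℝ) (habc : PhaseField.AreCoefficients a b c)
    -- the selection of eigenvalues and the cost function
    (l : ℕ) (i : Fin l → ℕ) (hi : StrictMono i) (hi_pos : ∀ j, 1 ≤ i j)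
    (Ψ : (Fin l → ℝ) → ℝ) (hΨ : ContDiffOn ℝ 1 Ψ {x | ∀ j, 0 < x j}) :
    -- the Dirichlet problem is well posed and has a minimizer
    ((∀ φ ∈ PhaseField.constraintG Ω S₀ S₁ β₁ β₂ ∩ PhaseField.constraintU Ω S₀ S₁,
        PhaseField.IsEigenvalueList (PhaseField.dirichletEigenfunctions Ω a b c φ)
          (fun n => PhaseField.dirichletEigenvalue Ω a b c φ (n + 1)) ∧
        ∀ k, 1 ≤ k → 0 < PhaseField.dirichletEigenvalue Ω a b c φ k) ∧
      ∃ φD ∈ PhaseField.constraintG Ω S₀ S₁ β₁ β₂ ∩ PhaseField.constraintU Ω S₀ S₁,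
        IsMinOn (PhaseField.dirichletObjective Ω S₀ S₁ a b c ψ₀ ε γ i Ψ)
          (PhaseField.constraintG Ω S₀ S₁ β₁ β₂ ∩ PhaseField.constraintU Ω S₀ S₁) φD) ∧
    -- the Neumann problem is well posed and has a minimizer
    ((∀ φ ∈ PhaseField.constraintG Ω S₀ S₁ β₁ β₂ ∩ PhaseField.constraintU Ω S₀ S₁,
        PhaseField.IsEigenvalueList (PhaseField.neumannEigenfunctions Ω a c φ)
          (fun n => PhaseField.neumannEigenvalue Ω a c φ n) ∧
        PhaseField.neumannEigenvalue Ω a c φ 0 = 0 ∧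
        ∀ k, 1 ≤ k → 0 < PhaseField.neumannEigenvalue Ω a c φ k) ∧
      ∃ φN ∈ PhaseField.constraintG Ω S₀ S₁ β₁ β₂ ∩ PhaseField.constraintU Ω S₀ S₁,
        IsMinOn (PhaseField.neumannObjective Ω S₀ S₁ a c ψ₀ ε γ i Ψ)
          (PhaseField.constraintG Ω S₀ S₁ β₁ β₂ ∩ PhaseField.constraintU Ω S₀ S₁) φN) := by
  have hdesign : PhaseField.IsDesign Ω S₀ S₁ := ⟨hΩ_bdd, hS₀, hS₁, hS, hΩ'_open, hΩ'_lip⟩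
  have hΩ := hΩ_open.measurableSet
  have hne := hdesign.nonempty_admissible hβ hβ₁
  have hvol : volume Ω ≠ 0 := (hΩ_open.measure_pos volume hΩ_conn.nonempty).ne'
  obtain ⟨m, M, hbounds⟩ := habc.exists_bounds
  have hD := PhaseField.isSpectralSpace_sobolevH10 hd hΩ_open hΩ_conn hΩ_bdd hΩ_lip
  have hN := PhaseField.isSpectralSpace_sobolevH1 hd hΩ_open hΩ_conn hΩ_bdd hΩ_lip
  have hNeq : ∀ (φ : PhaseField.PhaseFields Ω) k, PhaseField.neumannEigenvalue Ω a c φ k =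
      PhaseField.listedEigenvalue (PhaseField.sobolevH1 Ω) a (fun _ => 0) c φ k := fun φ k => by
    rw [PhaseField.neumannEigenvalue, PhaseField.neumannEigenfunctions_eq]
    rfl
  refine ⟨⟨fun φ hφ => ?_, ?_⟩, ⟨fun φ hφ => ?_, ?_⟩⟩
  · have hφ' := hdesign.isPhase hΩ hφ
    exact ⟨hD.isEigenvalueList hbounds hφ',
      fun k _ => hD.eigenvalue_pos hbounds hφ' (Nat.zero_le (k - 1))⟩
  -- Dirichlet eigenvalues are counted from 1 but listed from 0, hence i j − 1.
  · exact hdesign.exists_minimizer hΩ hne hψ₀ hε hγ hD hbounds (κ := fun j => i j - 1)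
      (fun _ => Nat.zero_le _) hΨ.continuousOn
  · have hφ' := hdesign.isPhase hΩ hφ
    simp only [hNeq]
    refine ⟨?_, PhaseField.listedEigenvalue_neumann_zero hN hΩ_bdd hvol hbounds.neumann hφ',
      fun k hk => hN.eigenvalue_pos hbounds.neumann hφ' hk⟩
    rw [PhaseField.neumannEigenfunctions_eq]
    exact hN.isEigenvalueList hbounds.neumann hφ'
  -- Indices at least 1 keep the eigenvalue μ₀ = 0 out of the arguments of Ψ.
  · obtain ⟨φN, hφN, hmin⟩ := hdesign.exists_minimizer hΩ hne hψ₀ hε hγ hN hbounds.neumann hi_pos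
      hΨ.continuousOn
    refine ⟨φN, hφN, ?_⟩
    unfold PhaseField.neumannObjective
    simp only [hNeq]
    exact hmin
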